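/- For a finite digraph $G=(V,E)$ with transitive closure $G^{\star}$ and an integer $k\ge 1$, a $k$-TC-spanner of $G$ is a subgraph $H\subseteq G^{\star}$ on the vertex set $V$ such that $\mathrm{dist}_H(u,v)\le k$ for every edge $(u,v)$ of $G^{\star}$, where $\mathrm{dist}_H(u,v)$ is the least number of edges of a directed path from $u$ to $v$ in $H$. There is a deterministic algorithm, with running time polynomial in $n$, that given an $n$-vertex digraph $G$ and an integer $k\ge 1$ outputs a $k$-TC-spanner of $G$ whose number of edges is at most $\widetilde{O}(\max\{1,n/k^3\})$ times the minimum number of edges of a $k$-TC-spanner of $G$; in particular, the approximation ratio is $\widetilde{O}(n/k^3)$ for $k\le n^{1/3}$. Explicitly, there are absolute constants $C$ and $c$ such that the ratio is at most $C\,(\log(n+2))^{c}\,\max\{1,n/k^3\}$ for all $n$, $G$ and $k$. -/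

import Mathlib

namespace TCSpanner

/-! ### Digraphs: distance, transitive closure, TC-spanners -/

/-- `HasWalk G m u v`: the digraph `G` has a directed walk with exactly `m` edges from `u` to `v`. -/
inductive HasWalk {V : Type*} (G : Digraph V) : ℕ → V → V → Prop
  | nil (u : V) : HasWalk G 0 u u
  | cons {m : ℕ} {u v w : V} : G.Adj u v → HasWalk G m v w → HasWalk G (m + 1) u w

/-- The directed distance `dist_G(u, v)`: the least number of edges of a directed walk from `u` to
`v`, and `⊤` if there is none. -/
noncomputable def dist {V : Type*} (G : Digraph V) (u v : V) : ℕ∞ :=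
  ⨅ (m : ℕ) (_ : HasWalk G m u v), (m : ℕ∞)

theorem dist_le_iff {V : Type*} (G : Digraph V) (u v : V) (k : ℕ) :
    dist G u v ≤ (k : ℕ∞) ↔ ∃ m : ℕ, m ≤ k ∧ HasWalk G m u v := by
  constructor
  · intro h
    by_contra hcon
    push Not at hcon
    have h1 : ((k + 1 : ℕ) : ℕ∞) ≤ dist G u v := by
      refine le_iInf₂ fun m hm => ?_
      have : ¬ m ≤ k := fun hk => hcon m hk hm
      exact_mod_cast (by omega : k + 1 ≤ m)
    have h2 : k + 1 ≤ k := by exact_mod_cast h1.trans h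
    omega
  · rintro ⟨m, hm, hw⟩
    exact (iInf₂_le m hw).trans (by exact_mod_cast hm)

/-- The transitive closure of a digraph: `(u, v)` is an edge if and only if `G` has a directed walk
from `u` to `v` with at least one edge. -/
def transClosure {V : Type*} (G : Digraph V) : Digraph V where
  Adj := Relation.TransGen G.Adj

/-- `H` is a `k`-TC-spanner of `G`: it is a subgraph of the transitive closure of `G` (on the same
vertex set) in which any `(u, v)` of the transitive closure are at distance at most `k`. -/
def IsTCSpanner {V : Type*} (k : ℕ) (G H : Digraph V) : Prop :=
  H ≤ transClosure G ∧ ∀ u v : V, (transClosure G).Adj u v → dist H u v ≤ (k : ℕ∞)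

/-- The number of (directed) edges of a digraph. -/
noncomputable def numEdges {V : Type*} (G : Digraph V) : ℕ :=
  {e : V × V | G.Adj e.1 e.2}.ncard

/-! ### A random access machine with a step count

Programs of a small structured language over natural numbers. The store has countably many scalar
registers, and countably many arrays whose cells are addressed by a pair of natural numbers. The
arithmetic operations are addition and truncated subtraction (there is no multiplication), so that
in `t` steps the numbers grow to `O(t)` bits at most beyond the size of the input numbers; unit cost
per operation is thus polynomially related to time on a Turing machine. -/

/-- The contents of the store. -/
structure Store where
  /-- the scalar registers -/
  reg : ℕ → ℕ
  /-- `arr a i j` is the cell with address `(i, j)` of the array number `a` -/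
  arr : ℕ → ℕ → ℕ → ℕ

/-- Expressions. -/
inductive Exp
  /-- a constant -/
  | lit (c : ℕ)
  /-- the register number `x` -/
  | var (x : ℕ)
  /-- the cell with address `(i, j)` of the array number `a` -/
  | get (a : ℕ) (i j : Exp)
  /-- the sum -/
  | add (d e : Exp)
  /-- the difference, or zero if it is negative -/
  | sub (d e : Exp)

/-- The value of an expression. -/
def Exp.eval (s : Store) : Exp → ℕ
  | .lit c => c
  | .var x => s.reg x
  | .get a i j => s.arr a (i.eval s) (j.eval s)
  | .add d e => d.eval s + e.eval s
  | .sub d e => d.eval s - e.eval s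

/-- The number of steps it takes to evaluate an expression: one for each constant, register access,
array access and arithmetic operation. -/
def Exp.cost : Exp → ℕ
  | .lit _ => 1
  | .var _ => 1
  | .get _ i j => i.cost + j.cost + 1
  | .add d e => d.cost + e.cost + 1
  | .sub d e => d.cost + e.cost + 1

/-- Programs. A program is a finite object that does not depend on the input. -/
inductive Prog
  /-- do nothing -/
  | skip
  /-- assign the value of `e` to the register number `x` -/
  | assign (x : ℕ) (e : Exp)
  /-- assign the value of `e` to the cell with address `(i, j)` of the array number `a` -/
  | put (a : ℕ) (i j e : Exp)
  /-- sequential composition -/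
  | seq (p q : Prog)
  /-- run `p` if the value of `e` is nonzero, and `q` otherwise -/
  | ite (e : Exp) (p q : Prog)
  /-- run `p` again and again as long as the value of `e` is nonzero -/
  | while (e : Exp) (p : Prog)

/-- The store after assigning `c` to the register `x`. -/
def Store.setReg (s : Store) (x c : ℕ) : Store where
  reg y := if y = x then c else s.reg y
  arr := s.arr

/-- The store after assigning `c` to the cell `(i, j)` of the array `a`. -/
def Store.setArr (s : Store) (a i j c : ℕ) : Store where
  reg := s.reg
  arr a' i' j' := if a' = a ∧ i' = i ∧ j' = j then c else s.arr a' i' j'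

/-- `Run p s t s'`: the program `p`, started with the store `s`, terminates after exactly `t` steps
with the store `s'`. -/
inductive Run : Prog → Store → ℕ → Store → Prop
  | skip (s : Store) : Run .skip s 1 s
  | assign (x : ℕ) (e : Exp) (s : Store) :
      Run (.assign x e) s (e.cost + 1) (s.setReg x (e.eval s))
  | put (a : ℕ) (i j e : Exp) (s : Store) :
      Run (.put a i j e) s (i.cost + j.cost + e.cost + 1)
        (s.setArr a (i.eval s) (j.eval s) (e.eval s))
  | seq {p q : Prog} {s s' s'' : Store} {t t' : ℕ} :
      Run p s t s' → Run q s' t' s'' → Run (.seq p q) s (t + t') s''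
  | iteTrue {e : Exp} {p q : Prog} {s s' : Store} {t : ℕ} :
      e.eval s ≠ 0 → Run p s t s' → Run (.ite e p q) s (e.cost + 1 + t) s'
  | iteFalse {e : Exp} {p q : Prog} {s s' : Store} {t : ℕ} :
      e.eval s = 0 → Run q s t s' → Run (.ite e p q) s (e.cost + 1 + t) s'
  | whileTrue {e : Exp} {p : Prog} {s s' s'' : Store} {t t' : ℕ} :
      e.eval s ≠ 0 → Run p s t s' → Run (.while e p) s' t' s'' →
        Run (.while e p) s (e.cost + 1 + t + t') s''
  | whileFalse {e : Exp} {p : Prog} {s : Store} :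
      e.eval s = 0 → Run (.while e p) s (e.cost + 1) s

/-- The machine is deterministic: a program has at most one terminating run from a given store. -/
theorem Run.deterministic {p : Prog} {s s₁ s₂ : Store} {t₁ t₂ : ℕ} (h₁ : Run p s t₁ s₁)
    (h₂ : Run p s t₂ s₂) : t₁ = t₂ ∧ s₁ = s₂ := by
  induction h₁ generalizing t₂ s₂ with
  | skip s => cases h₂; exact ⟨rfl, rfl⟩
  | assign x e s => cases h₂; exact ⟨rfl, rfl⟩
  | put a i j e s => cases h₂; exact ⟨rfl, rfl⟩
  | seq _ _ ih ih' =>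
    cases h₂ with
    | seq h h' =>
      obtain ⟨rfl, rfl⟩ := ih h
      obtain ⟨rfl, rfl⟩ := ih' h'
      exact ⟨rfl, rfl⟩
  | iteTrue he _ ih =>
    cases h₂ with
    | iteTrue _ h => obtain ⟨rfl, rfl⟩ := ih h; exact ⟨rfl, rfl⟩
    | iteFalse he' _ => exact absurd he' he
  | iteFalse he _ ih =>
    cases h₂ with
    | iteTrue he' _ => exact absurd he he'
    | iteFalse _ h => obtain ⟨rfl, rfl⟩ := ih h; exact ⟨rfl, rfl⟩
  | whileTrue he _ _ ih ih' =>
    cases h₂ with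
    | whileTrue _ h h' =>
      obtain ⟨rfl, rfl⟩ := ih h
      obtain ⟨rfl, rfl⟩ := ih' h'
      exact ⟨rfl, rfl⟩
    | whileFalse he' => exact absurd he' he
  | whileFalse he =>
    cases h₂ with
    | whileTrue he' _ _ => exact absurd he he'
    | whileFalse _ => exact ⟨rfl, rfl⟩

/-! ### Input and output of a TC-spanner algorithm -/

open Classical in
/-- The initial store for the input `(G, k)`: register `0` holds the number `n` of vertices,
register `1` holds `k`, array `0` holds the adjacency matrix of `G`, and all else is zero. -/
noncomputable def inputStore {n : ℕ} (G : Digraph (Fin n)) (k : ℕ) : Store where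
  reg x := if x = 0 then n else if x = 1 then k else 0
  arr a i j := if a = 0 ∧ ∃ (hi : i < n) (hj : j < n), G.Adj ⟨i, hi⟩ ⟨j, hj⟩ then 1 else 0

/-- The digraph on `n` vertices whose adjacency matrix is read off from array `1`
(a nonzero entry stands for an edge). -/
def outputGraph (n : ℕ) (s : Store) : Digraph (Fin n) where
  Adj u v := s.arr 1 u v ≠ 0

/-- `Approximates p T ρ`: for every digraph `G` on `n` vertices and every integer `k ≥ 1`, the
program `p` on input `(G, k)` stops after at most `T n` steps and outputs a `k`-TC-spanner of `G`
whose number of edges is at most `ρ n k` times that of any (hence of a smallest) `k`-TC-spanner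
of `G`. -/
def Approximates (p : Prog) (T : ℕ → ℕ) (ρ : ℕ → ℕ → ℝ) : Prop :=
  ∀ (n : ℕ) (G : Digraph (Fin n)) (k : ℕ), 1 ≤ k →
    ∃ (t : ℕ) (s : Store), Run p (inputStore G k) t s ∧ t ≤ T n ∧
      IsTCSpanner k G (outputGraph n s) ∧
      ∀ H : Digraph (Fin n), IsTCSpanner k G H →
        (numEdges (outputGraph n s) : ℝ) ≤ ρ n k * (numEdges H : ℝ)

end TCSpanner

namespace TCSpanner

/-! ### A language of bounded iterations, compiled to the random access machine -/

/-! Every strong component is collapsed to its least vertex. Edges between these representatives and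
the other vertices of their components number at most twice the optimum
(`IsTCSpanner.numEdges_star_le`) and cost one step at either end of a path, so it remains to reach
distance K = k - 2 in the strict order `repLt` on representatives. Two lower bounds for the optimum
drive the estimate: every spanner needs a separate edge for each cover relation
(`IsTCSpanner.numEdges_cover_le`), and it has at least N edges, where N is the number of non-maximal
representatives (`IsTCSpanner.numNonmax_le`).

Let L = log₂ n + 1, rounded down, and let D be about k / L. Disjoint chains of exactly D elements
are extracted until the remaining elements contain none; there are at most n / D of them. Shortcuts
of lengths 1, 2, 4, ... along the chains cost at most N L edges and bring any two elements of a
chain within L steps of each other. Together with the cover relation they form the starting graph.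

A pair is bad if its distance exceeds K. The key point is `IsChained.exists_fixes`: on a shortest
walk for a bad pair, the last D L + 2 D + 1 vertices meet at least D different chains, because fewer
than D of them avoid all chains and each chain is met at most L + 1 times. For each of the first D
vertices x and each of these chains, the edge from x to the first element of the chain above x
repairs the pair. Thus each bad pair is repaired by D² of the at most N · n / D candidates, and some
candidate repairs a fraction D³ / (N n) of all bad pairs (`IsChained.numBad_mul_le`). As in greedy
set cover, adding the best edge repeatedly leaves no bad pair after about (N n / D³) log n² edges
(`IsChained.potential_step`, `IsChained.greedy`). Relative to the optimum this is n / D³ up to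
logarithms, hence n / k³ up to logarithms. If D = 0, then k is O(log n), and the loop-free
transitive closure, of ratio n, is good enough.

For the running time, the algorithm is written in a language whose only iterations are sums and
loops of length n, so that compilation to the machine yields a polynomial bound by structural
induction (`Tm.comp_computes`, `Cmd.realize`). -/

/-- Terms with bounded sums. Variable `0` holds the number of vertices and bounds all sums. -/
inductive Tm
  | lit (c : ℕ)
  | var (x : ℕ)
  | get (a : ℕ) (i j : Tm)
  | add (d e : Tm)
  | sub (d e : Tm)
  | ite (c d e : Tm)
  /-- the sum of `t` over all values below the value of variable `0` of the variable `x + 2` -/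
  | sum (x : ℕ) (t : Tm)

/-- The value of a term, given the arrays and the values of the variables. -/
def Tm.eval (A : ℕ → ℕ → ℕ → ℕ) : Tm → (ℕ → ℕ) → ℕ
  | .lit c, _ => c
  | .var x, ρ => ρ x
  | .get a i j, ρ => A a (i.eval A ρ) (j.eval A ρ)
  | .add d e, ρ => d.eval A ρ + e.eval A ρ
  | .sub d e, ρ => d.eval A ρ - e.eval A ρ
  | .ite c d e, ρ => if c.eval A ρ ≠ 0 then d.eval A ρ else e.eval A ρ
  | .sum x t, ρ => ∑ i ∈ Finset.range (ρ 0), t.eval A (Function.update ρ (x + 2) i)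

/-- A loop that runs through all values of the register `x` below the value of register `0`. -/
def Prog.for (x : ℕ) (p : Prog) : Prog :=
  .seq (.assign x (.lit 0))
    (.while (.sub (.var 0) (.var x)) (.seq p (.assign x (.add (.var x) (.lit 1)))))

theorem Store.setReg_reg_self (s : Store) (x c : ℕ) : (s.setReg x c).reg x = c := by
  simp [Store.setReg]

theorem Store.setReg_reg_of_ne (s : Store) {x y : ℕ} (c : ℕ) (h : y ≠ x) :
    (s.setReg x c).reg y = s.reg y := by
  simp [Store.setReg, h]

theorem Store.setArr_reg (s : Store) (a i j c : ℕ) : (s.setArr a i j c).reg = s.reg := rfl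

/-- Induction on the number m of passes left. The invariant has to survive a change of the counter,
so that the increment preserves it. The 8 steps added to each pass are 4 for the test and 4 for the
increment; the final 4 are the failing test. -/
theorem Run.for_aux {x n c : ℕ} (p : Prog) (I : ℕ → Store → Prop)
    (hn : ∀ i s, I i s → s.reg 0 = n)
    (hx : ∀ i s c, I i s → I i (s.setReg x c))
    (hp : ∀ i s, i < n → I i s → s.reg x = i →
      ∃ t s', t ≤ c ∧ Run p s t s' ∧ I (i + 1) s' ∧ s'.reg x = i) :
    ∀ m i s, i + m = n → I i s → s.reg x = i → ∃ t s', t ≤ m * (c + 8) + 4 ∧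
      Run (.while (.sub (.var 0) (.var x)) (.seq p (.assign x (.add (.var x) (.lit 1))))) s t s' ∧
      I n s' := by
  intro m
  induction m with
  | zero =>
    intro i s hi hI hxi
    refine ⟨_, s, ?_, Run.whileFalse ?_, ?_⟩
    · simp [Exp.cost]
    · simp [Exp.eval, hn i s hI, hxi]; omega
    · rw [← hi]; exact hI
  | succ m ih =>
    intro i s hi hI hxi
    obtain ⟨t, s', ht, hr, hI', hx'⟩ := hp i s (by omega) hI hxi
    have hI2 := hx (i + 1) s' (i + 1) hI'
    obtain ⟨t2, s2, ht2, hr2, hI3⟩ := ih (i + 1) _ (by omega) hI2 (Store.setReg_reg_self _ _ _)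
    rw [show i + 1 = (Exp.add (.var x) (.lit 1)).eval s' by simp [Exp.eval, hx']] at hr2
    refine ⟨_, s2, ?_, Run.whileTrue ?_ (Run.seq hr (Run.assign _ _ _)) hr2, hI3⟩
    · simp only [Exp.cost, add_mul, one_mul]; omega
    · simp [Exp.eval, hn i s hI, hxi]; omega

/-- The loop rule: `I i` holds before the `i`-th pass. -/
theorem Run.for {x n c : ℕ} {p : Prog} (I : ℕ → Store → Prop)
    (hn : ∀ i s, I i s → s.reg 0 = n)
    (hx : ∀ i s c, I i s → I i (s.setReg x c))
    (hp : ∀ i s, i < n → I i s → s.reg x = i →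
      ∃ t s', t ≤ c ∧ Run p s t s' ∧ I (i + 1) s' ∧ s'.reg x = i)
    (s : Store) (hs : I 0 s) :
    ∃ t s', t ≤ n * (c + 8) + 6 ∧ Run (.for x p) s t s' ∧ I n s' := by
  obtain ⟨t, s', ht, hr, hI⟩ := Run.for_aux p I hn hx hp n 0 (s.setReg x 0) (by omega)
    (hx _ _ _ hs) (Store.setReg_reg_self _ _ _)
  refine ⟨_, s', ?_, Run.seq (Run.assign _ _ _) hr, hI⟩
  simp only [Exp.cost]; omega

/-- The program that computes a term. The variable `x` is the register `2 * x`, and the registers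
`2 * b + 1`, `2 * b + 3`, … hold intermediate values; the result is in the first of them. -/
def Tm.comp : Tm → ℕ → Prog
  | .lit c, b => .assign (2 * b + 1) (.lit c)
  | .var x, b => .assign (2 * b + 1) (.var (2 * x))
  | .get a i j, b => .seq (i.comp b) (.seq (j.comp (b + 1))
      (.assign (2 * b + 1) (.get (2 * a) (.var (2 * b + 1)) (.var (2 * b + 3)))))
  | .add d e, b => .seq (d.comp b) (.seq (e.comp (b + 1))
      (.assign (2 * b + 1) (.add (.var (2 * b + 1)) (.var (2 * b + 3)))))
  | .sub d e, b => .seq (d.comp b) (.seq (e.comp (b + 1))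
      (.assign (2 * b + 1) (.sub (.var (2 * b + 1)) (.var (2 * b + 3)))))
  | .ite c d e, b => .seq (c.comp b) (.ite (.var (2 * b + 1)) (d.comp b) (e.comp b))
  | .sum x t, b =>
    .seq (.assign (2 * b + 1) (.lit 0)) (.seq (.assign (2 * b + 3) (.var (2 * (x + 2))))
      (.seq (.for (2 * (x + 2)) (.seq (t.comp (b + 2))
        (.assign (2 * b + 1) (.add (.var (2 * b + 1)) (.var (2 * b + 5))))))
      (.assign (2 * (x + 2)) (.var (2 * b + 3)))))

/-- The values of the variables of a term. -/
def Store.env (s : Store) : ℕ → ℕ := fun x => s.reg (2 * x)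

/-- The arrays that are visible to a term. -/
def Store.arrs (s : Store) : ℕ → ℕ → ℕ → ℕ := fun a => s.arr (2 * a)

/-- The stores differ at most in the registers for intermediate values from number `b` on. -/
def Store.SameBelow (b : ℕ) (s s' : Store) : Prop :=
  s'.arr = s.arr ∧ ∀ r, (∀ b', b ≤ b' → r ≠ 2 * b' + 1) → s'.reg r = s.reg r

theorem Store.SameBelow.env {b : ℕ} {s s' : Store} (h : s.SameBelow b s') : s'.env = s.env := by
  funext x
  exact h.2 _ fun b' _ => by omega

theorem Store.SameBelow.arrs {b : ℕ} {s s' : Store} (h : s.SameBelow b s') : s'.arrs = s.arrs := by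
  funext x
  simp [Store.arrs, h.1]

theorem Store.SameBelow.reg_zero {b : ℕ} {s s' : Store} (h : s.SameBelow b s') :
    s'.reg 0 = s.reg 0 := h.2 _ fun b' _ => by omega

theorem Store.SameBelow.reg_lt {b c : ℕ} {s s' : Store} (h : s.SameBelow b s') (hc : c < b) :
    s'.reg (2 * c + 1) = s.reg (2 * c + 1) := h.2 _ fun b' _ => by omega

theorem Store.SameBelow.trans {b : ℕ} {s s' s'' : Store} (h : s.SameBelow b s')
    (h' : s'.SameBelow b s'') : s.SameBelow b s'' :=
  ⟨h'.1.trans h.1, fun r hr => (h'.2 r hr).trans (h.2 r hr)⟩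

theorem Store.SameBelow.mono {b c : ℕ} {s s' : Store} (h : s.SameBelow c s') (hb : b ≤ c) :
    s.SameBelow b s' :=
  ⟨h.1, fun r hr => h.2 r fun b' hb' => hr b' (hb.trans hb')⟩

theorem Store.SameBelow.setReg {b : ℕ} (s : Store) {x : ℕ} (c : ℕ) (h : ∃ b', b ≤ b' ∧ x = 2 * b' + 1) :
    s.SameBelow b (s.setReg x c) := by
  obtain ⟨b', hb', rfl⟩ := h
  exact ⟨rfl, fun r hr => Store.setReg_reg_of_ne _ _ (hr _ hb')⟩

/-- The program `p` computes the value of the term `t` into the intermediate register `b`. -/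
def Computes (t : Tm) (p : ℕ → Prog) (P : Polynomial ℕ) : Prop :=
  ∀ b s, ∃ m s', m ≤ P.eval (s.reg 0) ∧ Run (p b) s m s' ∧ s.SameBelow b s' ∧
    s'.reg (2 * b + 1) = t.eval s.arrs s.env

/-- The first operand waits in register `2 * b + 1` while the second is computed from base `b + 1`,
which by `SameBelow` cannot disturb it. This serves `get`, `add` and `sub` alike. -/
theorem computes_binary {d e r : Tm} {p q : ℕ → Prog} {P Q : Polynomial ℕ} {E : ℕ → Exp}
    (hp : Computes d p P) (hq : Computes e q Q) (C : ℕ) (hC : ∀ b, (E b).cost ≤ C)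
    (hE : ∀ b s, s.reg (2 * b + 1) = d.eval s.arrs s.env → s.reg (2 * b + 3) = e.eval s.arrs s.env →
      (E b).eval s = r.eval s.arrs s.env) :
    Computes r (fun b => .seq (p b) (.seq (q (b + 1)) (.assign (2 * b + 1) (E b))))
      (P + (Q + Polynomial.C (C + 1))) := by
  intro b s
  obtain ⟨m1, s1, h1, r1, b1, v1⟩ := hp b s
  obtain ⟨m2, s2, h2, r2, b2, v2⟩ := hq (b + 1) s1
  have b3 := Store.SameBelow.setReg (b := b) s2 (x := 2 * b + 1) ((E b).eval s2) ⟨b, le_rfl, rfl⟩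
  refine ⟨_, _, ?_, Run.seq r1 (Run.seq r2 (Run.assign _ _ _)),
    b1.trans ((b2.mono (by omega)).trans b3), ?_⟩
  · rw [b1.reg_zero] at h2
    simp only [Polynomial.eval_add, Polynomial.eval_C]
    have := hC b
    omega
  · rw [Store.setReg_reg_self, hE b s2]
    · rw [b2.env, b2.arrs, b1.env, b1.arrs]
    · rw [b2.reg_lt (by omega), v1, b2.env, b2.arrs, b1.env, b1.arrs]
    · rw [show 2 * b + 3 = 2 * (b + 1) + 1 by ring, v2, b2.env, b2.arrs]

/-- The only iteration is a loop of length `s.reg 0`, and no compiled term writes register 0: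
scratch registers are odd and bound variables sit in registers `2 * (x + 2)`. Hence the costs
compose to a polynomial in that one number. -/
theorem Tm.comp_computes (t : Tm) : ∃ P, Computes t t.comp P := by
  induction t with
  | lit c =>
    refine ⟨Polynomial.C 2, fun b s => ⟨_, _, ?_, Run.assign _ _ _, .setReg _ _ ⟨b, le_rfl, rfl⟩, ?_⟩⟩
    · simp [Exp.cost]
    · simp [Store.setReg_reg_self, Exp.eval, Tm.eval]
  | var x =>
    refine ⟨Polynomial.C 2, fun b s => ⟨_, _, ?_, Run.assign _ _ _, .setReg _ _ ⟨b, le_rfl, rfl⟩, ?_⟩⟩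
    · simp [Exp.cost]
    · simp [Store.setReg_reg_self, Exp.eval, Tm.eval, Store.env]
  | get a i j hi hj =>
    obtain ⟨P, hP⟩ := hi
    obtain ⟨Q, hQ⟩ := hj
    refine ⟨_, computes_binary hP hQ 3 (fun b => by simp [Exp.cost]) fun b s h h' => ?_⟩
    simp [Exp.eval, Tm.eval, h, h', Store.arrs]
  | add d e hi hj =>
    obtain ⟨P, hP⟩ := hi
    obtain ⟨Q, hQ⟩ := hj
    refine ⟨_, computes_binary hP hQ 3 (fun b => by simp [Exp.cost]) fun b s h h' => ?_⟩
    simp [Exp.eval, Tm.eval, h, h']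
  | sub d e hi hj =>
    obtain ⟨P, hP⟩ := hi
    obtain ⟨Q, hQ⟩ := hj
    refine ⟨_, computes_binary hP hQ 3 (fun b => by simp [Exp.cost]) fun b s h h' => ?_⟩
    simp [Exp.eval, Tm.eval, h, h']
  | ite c d e hc hd he =>
    obtain ⟨P, hP⟩ := hc
    obtain ⟨Q, hQ⟩ := hd
    obtain ⟨R, hR⟩ := he
    refine ⟨P + (Polynomial.C 2 + (Q + R)), fun b s => ?_⟩
    obtain ⟨m1, s1, h1, r1, b1, v1⟩ := hP b s
    by_cases h : c.eval s.arrs s.env = 0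
    · obtain ⟨m2, s2, h2, r2, b2, v2⟩ := hR b s1
      refine ⟨_, _, ?_, Run.seq r1 (Run.iteFalse ?_ r2), b1.trans b2, ?_⟩
      · rw [b1.reg_zero] at h2
        simp only [Polynomial.eval_add, Polynomial.eval_C, Exp.cost]
        omega
      · simp [Exp.eval, v1, h]
      · simp [Tm.eval, h, v2, b1.env, b1.arrs]
    · obtain ⟨m2, s2, h2, r2, b2, v2⟩ := hQ b s1
      refine ⟨_, _, ?_, Run.seq r1 (Run.iteTrue ?_ r2), b1.trans b2, ?_⟩
      · rw [b1.reg_zero] at h2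
        simp only [Polynomial.eval_add, Polynomial.eval_C, Exp.cost]
        omega
      · simp [Exp.eval, v1, h]
      · simp [Tm.eval, h, v2, b1.env, b1.arrs]
  | sum x t ht =>
    obtain ⟨P, hP⟩ := ht
    refine ⟨Polynomial.X * (P + Polynomial.C 12) + Polynomial.C 12, fun b s => ?_⟩
    let f : ℕ → ℕ := fun i => t.eval s.arrs (Function.update s.env (x + 2) i)
    -- Register `2 * (x + 2)` is exempt because the loop runs on it. Its old value is kept in `2 * b
    -- + 3` and restored at the end, which is what makes nested uses of the same variable harmless.
    let I : ℕ → Store → Prop := fun i s' => s'.arr = s.arr ∧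
      (∀ r, r ≠ 2 * (x + 2) → (∀ b', b ≤ b' → r ≠ 2 * b' + 1) → s'.reg r = s.reg r) ∧
      s'.reg (2 * b + 1) = ∑ j ∈ Finset.range i, f j ∧ s'.reg (2 * b + 3) = s.reg (2 * (x + 2))
    have h0 : ∀ i s', I i s' → s'.reg 0 = s.reg 0 := fun i s' h =>
      h.2.1 0 (by omega) fun b' _ => by omega
    obtain ⟨m, s', hm, hr, hI⟩ := Run.for (x := 2 * (x + 2)) (n := s.reg 0) (c := P.eval (s.reg 0) + 4)
      (p := .seq (t.comp (b + 2)) (.assign (2 * b + 1) (.add (.var (2 * b + 1)) (.var (2 * b + 5)))))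
      I h0
      (fun i s' c h => ⟨h.1, fun r hr hr' => by
          rw [Store.setReg_reg_of_ne _ _ hr]; exact h.2.1 r hr hr',
        by rw [Store.setReg_reg_of_ne _ _ (by omega)]; exact h.2.2.1,
        by rw [Store.setReg_reg_of_ne _ _ (by omega)]; exact h.2.2.2⟩)
      (by
        intro i s1 hi h hx
        obtain ⟨m, s2, h2, r2, b2, v2⟩ := hP (b + 2) s1
        refine ⟨_, _, ?_, Run.seq r2 (Run.assign _ _ _), ⟨?_, ?_, ?_, ?_⟩, ?_⟩
        · rw [h0 i s1 h] at h2
          simp only [Exp.cost]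
          omega
        · exact b2.1.trans h.1
        · intro r hr hr'
          rw [Store.setReg_reg_of_ne _ _ (hr' b le_rfl), b2.2 r fun b' hb' => hr' b' (by omega)]
          exact h.2.1 r hr hr'
        · rw [Store.setReg_reg_self, Finset.sum_range_succ]
          simp only [Exp.eval]
          rw [b2.reg_lt (by omega), h.2.2.1, show 2 * b + 5 = 2 * (b + 2) + 1 by ring, v2]
          congr 2
          · funext a; simp [Store.arrs, h.1]
          · funext y
            by_cases hy : y = x + 2
            · subst hy; simp [Store.env, hx]
            · rw [Function.update_of_ne hy]
              exact h.2.1 _ (by omega) fun b' _ => by omega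
        · rw [Store.setReg_reg_of_ne _ _ (by omega), show 2 * b + 3 = 2 * (b + 1) + 1 by ring,
            b2.reg_lt (by omega)]
          exact h.2.2.2
        · rw [Store.setReg_reg_of_ne _ _ (by omega), b2.2 _ fun b' _ => by omega]
          exact hx)
      ((s.setReg (2 * b + 1) 0).setReg (2 * b + 3) (s.reg (2 * (x + 2))))
      ⟨rfl, fun r _ hr => by
          rw [Store.setReg_reg_of_ne _ _ (by have := hr (b + 1) (by omega); omega),
            Store.setReg_reg_of_ne _ _ (hr b (by omega))],
        by rw [Store.setReg_reg_of_ne _ _ (by omega), Store.setReg_reg_self]; simp,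
        Store.setReg_reg_self _ _ _⟩
    rw [show s.reg (2 * (x + 2)) = (Exp.var (2 * (x + 2))).eval (s.setReg (2 * b + 1) 0) by
      simp only [Exp.eval]; rw [Store.setReg_reg_of_ne _ _ (by omega)]] at hr
    refine ⟨_, _, ?_, Run.seq (Run.assign _ _ _) (Run.seq (Run.assign _ _ _)
      (Run.seq hr (Run.assign _ _ _))), ⟨?_, ?_⟩, ?_⟩
    rotate_left
    · exact hI.1
    · intro r hr
      by_cases hrx : r = 2 * (x + 2)
      · subst hrx
        rw [Store.setReg_reg_self]
        exact hI.2.2.2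
      · rw [Store.setReg_reg_of_ne _ _ hrx]
        exact hI.2.1 r hrx hr
    · rw [Store.setReg_reg_of_ne _ _ (by omega)]
      exact hI.2.2.1
    · simp only [Polynomial.eval_add, Polynomial.eval_mul, Polynomial.eval_X, Polynomial.eval_C,
        Exp.cost]
      have : s.reg 0 * (Polynomial.eval (s.reg 0) P + 4 + 8) =
        s.reg 0 * (Polynomial.eval (s.reg 0) P + 12) := by ring
      omega

/-! ### Array commands and their compilation -/

/-- Commands: define an array by a term in its indices (the variables `2` and `3`), compose, and
iterate as often as there are vertices. -/
inductive Cmd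
  | define (a : ℕ) (t : Tm)
  | seq (c d : Cmd)
  | loop (c : Cmd)

/-- The values of the variables in a definition of an array. -/
def indexEnv (n k i j : ℕ) : ℕ → ℕ := fun x =>
  if x = 0 then n else if x = 1 then k else if x = 2 then i else if x = 3 then j else 0

/-- The effect of a command on the arrays. -/
def Cmd.exec (n k : ℕ) : Cmd → (ℕ → ℕ → ℕ → ℕ) → ℕ → ℕ → ℕ → ℕ
  | .define a t, A => Function.update A a fun i j =>
      if i < n ∧ j < n then t.eval A (indexEnv n k i j) else A a i j
  | .seq c d, A => d.exec n k (c.exec n k A)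
  | .loop c, A => (c.exec n k)^[n] A

/-- The program of a command; the intermediate registers below number `b` are not touched. -/
def Cmd.comp : Cmd → ℕ → Prog
  | .define a t, b =>
    .seq (.for 4 (.for 6 (.seq (t.comp b) (.put 1 (.var 4) (.var 6) (.var (2 * b + 1))))))
      (.for 4 (.for 6 (.put (2 * a) (.var 4) (.var 6) (.get 1 (.var 4) (.var 6)))))
  | .seq c d, b => .seq (c.comp b) (d.comp b)
  | .loop c, b => .for (2 * b + 1) (c.comp (b + 1))

/-- The store represents the arrays `A` on the input parameters `n` and `k`. -/
def Store.Represents (s : Store) (n k : ℕ) (A : ℕ → ℕ → ℕ → ℕ) : Prop :=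
  s.arrs = A ∧ s.reg 0 = n ∧ s.reg 2 = k ∧ ∀ x, 4 ≤ x → s.reg (2 * x) = 0

theorem Run.for_for {n c : ℕ} {p : Prog} (I : ℕ → ℕ → Store → Prop)
    (hn : ∀ i j s, I i j s → s.reg 0 = n)
    (h4 : ∀ i j s c, I i j s → I i j (s.setReg 4 c))
    (h6 : ∀ i j s c, I i j s → I i j (s.setReg 6 c))
    (hrow : ∀ i s, I i n s → I (i + 1) 0 s)
    (hp : ∀ i j s, i < n → j < n → I i j s → s.reg 4 = i → s.reg 6 = j →
      ∃ t s', t ≤ c ∧ Run p s t s' ∧ I i (j + 1) s' ∧ s'.reg 4 = i ∧ s'.reg 6 = j)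
    (s : Store) (hs : I 0 0 s) :
    ∃ t s', t ≤ n * (n * (c + 8) + 14) + 6 ∧ Run (.for 4 (.for 6 p)) s t s' ∧ I n 0 s' := by
  refine Run.for (c := n * (c + 8) + 6) (fun i s => I i 0 s) (fun i => hn i 0) (fun i => h4 i 0)
    (fun i s hi hI hx => ?_) s hs
  obtain ⟨t, s', ht, hr, hI'⟩ := Run.for (x := 6) (n := n) (c := c) (p := p)
    (fun j s => I i j s ∧ s.reg 4 = i)
    (fun j s h => hn i j s h.1)
    (fun j s c h => ⟨h6 _ _ _ _ h.1, by rw [Store.setReg_reg_of_ne _ _ (by omega)]; exact h.2⟩)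
    (fun j s hj h hx => by
      obtain ⟨t, s', ht, hr, hI, h, h'⟩ := hp i j s hi hj h.1 h.2 hx
      exact ⟨t, s', ht, hr, ⟨hI, h⟩, h'⟩) s ⟨hI, hx⟩
  exact ⟨t, s', ht, hr, hrow _ _ hI'.1, hI'.2⟩

/-- A definition of an array also leaves the defined values in the array number `1`. -/
theorem Cmd.comp_define_run (a : ℕ) (t : Tm) : ∃ P : Polynomial ℕ, ∀ b n k A s,
    s.Represents n k A → ∃ m s', m ≤ P.eval n ∧ Run ((Cmd.define a t).comp b) s m s' ∧
      s'.Represents n k ((Cmd.define a t).exec n k A) ∧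
      (∀ c < b, s'.reg (2 * c + 1) = s.reg (2 * c + 1)) ∧
      ∀ i j, i < n → j < n → s'.arr 1 i j = (Cmd.define a t).exec n k A a i j := by
  obtain ⟨P, hP⟩ := t.comp_computes
  refine ⟨(Polynomial.X * (Polynomial.X * (P + Polynomial.C 12) + Polynomial.C 14) + Polynomial.C 6) +
    (Polynomial.X * (Polynomial.X * (Polynomial.C 14) + Polynomial.C 14) + Polynomial.C 6),
    fun b n k A s hs => ?_⟩
  obtain ⟨hA, hn, hk, hx⟩ := hs
  let f : ℕ → ℕ → ℕ := fun i j => t.eval A (indexEnv n k i j)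
  let same : Store → Prop := fun s' =>
    ∀ r, r ≠ 4 → r ≠ 6 → (∀ b', b ≤ b' → r ≠ 2 * b' + 1) → s'.reg r = s.reg r
  have same_set : ∀ s' x c, (x = 4 ∨ x = 6) → same s' → same (s'.setReg x c) := by
    intro s' x c hx h r h4 h6 hb
    rw [Store.setReg_reg_of_ne _ _ (by omega)]
    exact h r h4 h6 hb
  have same_zero : ∀ s', same s' → s'.reg 0 = n := fun s' h =>
    (h 0 (by omega) (by omega) fun b' _ => by omega).trans hn
  -- First sweep: the values go to machine array 1, which is odd and so invisible to terms. Every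
  -- cell is therefore computed from the old contents of `a`, and the definition acts simultaneously
  -- on all cells.
  obtain ⟨m1, s1, hm1, hr1, hI1⟩ := Run.for_for (n := n) (c := P.eval n + 4)
    (p := .seq (t.comp b) (.put 1 (.var 4) (.var 6) (.var (2 * b + 1))))
    (fun i j s' => same s' ∧ s'.arrs = A ∧
      ∀ i' j', j' < n → (i' < i ∨ i' = i ∧ j' < j) → s'.arr 1 i' j' = f i' j')
    (fun i j s' h => same_zero s' h.1)
    (fun i j s' c h => ⟨same_set _ _ _ (.inl rfl) h.1, h.2⟩)
    (fun i j s' c h => ⟨same_set _ _ _ (.inr rfl) h.1, h.2⟩)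
    (fun i s' h => ⟨h.1, h.2.1, fun i' j' hj hd => h.2.2 i' j' hj (by omega)⟩)
    (by
      intro i j s' hi hj h h4 h6
      obtain ⟨m, s2, hm, hr, b2, v2⟩ := hP b s'
      have he : s'.env = indexEnv n k i j := by
        funext x
        simp only [Store.env, indexEnv]
        by_cases hx0 : 4 ≤ x
        · rw [h.1 _ (by omega) (by omega) (fun b' _ => by omega), hx x hx0]
          simp [show x ≠ 0 by omega, show x ≠ 1 by omega, show x ≠ 2 by omega, show x ≠ 3 by omega]
        · interval_cases x
          · simpa using same_zero s' h.1
          · simpa using (h.1 2 (by omega) (by omega) (fun b' _ => by omega)).trans hk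
          · simpa using h4
          · simpa using h6
      have r4 : s2.reg 4 = i := (b2.2 4 fun b' _ => by omega).trans h4
      have r6 : s2.reg 6 = j := (b2.2 6 fun b' _ => by omega).trans h6
      refine ⟨_, _, ?_, Run.seq hr (Run.put _ _ _ _ _), ⟨?_, ?_, ?_⟩, ?_, ?_⟩
      · rw [same_zero s' h.1] at hm
        simp only [Exp.cost]
        omega
      · intro r h4 h6 hb
        rw [Store.setArr_reg, b2.2 r hb]
        exact h.1 r h4 h6 hb
      · rw [← h.2.1, ← b2.arrs]
        funext a i j
        simp [Store.arrs, Store.setArr]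
      · intro i' j' hj' hd
        simp only [Store.setArr, Exp.eval, r4, r6, v2, true_and]
        split_ifs with hc
        · rw [hc.1, hc.2, h.2.1, he]
        · rw [b2.1]
          exact h.2.2 i' j' hj' (by omega)
      · rw [Store.setArr_reg, r4]
      · rw [Store.setArr_reg, r6])
    s ⟨fun r _ _ _ => rfl, hA, fun i' j' _ h => by omega⟩
  have hf : ∀ i j, i < n → j < n → s1.arr 1 i j = f i j := fun i j hi hj =>
    hI1.2.2 i j hj (Or.inl hi)
  -- Second sweep: the buffer is copied to array `2 * a`.
  obtain ⟨m2, s2, hm2, hr2, hI2⟩ := Run.for_for (n := n) (c := 6)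
    (p := .put (2 * a) (.var 4) (.var 6) (.get 1 (.var 4) (.var 6)))
    (fun i j s' => same s' ∧ (∀ a', a' ≠ 2 * a → s'.arr a' = s1.arr a') ∧
      ∀ i' j', s'.arr (2 * a) i' j' = if (i' < i ∨ i' = i ∧ j' < j) ∧ j' < n then s1.arr 1 i' j'
        else A a i' j')
    (fun i j s' h => same_zero s' h.1)
    (fun i j s' c h => ⟨same_set _ _ _ (.inl rfl) h.1, h.2⟩)
    (fun i j s' c h => ⟨same_set _ _ _ (.inr rfl) h.1, h.2⟩)
    (fun i s' h => ⟨h.1, h.2.1, fun i' j' => by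
      rw [h.2.2]
      exact if_congr (by omega) rfl rfl⟩)
    (by
      intro i j s' hi hj h h4 h6
      refine ⟨_, _, ?_, Run.put _ _ _ _ _, ⟨?_, ?_, ?_⟩, ?_, ?_⟩
      · simp [Exp.cost]
      · exact h.1
      · intro a' ha'
        simp only [Store.setArr, ha', false_and, if_false]
        exact h.2.1 a' ha'
      · intro i' j'
        simp only [Store.setArr, Exp.eval, true_and, h4, h6]
        split_ifs with h1 h2 h2
        · rw [h.2.1 1 (by omega), h1.1, h1.2]
        · omega
        · rw [h.2.2, if_pos (by omega)]
        · rw [h.2.2, if_neg (by omega)]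
      · exact h4
      · exact h6)
    s1 ⟨hI1.1, fun _ _ => rfl, fun i' j' => by
      rw [if_neg (by omega), ← hI1.2.1]
      rfl⟩
  refine ⟨_, s2, ?_, Run.seq hr1 hr2, ⟨?_, same_zero _ hI2.1, ?_, ?_⟩, ?_, ?_⟩
  · simp only [Polynomial.eval_add, Polynomial.eval_mul, Polynomial.eval_X, Polynomial.eval_C]
    rw [show P.eval n + 4 + 8 = P.eval n + 12 by ring] at hm1
    norm_num at hm2
    omega
  · funext a' i j
    simp only [Cmd.exec, Store.arrs]
    by_cases ha : a' = a
    · subst ha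
      simp only [Function.update_self]
      rw [hI2.2.2]
      by_cases hc : i < n ∧ j < n
      · rw [if_pos (by omega), if_pos hc, hf _ _ hc.1 hc.2]
      · rw [if_neg (by omega), if_neg hc]
    · rw [Function.update_of_ne ha, hI2.2.1 _ (by omega), ← hI1.2.1]
      rfl
  · exact (hI2.1 2 (by omega) (by omega) fun b' _ => by omega).trans hk
  · intro x h
    exact (hI2.1 _ (by omega) (by omega) fun b' _ => by omega).trans (hx x h)
  · intro c hc
    exact hI2.1 _ (by omega) (by omega) fun b' _ => by omega
  · intro i j hi hj
    rw [hI2.2.1 1 (by omega), hf i j hi hj]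
    simp [Cmd.exec, hi, hj, f]

/-- A loop keeps its counter in register `2 * b + 1` and compiles its body from base `b + 1`; the
clause on registers below the base is what protects the counters of enclosing loops. -/
theorem Cmd.comp_run (c : Cmd) : ∃ P : Polynomial ℕ, ∀ b n k A s,
    s.Represents n k A → ∃ m s', m ≤ P.eval n ∧ Run (c.comp b) s m s' ∧
      s'.Represents n k (c.exec n k A) ∧ ∀ c < b, s'.reg (2 * c + 1) = s.reg (2 * c + 1) := by
  induction c with
  | define a t =>
    obtain ⟨P, hP⟩ := Cmd.comp_define_run a t
    refine ⟨P, fun b n k A s hs => ?_⟩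
    obtain ⟨m, s', h1, h2, h3, h4, -⟩ := hP b n k A s hs
    exact ⟨m, s', h1, h2, h3, h4⟩
  | seq c d hc hd =>
    obtain ⟨P, hP⟩ := hc
    obtain ⟨Q, hQ⟩ := hd
    refine ⟨P + Q, fun b n k A s hs => ?_⟩
    obtain ⟨m1, s1, h1, r1, e1, o1⟩ := hP b n k A s hs
    obtain ⟨m2, s2, h2, r2, e2, o2⟩ := hQ b n k _ s1 e1
    refine ⟨_, s2, ?_, Run.seq r1 r2, e2, fun c hc => (o2 c hc).trans (o1 c hc)⟩
    rw [Polynomial.eval_add]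
    omega
  | loop c hc =>
    obtain ⟨P, hP⟩ := hc
    refine ⟨Polynomial.X * (P + Polynomial.C 8) + Polynomial.C 6, fun b n k A s hs => ?_⟩
    obtain ⟨m, s', hm, hr, h1, h2⟩ := Run.for (x := 2 * b + 1) (n := n) (c := P.eval n)
      (p := c.comp (b + 1))
      (fun i s' => s'.Represents n k ((c.exec n k)^[i] A) ∧
        ∀ c < b, s'.reg (2 * c + 1) = s.reg (2 * c + 1))
      (fun i s' h => h.1.2.1)
      (fun i s' c h => ⟨⟨h.1.1,
        by rw [Store.setReg_reg_of_ne _ _ (by omega)]; exact h.1.2.1,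
        by rw [Store.setReg_reg_of_ne _ _ (by omega)]; exact h.1.2.2.1,
        fun x hx => by rw [Store.setReg_reg_of_ne _ _ (by omega)]; exact h.1.2.2.2 x hx⟩,
        fun c hc => by rw [Store.setReg_reg_of_ne _ _ (by omega)]; exact h.2 c hc⟩)
      (by
        intro i s1 hi h hx
        obtain ⟨m2, s2, h2, r2, e2, o2⟩ := hP (b + 1) n k _ s1 h.1
        refine ⟨m2, s2, h2, r2, ⟨?_, fun c hc => (o2 c (by omega)).trans (h.2 c hc)⟩,
          (o2 b (by omega)).trans hx⟩
        rw [Function.iterate_succ_apply']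
        exact e2)
      s ⟨hs, fun _ _ => rfl⟩
    refine ⟨m, s', ?_, hr, h1, h2⟩
    simpa using hm

/-- The arrays of an input: array `0` holds the adjacency matrix. -/
noncomputable def inputArrs {n : ℕ} (G : Digraph (Fin n)) : ℕ → ℕ → ℕ → ℕ := (inputStore G 0).arrs

/-- Every command with a final definition of an array is realized by a program with a polynomial
running time that returns this array. -/
theorem Cmd.realize (c : Cmd) (a : ℕ) (t : Tm) : ∃ (p : Prog) (T : Polynomial ℕ),
    ∀ (n : ℕ) (G : Digraph (Fin n)) (k : ℕ), ∃ m s, Run p (inputStore G k) m s ∧ m ≤ T.eval n ∧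
      ∀ u v : Fin n, (outputGraph n s).Adj u v ↔
        (Cmd.seq c (.define a t)).exec n k (inputArrs G) a u v ≠ 0 := by
  obtain ⟨P, hP⟩ := c.comp_run
  obtain ⟨Q, hQ⟩ := Cmd.comp_define_run a t
  -- The input puts `k` into register 1, but odd registers are scratch space, so it is moved to
  -- register 2, the place of variable 1. The output needs no copying: a final definition leaves its
  -- values in array 1, where `outputGraph` reads them.
  refine ⟨.seq (.assign 2 (.var 1)) (.seq (.assign 1 (.lit 0)) (.seq (c.comp 0)
    ((Cmd.define a t).comp 0))), Polynomial.C 4 + (P + Q), fun n G k => ?_⟩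
  obtain ⟨m1, s1, h1, r1, e1, -⟩ := hP 0 n k (inputArrs G)
    (((inputStore G k).setReg 2 k).setReg 1 0) ⟨rfl, by simp [Store.setReg, inputStore],
      by simp [Store.setReg], fun x hx => by
        simp [Store.setReg, inputStore, show x ≠ 0 by omega, show x ≠ 1 by omega,
          show 2 * x ≠ 1 by omega]⟩
  obtain ⟨m2, s2, h2, r2, e2, -, o2⟩ := hQ 0 n k _ s1 e1
  refine ⟨_, s2, Run.seq (Run.assign _ _ _) (Run.seq (Run.assign _ _ _) (Run.seq r1 r2)), ?_, ?_⟩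
  · simp only [Polynomial.eval_add, Polynomial.eval_C, Exp.cost]
    omega
  · intro u v
    simp only [outputGraph]
    rw [o2 u v u.2 v.2]
    rfl

/-! ### Walks of bounded length -/

variable {V : Type*}

/-- There is a directed walk with at most `l` edges from `u` to `v`. -/
def Within (G : Digraph V) (l : ℕ) (u v : V) : Prop := ∃ m, m ≤ l ∧ HasWalk G m u v

theorem Within.refl (G : Digraph V) (l : ℕ) (u : V) : Within G l u u := ⟨0, by omega, .nil u⟩

theorem Within.mono {G : Digraph V} {l l' : ℕ} {u v : V} (h : Within G l u v) (hl : l ≤ l') :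
    Within G l' u v := by
  obtain ⟨m, hm, hw⟩ := h
  exact ⟨m, hm.trans hl, hw⟩

theorem HasWalk.mono {G H : Digraph V} (hGH : G ≤ H) {m : ℕ} {u v : V} (h : HasWalk G m u v) :
    HasWalk H m u v := by
  induction h with
  | nil u => exact .nil u
  | cons h _ ih => exact .cons (hGH h) ih

theorem Within.mono_graph {G H : Digraph V} (hGH : G ≤ H) {l : ℕ} {u v : V} (h : Within G l u v) :
    Within H l u v := by
  obtain ⟨m, hm, hw⟩ := h
  exact ⟨m, hm, hw.mono hGH⟩

theorem HasWalk.append {G : Digraph V} {a b : ℕ} {u v w : V} (h : HasWalk G a u v)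
    (h' : HasWalk G b v w) : HasWalk G (a + b) u w := by
  induction h with
  | nil u => simpa using h'
  | cons h _ ih =>
    rw [Nat.add_right_comm]
    exact .cons h (ih h')

theorem Within.trans {G : Digraph V} {a b : ℕ} {u v w : V} (h : Within G a u v)
    (h' : Within G b v w) : Within G (a + b) u w := by
  obtain ⟨m, hm, hw⟩ := h
  obtain ⟨m', hm', hw'⟩ := h'
  exact ⟨m + m', by omega, hw.append hw'⟩

theorem Within.of_adj {G : Digraph V} {u v : V} (h : G.Adj u v) : Within G 1 u v :=
  ⟨1, le_rfl, .cons h (.nil v)⟩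

theorem within_zero {G : Digraph V} {u v : V} : Within G 0 u v ↔ u = v := by
  constructor
  · rintro ⟨m, hm, hw⟩
    obtain rfl : m = 0 := by omega
    cases hw
    rfl
  · rintro rfl
    exact .refl _ _ _

theorem within_succ {G : Digraph V} {l : ℕ} {u v : V} :
    Within G (l + 1) u v ↔ Within G l u v ∨ ∃ w, G.Adj u w ∧ Within G l w v := by
  constructor
  · rintro ⟨m, hm, hw⟩
    cases hw with
    | nil => exact .inl (.refl _ _ _)
    | cons h hw => exact .inr ⟨_, h, _, by omega, hw⟩
  · rintro (h | ⟨w, h, hw⟩)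
    · exact h.mono (by omega)
    · exact ((Within.of_adj h).trans hw).mono (by omega)

theorem transGen_iff_hasWalk {G : Digraph V} {u v : V} :
    Relation.TransGen G.Adj u v ↔ ∃ w m, G.Adj u w ∧ HasWalk G m w v := by
  constructor
  · intro h
    induction h using Relation.TransGen.head_induction_on with
    | single h => exact ⟨_, 0, h, .nil _⟩
    | head h _ ih =>
      obtain ⟨w, m, hw, hm⟩ := ih
      exact ⟨_, m + 1, h, .cons hw hm⟩
  · rintro ⟨w, m, h, hm⟩
    induction hm generalizing u with
    | nil => exact .single h
    | cons h' _ ih => exact .head h (ih h')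

theorem HasWalk.exists_fun {G : Digraph V} {m : ℕ} {u v : V} (h : HasWalk G m u v) :
    ∃ w : ℕ → V, w 0 = u ∧ w m = v ∧ ∀ i < m, G.Adj (w i) (w (i + 1)) := by
  induction h with
  | nil u => exact ⟨fun _ => u, rfl, rfl, fun i hi => by omega⟩
  | @cons m u v w h _ ih =>
    obtain ⟨f, h0, hm, hf⟩ := ih
    refine ⟨fun i => if i = 0 then u else f (i - 1), by simp, by simpa using hm, fun i hi => ?_⟩
    rcases i with _ | i
    · simpa [h0] using h
    · simpa using hf i (by omega)

theorem HasWalk.of_fun {G : Digraph V} {w : ℕ → V} {i d : ℕ}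
    (h : ∀ j, i ≤ j → j < i + d → G.Adj (w j) (w (j + 1))) : HasWalk G d (w i) (w (i + d)) := by
  induction d generalizing i with
  | zero => exact .nil _
  | succ d ih =>
    rw [show i + (d + 1) = (i + 1) + d by ring]
    exact .cons (h i le_rfl (by omega)) (ih fun j hj hj' => h j (by omega) (by omega))

/-- A shortest walk. -/
theorem HasWalk.exists_shortest {G : Digraph V} {m₀ : ℕ} {u v : V} (h : HasWalk G m₀ u v) :
    ∃ (m : ℕ) (w : ℕ → V), w 0 = u ∧ w m = v ∧ (∀ i < m, G.Adj (w i) (w (i + 1))) ∧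
      ∀ i j a, i ≤ j → j ≤ m → Within G a (w i) (w j) → j ≤ i + a := by
  classical
  have hex : ∃ m, HasWalk G m u v := ⟨_, h⟩
  obtain ⟨w, h0, hm, hw⟩ := (Nat.find_spec hex).exists_fun
  refine ⟨Nat.find hex, w, h0, hm, hw, fun i j a hij hj ⟨b, hb, hab⟩ => ?_⟩
  by_contra hcon
  have h1 : HasWalk G i u (w i) := by
    simpa [h0] using HasWalk.of_fun (G := G) (w := w) (i := 0) (d := i) fun j _ h => hw j (by omega)
  have h2 : HasWalk G (Nat.find hex - j) (w j) v := by
    have := HasWalk.of_fun (G := G) (w := w) (i := j) (d := Nat.find hex - j)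
      fun l _ h => hw l (by omega)
    rwa [show j + (Nat.find hex - j) = Nat.find hex by omega, hm] at this
  -- Replacing the segment from `w i` to `w j` by the walk of length `b` would give a shorter walk.
  have := Nat.find_min' hex ((h1.append hab).append h2)
  omega

/-- The vertices of a shortest walk are distinct: a repetition would be a segment replaceable by a
walk of length 0. -/
theorem HasWalk.within_card [Fintype V] {G : Digraph V} {m : ℕ} {u v : V} (h : HasWalk G m u v) :
    Within G (Fintype.card V - 1) u v := by
  obtain ⟨m, w, h0, hm, hw, hmin⟩ := h.exists_shortest
  have hinj : Set.InjOn w (Finset.range (m + 1)) := by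
    intro i hi j hj hij
    simp only [Finset.coe_range, Set.mem_Iio] at hi hj
    rcases le_total i j with hle | hle
    · have := hmin i j 0 hle (by omega) (within_zero.2 hij)
      omega
    · have := hmin j i 0 hle (by omega) (within_zero.2 hij.symm)
      omega
  have hc := Finset.card_le_card_of_injOn w (fun _ _ => Finset.mem_univ _) hinj
  rw [Finset.card_range, Finset.card_univ] at hc
  refine ⟨m, by omega, ?_⟩
  have := HasWalk.of_fun (G := G) (w := w) (i := 0) (d := m) fun j _ h => hw j (by omega)
  simpa [h0, hm] using this

/-! ### Strict orders, cover relations and chains -/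

/-- The digraph of the cover relation of a strict order. -/
def coverGraph (lt : V → V → Prop) : Digraph V where
  Adj u v := lt u v ∧ ∀ w, lt u w → ¬ lt w v

/-- Either nothing lies strictly between `u` and `v`, or an intermediate element splits the interval
into two strictly smaller ones. -/
theorem hasWalk_coverGraph [Finite V] {lt : V → V → Prop} [IsStrictOrder V lt] {u v : V}
    (h : lt u v) : ∃ m, HasWalk (coverGraph lt) m u v := by
  induction hN : {w | lt u w ∧ lt w v}.ncard using Nat.strong_induction_on generalizing u v with
  | _ N ih =>
    by_cases hc : ∃ w, lt u w ∧ lt w v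
    · obtain ⟨w, huw, hwv⟩ := hc
      have h1 : {x | lt u x ∧ lt x w}.ncard < N := by
        rw [← hN]
        exact Set.ncard_lt_ncard ⟨fun x hx => ⟨hx.1, trans_of lt hx.2 hwv⟩,
          fun hs => irrefl_of lt w (hs (show lt u w ∧ lt w v from ⟨huw, hwv⟩)).2⟩ (Set.toFinite _)
      have h2 : {x | lt w x ∧ lt x v}.ncard < N := by
        rw [← hN]
        exact Set.ncard_lt_ncard ⟨fun x hx => ⟨trans_of lt huw hx.1, hx.2⟩,
          fun hs => irrefl_of lt w (hs (show lt u w ∧ lt w v from ⟨huw, hwv⟩)).1⟩ (Set.toFinite _)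
      obtain ⟨m, hm⟩ := ih _ h1 huw rfl
      obtain ⟨m', hm'⟩ := ih _ h2 hwv rfl
      exact ⟨m + m', hm.append hm'⟩
    · push Not at hc
      exact ⟨1, .cons ⟨h, hc⟩ (.nil v)⟩

/-- There is an `lt`-chain of `l + 1` elements of `U` with largest element `v`. -/
def ChainTo (U : V → Prop) (lt : V → V → Prop) : ℕ → V → Prop
  | 0, v => U v
  | l + 1, v => U v ∧ ∃ u, ChainTo U lt l u ∧ lt u v

/-- The element of largest index is removed and put on top of a chain found among the others.
Applied to a walk, this turns the absence of long chains in `U` into a bound on the number of visits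
to `U`. -/
theorem exists_chainTo {U : V → Prop} {lt : V → V → Prop} {w : ℕ → V} {l : ℕ} {I : Finset ℕ}
    (hU : ∀ i ∈ I, U (w i)) (hlt : ∀ i ∈ I, ∀ j ∈ I, i < j → lt (w i) (w j)) (hI : l + 1 ≤ I.card) :
    ∃ i ∈ I, ChainTo U lt l (w i) := by
  induction l generalizing I with
  | zero =>
    obtain ⟨i, hi⟩ := Finset.card_pos.1 hI
    exact ⟨i, hi, hU i hi⟩
  | succ l ih =>
    have hne : I.Nonempty := Finset.card_pos.1 (by omega)
    have hmax := I.max'_mem hne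
    obtain ⟨i, hi, hc⟩ := ih (I := I.erase (I.max' hne))
      (fun i hi => hU i (Finset.mem_of_mem_erase hi))
      (fun i hi j hj => hlt i (Finset.mem_of_mem_erase hi) j (Finset.mem_of_mem_erase hj))
      (by rw [Finset.card_erase_of_mem hmax]; omega)
    have hi' := Finset.mem_of_mem_erase hi
    exact ⟨_, hmax, hU _ hmax, w i, hc, hlt i hi' _ hmax
      (lt_of_le_of_ne (Finset.le_max' I i hi') (Finset.ne_of_mem_erase hi))⟩

/-- A family of disjoint `lt`-chains of exactly `D` elements: `id v` is the number of the chain of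
`v` (zero if `v` is on none), and `pos v` is the position of `v` on it. -/
structure IsChainSystem (lt : V → V → Prop) (D : ℕ) (id pos : V → ℕ) : Prop where
  lt_of : ∀ u v, id u ≠ 0 → id u = id v → pos u < pos v → lt u v
  inj : ∀ u v, id u ≠ 0 → id u = id v → pos u = pos v → u = v
  range : ∀ u, id u ≠ 0 → 1 ≤ pos u ∧ pos u ≤ D
  surj : ∀ u p, id u ≠ 0 → 1 ≤ p → p ≤ D → ∃ v, id v = id u ∧ pos v = p

/-- The numbers of the chains of a system. -/
def chainIds [Fintype V] (id : V → ℕ) : Finset ℕ := (Finset.univ.filter fun v => id v ≠ 0).image id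

/-- Chains are disjoint and each realizes all positions 1, ..., `D`. This supplies one of the three
factors `D` in the final saving of `D ^ 3`. -/
theorem IsChainSystem.card_mul_le [Fintype V] {lt : V → V → Prop} {D : ℕ} {id pos : V → ℕ}
    (h : IsChainSystem lt D id pos) : D * (chainIds id).card ≤ Fintype.card V := by
  classical
  refine (Finset.mul_card_image_le_card _ D fun c hc => ?_).trans (Finset.card_le_univ _)
  obtain ⟨u, hu, rfl⟩ := Finset.mem_image.1 hc
  simp only [Finset.mem_filter, Finset.mem_univ, true_and] at hu
  have : Finset.Icc 1 D ⊆ (Finset.univ.filter fun v => id v = id u).image pos := by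
    intro p hp
    obtain ⟨hp1, hp2⟩ := Finset.mem_Icc.1 hp
    obtain ⟨v, hv, hvp⟩ := h.surj u p hu hp1 hp2
    exact Finset.mem_image.2 ⟨v, by simp [hv], hvp⟩
  have := (Finset.card_le_card this).trans Finset.card_image_le
  rw [Nat.card_Icc, Nat.add_sub_cancel] at this
  refine this.trans (Finset.card_le_card fun v hv => ?_)
  simp only [Finset.mem_filter, Finset.mem_univ, true_and] at hv ⊢
  exact ⟨by rw [hv]; exact hu, hv⟩

/-- The shortcuts on the chains of a system: edges whose length is a power of two. -/
def chainGraph (id pos : V → ℕ) : Digraph V where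
  Adj u v := id u ≠ 0 ∧ id u = id v ∧ ∃ l, pos v = pos u + 2 ^ l

/-- The gap is written in binary: if it is at least `2 ^ l`, one jump of that length leaves a gap
below `2 ^ l`. -/
theorem IsChainSystem.within {lt : V → V → Prop} {D : ℕ} {id pos : V → ℕ}
    (h : IsChainSystem lt D id pos) (l : ℕ) {u v : V} (hu : id u ≠ 0) (huv : id u = id v)
    (hle : pos u ≤ pos v) (hl : pos v < pos u + 2 ^ l) : Within (chainGraph id pos) l u v := by
  induction l generalizing u with
  | zero => exact within_zero.2 (h.inj u v hu huv (by simp at hl; omega))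
  | succ l ih =>
    by_cases hlt : pos v < pos u + 2 ^ l
    · exact (ih hu huv hle hlt).mono (by omega)
    · obtain ⟨w, hw, hwp⟩ := h.surj u (pos u + 2 ^ l) hu (by have := (h.range u hu).1; omega)
        (by have := (h.range v (huv ▸ hu)).2; omega)
      refine within_succ.2 (.inr ⟨w, ⟨hu, hw.symm, l, hwp⟩,
        ih (hw ▸ hu) (hw.trans huv) (by omega) ?_⟩)
      rw [pow_succ] at hl
      omega

/-- The number of elements that are not maximal. -/
noncomputable def numNonmax (lt : V → V → Prop) : ℕ := {u | ∃ v, lt u v}.ncard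

/-- A shortcut is determined by its tail and its exponent, which is below `L`. Tails are not
maximal; counting only such vertices, rather than all `n`, makes the bound comparable with the
optimum. -/
theorem IsChainSystem.numEdges_le [Finite V] {lt : V → V → Prop} {D L : ℕ} {id pos : V → ℕ}
    (h : IsChainSystem lt D id pos) (hL : D < 2 ^ L) :
    numEdges (chainGraph id pos) ≤ numNonmax lt * L := by
  have key : ∀ u v l, (chainGraph id pos).Adj u v → pos v = pos u + 2 ^ l → l < L := by
    intro u v l huv hl
    have := (h.range v (huv.2.1 ▸ huv.1)).2
    exact (Nat.pow_lt_pow_iff_right (a := 2) (by omega)).1 (by omega)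
  rw [← Set.ncard_coe_finset (Finset.range L) |>.trans (Finset.card_range L), numNonmax,
    ← Set.ncard_prod]
  refine Set.ncard_le_ncard_of_injOn (fun e : V × V => (e.1, Nat.log 2 (pos e.2 - pos e.1))) ?_ ?_
    (Set.toFinite _)
  · rintro ⟨u, v⟩ huv
    have ⟨hu, hid, l, hl⟩ := huv
    dsimp only at hu hid hl
    have hp : 0 < 2 ^ l := by positivity
    refine ⟨⟨v, h.lt_of u v hu hid (by omega)⟩, ?_⟩
    simp only [hl, Nat.add_sub_cancel_left, Nat.log_pow (show 1 < 2 by omega)]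
    simpa using key u v l huv hl
  · rintro ⟨u, v⟩ huv ⟨u', v'⟩ huv' he
    have ⟨hu, hid, l, hl⟩ := huv
    have ⟨hu', hid', l', hl'⟩ := huv'
    dsimp only at hu hid hl hu' hid' hl'
    simp only [Prod.mk.injEq] at he
    obtain ⟨rfl, he⟩ := he
    simp only [hl, hl', Nat.add_sub_cancel_left, Nat.log_pow (show 1 < 2 by omega)] at he
    subst he
    rw [h.inj v v' (hid ▸ hu) (hid.symm.trans hid') (hl.trans hl'.symm)]

/-! ### Greedy shortcuts -/

/-- `lt u v`, but `H` has no walk with at most `K` edges from `u` to `v`. -/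
def IsBad (lt : V → V → Prop) (H : Digraph V) (K : ℕ) (u v : V) : Prop :=
  lt u v ∧ ¬ Within H K u v

/-- The edge `(x, y)` makes a walk with at most `K` edges out of the bad pair `(u, v)`. -/
def Fixes (lt : V → V → Prop) (H : Digraph V) (K : ℕ) (x y u v : V) : Prop :=
  IsBad lt H K u v ∧ ∃ a b, a + 1 + b ≤ K ∧ Within H a u x ∧ Within H b y v

/-- The first element of the chain number `c` above `x`, if there is one. -/
noncomputable def chainFirst (lt : V → V → Prop) (id pos : V → ℕ) (x : V) (c : ℕ) : V :=
  open Classical in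
  if h : ∃ y, (id y = c ∧ lt x y) ∧ ∀ z, id z = c ∧ lt x z → pos y ≤ pos z then h.choose else x

theorem chainFirst_spec {lt : V → V → Prop} {id pos : V → ℕ} {x y : V}
    (hy : lt x y) : id (chainFirst lt id pos x (id y)) = id y ∧
      lt x (chainFirst lt id pos x (id y)) ∧ pos (chainFirst lt id pos x (id y)) ≤ pos y := by
  have hex : ∃ y', (id y' = id y ∧ lt x y') ∧ ∀ z, id z = id y ∧ lt x z → pos y' ≤ pos z := by
    obtain ⟨p, ⟨y', hy', rfl⟩, hmin⟩ := WellFounded.has_min (α := ℕ) wellFounded_lt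
      (pos '' {y' | id y' = id y ∧ lt x y'}) ⟨_, y, ⟨rfl, hy⟩, rfl⟩
    exact ⟨y', hy', fun z hz => not_lt.1 (hmin _ ⟨z, hz, rfl⟩)⟩
  rw [chainFirst, dif_pos hex]
  exact ⟨hex.choose_spec.1.1, hex.choose_spec.1.2, hex.choose_spec.2 y ⟨rfl, hy⟩⟩

theorem lt_of_walk {lt : V → V → Prop} [IsStrictOrder V lt] {w : ℕ → V} {m : ℕ}
    (hw : ∀ i < m, lt (w i) (w (i + 1))) {i j : ℕ} (hij : i < j) (hj : j ≤ m) :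
    lt (w i) (w j) := by
  induction j with
  | zero => omega
  | succ j ih =>
    rcases Nat.lt_succ_iff_lt_or_eq.1 hij with h | rfl
    · exact trans_of lt (ih h (by omega)) (hw j (by omega))
    · exact hw _ (by omega)

/-- Data under which greedy shortcuts are efficient: a chain system that leaves no further chain of
`D` elements, with shortcuts on the chains. -/
structure IsChained (lt : V → V → Prop) (D L : ℕ) (id pos : V → ℕ) (H : Digraph V) : Prop where
  system : IsChainSystem lt D id pos
  rest : ∀ v, ¬ ChainTo (fun v => id v = 0) lt (D - 1) v
  sub : ∀ u v, H.Adj u v → lt u v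
  short : ∀ u v, id u ≠ 0 → id u = id v → pos u ≤ pos v → Within H L u v
  reach : ∀ u v, lt u v → ∃ m, HasWalk H m u v

/-- Many shortcuts from a vertex to its first successor on a chain fix a given bad pair. -/
theorem IsChained.exists_fixes [Fintype V] {lt : V → V → Prop} [IsStrictOrder V lt] {D L K : ℕ}
    {id pos : V → ℕ} {H : Digraph V} (h : IsChained lt D L id pos H) (hD : 1 ≤ D)
    (hK : (2 * L + 4) * D ≤ K) {u v : V} (huv : IsBad lt H K u v) :
    ∃ (X : Finset V) (C : Finset ℕ), D ≤ X.card ∧ D ≤ C.card ∧ (∀ x ∈ X, ∃ y, lt x y) ∧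
      C ⊆ chainIds id ∧ ∀ x ∈ X, ∀ c ∈ C, lt x (chainFirst lt id pos x c) ∧
        Fixes lt H K x (chainFirst lt id pos x c) u v := by
  classical
  obtain ⟨m₀, hm₀⟩ := h.reach u v huv.1
  obtain ⟨m, w, h0, hm, hw, hmin⟩ := hm₀.exists_shortest
  have hwalk : ∀ i j, i ≤ j → j ≤ m → Within H (j - i) (w i) (w j) := by
    intro i j hij hj
    have := HasWalk.of_fun (G := H) (w := w) (i := i) (d := j - i) fun l _ h => hw l (by omega)
    rw [show i + (j - i) = j by omega] at this
    exact ⟨_, le_rfl, this⟩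
  have hmK : K < m := by
    by_contra hcon
    have := (hwalk 0 m (by omega) le_rfl).mono (show m - 0 ≤ K by omega)
    rw [h0, hm] at this
    exact huv.2 this
  have hlt : ∀ i j, i < j → j ≤ m → lt (w i) (w j) := fun i j hij hj =>
    lt_of_walk (fun i hi => h.sub _ _ (hw i hi)) hij hj
  have hinj : ∀ i j, i ≤ m → j ≤ m → w i = w j → i = j := by
    intro i j hi hj hij
    by_contra hne
    rcases Nat.lt_or_gt_of_ne hne with hl | hl
    · exact irrefl_of lt (w j) (hij ▸ hlt i j hl hj)
    · exact irrefl_of lt (w j) (hij ▸ hlt j i hl hi)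
  -- The budget is two blocks of `D * L + 2 * D`. The walk is longer than both together, so its
  -- first `D` indices precede the final block `J`.
  have hexp : (2 * L + 4) * D = D * L + 2 * D + (D * L + 2 * D) := by ring
  have hDL : L ≤ D * L := Nat.le_mul_of_pos_left L hD
  let J := Finset.Icc (m - (D * L + 2 * D)) m
  have hJcard : J.card = D * L + 2 * D + 1 := by
    simp only [J, Nat.card_Icc]
    omega
  -- `D` chainless vertices on the walk would form a chain that the extraction should have found.
  have hJ0 : (J.filter fun j => id (w j) = 0).card ≤ D - 1 := by
    by_contra hcon
    obtain ⟨i, -, hi⟩ := exists_chainTo (U := fun v => id v = 0) (lt := lt) (w := w) (l := D - 1)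
      (I := J.filter fun j => id (w j) = 0) (fun i hi => (Finset.mem_filter.1 hi).2)
      (fun i _ j hj hij => hlt i j hij (Finset.mem_Icc.1 (Finset.mem_filter.1 hj).1).2) (by omega)
    exact h.rest _ hi
  let J1 := J.filter fun j => id (w j) ≠ 0
  -- Two vertices of one chain are within `L` steps by shortcuts, so on a shortest walk their
  -- indices differ by at most `L`. The order along the walk agrees with the positions on the chain,
  -- since otherwise `lt` would have a cycle.
  have hJ1 : J1.card ≤ (L + 1) * (J1.image fun j => id (w j)).card := by
    refine Finset.card_le_mul_card_image _ _ fun c hc => ?_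
    obtain ⟨i, hi, hmn⟩ := Finset.exists_min_image (J1.filter fun j => id (w j) = c) (fun j => j) (by
      obtain ⟨j, hj, hjc⟩ := Finset.mem_image.1 hc
      exact ⟨j, Finset.mem_filter.2 ⟨hj, hjc⟩⟩)
    have hi1 := Finset.mem_filter.1 hi
    have hi2 := Finset.mem_filter.1 hi1.1
    have : (J1.filter fun j => id (w j) = c) ⊆ Finset.Icc i (i + L) := by
      intro j hj
      have hj1 := Finset.mem_filter.1 hj
      have hj2 := Finset.mem_filter.1 hj1.1
      have hjm := (Finset.mem_Icc.1 hj2.1).2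
      have hij := hmn j hj
      refine Finset.mem_Icc.2 ⟨hij, hmin i j L hij hjm (h.short _ _ hi2.2 (hi1.2.trans hj1.2.symm) ?_)⟩
      by_contra hcon
      rcases Nat.lt_or_ge i j with hl | hl
      · exact irrefl_of lt (w i) (trans_of lt (hlt i j hl hjm)
          (h.system.lt_of _ _ hj2.2 (hj1.2.trans hi1.2.symm) (by omega)))
      · obtain rfl : i = j := by omega
        omega
    refine (Finset.card_le_card this).trans ?_
    rw [Nat.card_Icc]
    omega
  have hsplit : (J.filter fun j => id (w j) = 0).card + J1.card = J.card :=
    Finset.card_filter_add_card_filter_not _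
  -- At least `D * L + D + 2` indices of `J` lie on chains, at most `L + 1` per chain.
  have hC : D ≤ (J1.image fun j => id (w j)).card := by
    by_contra hcon
    obtain ⟨D', rfl⟩ : ∃ D', D = D' + 1 := ⟨D - 1, by omega⟩
    have h1 : (L + 1) * (J1.image fun j => id (w j)).card ≤ (L + 1) * D' :=
      Nat.mul_le_mul_left _ (by omega)
    have h2 : (L + 1) * D' = D' * L + D' := by ring
    have h3 : (D' + 1) * L = D' * L + L := by ring
    omega
  have hXinj : Set.InjOn w (Finset.range D) := by
    intro i hi j hj hij
    simp only [Finset.coe_range, Set.mem_Iio] at hi hj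
    exact hinj i j (by omega) (by omega) hij
  refine ⟨(Finset.range D).image w, J1.image fun j => id (w j),
    by rw [Finset.card_image_of_injOn hXinj, Finset.card_range], hC, ?_, ?_, ?_⟩
  · intro x hx
    obtain ⟨i, hi, rfl⟩ := Finset.mem_image.1 hx
    have := Finset.mem_range.1 hi
    exact ⟨w m, hlt i m (by omega) le_rfl⟩
  · intro c hc
    obtain ⟨j, hj, rfl⟩ := Finset.mem_image.1 hc
    exact Finset.mem_image_of_mem _ (Finset.mem_filter.2 ⟨Finset.mem_univ _, (Finset.mem_filter.1 hj).2⟩)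
  · intro x hx c hc
    obtain ⟨i, hi, rfl⟩ := Finset.mem_image.1 hx
    obtain ⟨j, hj, rfl⟩ := Finset.mem_image.1 hc
    have hi' := Finset.mem_range.1 hi
    have hj1 := Finset.mem_filter.1 hj
    have hj2 := Finset.mem_Icc.1 hj1.1
    obtain ⟨h1, h2, h3⟩ := chainFirst_spec (pos := pos) (id := id) (hlt i j (by omega) hj2.2)
    -- The repaired walk follows `w` up to `x`, takes the new edge, moves along the chain to `w j`
    -- in at most `L` steps, and follows `w` to its end.
    refine ⟨h2, huv, i - 0, L + (m - j), by omega, ?_, ?_⟩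
    · rw [← h0]
      exact hwalk 0 i (by omega) (by omega)
    · rw [← hm]
      exact (h.short _ _ (by rw [h1]; exact hj1.2) h1 h3).trans (hwalk j m hj2.2 le_rfl)

/-- The number of bad pairs. -/
noncomputable def numBad (lt : V → V → Prop) (H : Digraph V) (K : ℕ) : ℕ :=
  {e : V × V | IsBad lt H K e.1 e.2}.ncard

/-- The number of bad pairs that an edge fixes. -/
noncomputable def score (lt : V → V → Prop) (H : Digraph V) (K : ℕ) (x y : V) : ℕ :=
  {e : V × V | Fixes lt H K x y e.1 e.2}.ncard

/-- Double counting of bad pairs against candidates, a candidate being a non-maximal vertex with a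
chain number. A bad pair has at least `D * D` candidates, a candidate repairs at most `M` pairs, and
the number of chains contributes another factor `D`. -/
theorem IsChained.numBad_mul_le [Fintype V] {lt : V → V → Prop} [IsStrictOrder V lt] {D L K M : ℕ}
    {id pos : V → ℕ} {H : Digraph V} (h : IsChained lt D L id pos H) (hD : 1 ≤ D)
    (hK : (2 * L + 4) * D ≤ K) (hM : ∀ x y, lt x y → score lt H K x y ≤ M) :
    numBad lt H K * D ^ 3 ≤ numNonmax lt * Fintype.card V * M := by
  classical
  let N : Finset V := Finset.univ.filter fun u => ∃ v, lt u v
  have hN : N.card = numNonmax lt := by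
    rw [numNonmax, ← Set.ncard_coe_finset]
    simp [N]
  let B : Finset (V × V) := Finset.univ.filter fun e => IsBad lt H K e.1 e.2
  have hB : B.card = numBad lt H K := by
    rw [numBad, ← Set.ncard_coe_finset]
    simp [B]
  -- The first conjunct discards the default value of `chainFirst`, taken when the chain has no
  -- element above the vertex.
  let r : V × V → V × ℕ → Prop := fun e p => lt p.1 (chainFirst lt id pos p.1 p.2) ∧
    Fixes lt H K p.1 (chainFirst lt id pos p.1 p.2) e.1 e.2
  have key : B.card * (D * D) ≤ (N ×ˢ chainIds id).card * M := by
    refine Finset.card_mul_le_card_mul r (fun e he => ?_) (fun p hp => ?_)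
    · obtain ⟨X, C, hX, hC, hXN, hCi, hf⟩ := h.exists_fixes hD hK (Finset.mem_filter.1 he).2
      refine (Nat.mul_le_mul hX hC).trans ?_
      rw [← Finset.card_product]
      refine Finset.card_le_card fun p hp => ?_
      obtain ⟨h1, h2⟩ := Finset.mem_product.1 hp
      refine Finset.mem_filter.2 ⟨Finset.mem_product.2 ⟨?_, hCi h2⟩, hf _ h1 _ h2⟩
      exact Finset.mem_filter.2 ⟨Finset.mem_univ _, hXN _ h1⟩
    · by_cases hlt : lt p.1 (chainFirst lt id pos p.1 p.2)
      · refine le_trans ?_ (hM _ _ hlt)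
        rw [score, ← Set.ncard_coe_finset]
        refine Set.ncard_le_ncard (fun e he => ?_) (Set.toFinite _)
        exact (Finset.mem_filter.1 he).2.2
      · rw [Finset.card_eq_zero.2]
        · omega
        · exact Finset.filter_eq_empty_iff.2 fun e _ hr => hlt hr.1
  rw [Finset.card_product, hN, hB] at key
  calc numBad lt H K * D ^ 3 = D * (numBad lt H K * (D * D)) := by ring
    _ ≤ D * (numNonmax lt * (chainIds id).card * M) := Nat.mul_le_mul_left _ key
    _ = numNonmax lt * (D * (chainIds id).card) * M := by ring
    _ ≤ _ := by gcongr; exact h.system.card_mul_le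

/-- One greedy step adds an edge of largest score, if there is a bad pair. -/
def IsGreedyStep (lt : V → V → Prop) (K : ℕ) (H H' : Digraph V) : Prop :=
  (numBad lt H K = 0 ∧ H' = H) ∨ ∃ x y, lt x y ∧ 0 < score lt H K x y ∧
    (∀ x' y', lt x' y' → score lt H K x' y' ≤ score lt H K x y) ∧
    ∀ u v, H'.Adj u v ↔ H.Adj u v ∨ u = x ∧ v = y

theorem IsGreedyStep.le {lt : V → V → Prop} {K : ℕ} {H H' : Digraph V}
    (h : IsGreedyStep lt K H H') : H ≤ H' := by
  rcases h with ⟨-, rfl⟩ | ⟨x, y, -, -, -, h⟩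
  · exact le_rfl
  · exact fun u v huv => (h u v).2 (.inl huv)

/-- Pairs repaired by the new edge were bad before and are not bad now, hence are disjoint from the
surviving bad pairs. -/
theorem numBad_add_score_le [Finite V] {lt : V → V → Prop} {K : ℕ} {H H' : Digraph V} {x y : V}
    (hle : H ≤ H') (hxy : H'.Adj x y) : numBad lt H' K + score lt H K x y ≤ numBad lt H K := by
  rw [numBad, score, ← Set.ncard_union_eq _ (Set.toFinite _) (Set.toFinite _)]
  · refine Set.ncard_le_ncard ?_ (Set.toFinite _)
    rintro e (he | he)
    · exact ⟨he.1, fun hw => he.2 (hw.mono_graph hle)⟩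
    · exact he.1
  · rw [Set.disjoint_left]
    rintro e he ⟨-, a, b, hab, h1, h2⟩
    exact he.2 ((((h1.mono_graph hle).trans (.of_adj hxy)).trans (h2.mono_graph hle)).mono hab)

/-- Extra edges only shorten distances, and the added edge lies in `lt`; the chain system itself
never changes. -/
theorem IsChained.step {lt : V → V → Prop} {D L K : ℕ} {id pos : V → ℕ}
    {H H' : Digraph V} (h : IsChained lt D L id pos H) (hs : IsGreedyStep lt K H H') :
    IsChained lt D L id pos H' := by
  refine ⟨h.system, h.rest, ?_, fun u v h1 h2 h3 => (h.short u v h1 h2 h3).mono_graph hs.le,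
    fun u v huv => ?_⟩
  · rcases hs with ⟨-, rfl⟩ | ⟨x, y, hxy, -, -, hH⟩
    · exact h.sub
    · intro u v huv
      rcases (hH u v).1 huv with huv | ⟨rfl, rfl⟩
      · exact h.sub u v huv
      · exact hxy
  · obtain ⟨m, hm⟩ := h.reach u v huv
    exact ⟨m, hm.mono hs.le⟩

/-- The potential of a greedy run. -/
noncomputable def greedyPotential (α : ℝ) (b : ℕ) : ℝ := if b = 0 then 0 else 1 + Real.log b / α

/-- A step adds one edge and leaves at most (1 - α) b ≤ exp(-α) b bad pairs, so log b / α drops by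
at least 1. In the step that reaches zero, the summand 1 of the potential pays for the edge. -/
theorem IsChained.potential_step [Fintype V] {lt : V → V → Prop} [IsStrictOrder V lt]
    {D L K : ℕ} {id pos : V → ℕ} {H H' : Digraph V} (h : IsChained lt D L id pos H) (hD : 1 ≤ D)
    (hK : (2 * L + 4) * D ≤ K) (hs : IsGreedyStep lt K H H') {α : ℝ}
    (hα : α = (D : ℝ) ^ 3 / (numNonmax lt * Fintype.card V)) :
    numEdges H' + greedyPotential α (numBad lt H' K) ≤
      numEdges H + greedyPotential α (numBad lt H K) := by
  rcases hs with ⟨-, rfl⟩ | ⟨x, y, hxy, hpos, hmax, hH⟩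
  · exact le_rfl
  have hle : H ≤ H' := fun u v huv => (hH u v).2 (.inl huv)
  have hb := numBad_add_score_le (lt := lt) (K := K) hle ((hH x y).2 (.inr ⟨rfl, rfl⟩))
  have hM := h.numBad_mul_le hD hK hmax
  have he : (numEdges H' : ℝ) ≤ numEdges H + 1 := by
    have : {e : V × V | H'.Adj e.1 e.2} = insert (x, y) {e : V × V | H.Adj e.1 e.2} := by
      ext ⟨u, v⟩
      simp [hH u v, or_comm]
    rw [numEdges, this]
    exact_mod_cast Set.ncard_insert_le _ _
  set b := numBad lt H K
  set b' := numBad lt H' K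
  set s := score lt H K x y
  have hb0 : b ≠ 0 := by omega
  have hDpos : (0 : ℝ) < (D : ℝ) ^ 3 := by positivity
  have hNpos : 0 < numNonmax lt * Fintype.card V := by
    rcases Nat.eq_zero_or_pos (numNonmax lt * Fintype.card V) with h0 | h0
    · rw [h0, zero_mul] at hM
      have : 0 < b * D ^ 3 := by positivity
      omega
    · exact h0
  have hNpos' : (0 : ℝ) < numNonmax lt * Fintype.card V := by exact_mod_cast hNpos
  have hαpos : 0 < α := by rw [hα]; positivity
  have hbpos : (0 : ℝ) < b := by positivity
  have hlogb : 0 ≤ Real.log b := Real.log_natCast_nonneg b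
  have hsα : α * b ≤ s := by
    rw [hα, div_mul_eq_mul_div, div_le_iff₀ hNpos']
    have : (b : ℝ) * (D : ℝ) ^ 3 ≤ numNonmax lt * Fintype.card V * s := by exact_mod_cast hM
    linarith
  rw [greedyPotential, greedyPotential, if_neg hb0]
  split_ifs with hb'
  · have : 0 ≤ Real.log b / α := by positivity
    linarith
  · have hb'pos : (0 : ℝ) < b' := by positivity
    have hbb : (b' : ℝ) + s ≤ b := by exact_mod_cast hb
    have h1 : (b' : ℝ) ≤ b * Real.exp (-α) := by
      have := Real.add_one_le_exp (-α)
      nlinarith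
    have h2 : Real.log b' ≤ Real.log b - α := by
      have := Real.log_le_log hb'pos h1
      rwa [Real.log_mul hbpos.ne' (Real.exp_pos _).ne', Real.log_exp] at this
    have h3 : Real.log b' / α ≤ Real.log b / α - 1 := by
      rw [div_le_iff₀ hαpos, sub_mul, div_mul_cancel₀ _ hαpos.ne']
      linarith
    linarith

/-- The outcome of a greedy run: no bad pairs are left, and few edges have been added. -/
theorem IsChained.greedy [Fintype V] {lt : V → V → Prop} [IsStrictOrder V lt]
    {D L K : ℕ} {id pos : V → ℕ} {H : ℕ → Digraph V} (h : IsChained lt D L id pos (H 0))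
    (hD : 1 ≤ D) (hK : (2 * L + 4) * D ≤ K) (hs : ∀ i, IsGreedyStep lt K (H i) (H (i + 1)))
    {T : ℕ} (hT : Fintype.card V * Fintype.card V ≤ T) :
    IsChained lt D L id pos (H T) ∧ numBad lt (H T) K = 0 ∧ (numEdges (H T) : ℝ) ≤ numEdges (H 0) +
      (numNonmax lt + numNonmax lt * (2 * Real.log (Fintype.card V) *
        (Fintype.card V / (D : ℝ) ^ 3))) := by
  have hc : ∀ i, IsChained lt D L id pos (H i) := by
    intro i
    induction i with
    | zero => exact h
    | succ i ih => exact ih.step (hs i)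
  have hcard : ∀ i, numBad lt (H i) K ≤ Fintype.card V * Fintype.card V := by
    intro i
    rw [numBad, ← Fintype.card_prod, ← Nat.card_eq_fintype_card, ← Set.ncard_univ]
    exact Set.ncard_le_ncard (Set.subset_univ _) (Set.toFinite _)
  -- Each step taken while bad pairs exist repairs at least one, so as many steps as there are pairs
  -- of vertices suffice.
  have hbad : ∀ i, numBad lt (H i) K ≤ Fintype.card V * Fintype.card V - i := by
    intro i
    induction i with
    | zero => simpa using hcard 0
    | succ i ih =>
      rcases hs i with ⟨h0, he⟩ | ⟨x, y, -, hpos, -, hH⟩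
      · rw [he, h0]
        omega
      · have := numBad_add_score_le (lt := lt) (K := K) (hs i).le ((hH x y).2 (.inr ⟨rfl, rfl⟩))
        omega
  have hzero : numBad lt (H T) K = 0 := by
    have := hbad T
    omega
  refine ⟨hc T, hzero, ?_⟩
  set α : ℝ := (D : ℝ) ^ 3 / (numNonmax lt * Fintype.card V) with hα
  have hpot : ∀ i, numEdges (H i) + greedyPotential α (numBad lt (H i) K) ≤
      numEdges (H 0) + greedyPotential α (numBad lt (H 0) K) := by
    intro i
    induction i with
    | zero => exact le_rfl
    | succ i ih => exact ((hc i).potential_step hD hK (hs i) hα).trans ih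
  have h1 := hpot T
  rw [hzero, greedyPotential, if_pos rfl, add_zero] at h1
  refine h1.trans (add_le_add_right ?_ _)
  have hlog : 0 ≤ Real.log (Fintype.card V) := Real.log_natCast_nonneg _
  rw [greedyPotential]
  split_ifs with hb
  · positivity
  · have hN : 1 ≤ numNonmax lt := by
      rw [Nat.one_le_iff_ne_zero]
      intro h0
      refine hb ?_
      rw [numNonmax, Set.ncard_eq_zero (Set.toFinite _)] at h0
      rw [numBad, Set.ncard_eq_zero (Set.toFinite _)]
      refine Set.eq_empty_of_forall_notMem fun e he => ?_
      have : e.1 ∈ {u | ∃ v, lt u v} := ⟨_, he.1⟩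
      rw [h0] at this
      exact this
    have hN' : (1 : ℝ) ≤ numNonmax lt := by exact_mod_cast hN
    refine add_le_add hN' ?_
    have hlb : Real.log (numBad lt (H 0) K) ≤ 2 * Real.log (Fintype.card V) := by
      have h2 : ((numBad lt (H 0) K : ℕ) : ℝ) ≤ (Fintype.card V : ℝ) ^ 2 := by
        rw [sq]
        exact_mod_cast hcard 0
      have := Real.log_le_log (by positivity) h2
      rwa [Real.log_pow] at this
    rw [hα, div_div_eq_mul_div]
    calc Real.log (numBad lt (H 0) K) * (numNonmax lt * Fintype.card V) / (D : ℝ) ^ 3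
        ≤ 2 * Real.log (Fintype.card V) * (numNonmax lt * Fintype.card V) / (D : ℝ) ^ 3 := by
          gcongr
      _ = _ := by ring

/-! ### Representatives of strong components, and lower bounds for spanners -/

section Rep

variable {n : ℕ} (G : Digraph (Fin n))

/-- The vertex is the least one of its strong component. -/
def IsRep (u : Fin n) : Prop := ∀ v < u, ¬ (Relation.TransGen G.Adj u v ∧ Relation.TransGen G.Adj v u)

/-- Strict reachability between the least vertices of strong components. -/
def repLt (u v : Fin n) : Prop :=
  IsRep G u ∧ IsRep G v ∧ Relation.TransGen G.Adj u v ∧ ¬ Relation.TransGen G.Adj v u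

instance : IsStrictOrder (Fin n) (repLt G) where
  irrefl _ h := h.2.2.2 h.2.2.1
  trans _ _ _ h h' := ⟨h.1, h'.2.1, h.2.2.1.trans h'.2.2.1, fun hc => h.2.2.2 (h'.2.2.1.trans hc)⟩

/-- The edges between the least vertex of a strong component and the other ones. -/
def starGraph : Digraph (Fin n) where
  Adj u v := u ≠ v ∧ Relation.TransGen G.Adj u v ∧ Relation.TransGen G.Adj v u ∧
    (IsRep G u ∨ IsRep G v)

/-- The transitive closure without its loops. -/
def offDiagClosure : Digraph (Fin n) where
  Adj u v := u ≠ v ∧ Relation.TransGen G.Adj u v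

variable {G}

theorem IsRep.eq {u v : Fin n} (hu : IsRep G u) (hv : IsRep G v) (h : Relation.TransGen G.Adj u v)
    (h' : Relation.TransGen G.Adj v u) : u = v := by
  rcases lt_trichotomy u v with hl | hl | hl
  · exact absurd ⟨h', h⟩ (hv u hl)
  · exact hl
  · exact absurd ⟨h, h'⟩ (hu v hl)

/-- The case `r = u` is separate because `Relation.TransGen` is not reflexive: a vertex on no closed
walk does not reach itself. -/
theorem exists_isRep (G : Digraph (Fin n)) (u : Fin n) : ∃ r, IsRep G r ∧
    (r = u ∨ Relation.TransGen G.Adj u r ∧ Relation.TransGen G.Adj r u) := by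
  obtain ⟨r, hr, hmin⟩ := WellFounded.has_min (α := Fin n) wellFounded_lt
    {r | r = u ∨ Relation.TransGen G.Adj u r ∧ Relation.TransGen G.Adj r u} ⟨u, .inl rfl⟩
  refine ⟨r, fun v hv ⟨h1, h2⟩ => hmin v ?_ hv, hr⟩
  rcases hr with rfl | ⟨h3, h4⟩
  · exact .inr ⟨h1, h2⟩
  · exact .inr ⟨h3.trans h1, h2.trans h4⟩

/-! ### Lower bounds for spanners -/

theorem IsTCSpanner.within {k : ℕ} {H : Digraph (Fin n)} (h : IsTCSpanner k G H) {u v : Fin n}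
    (huv : Relation.TransGen G.Adj u v) : Within H k u v := (dist_le_iff H u v k).1 (h.2 u v huv)

/-- A vertex that reaches another one must have an outgoing edge in `H`, and edges with different
tails are different. -/
theorem IsTCSpanner.ncard_offDiag_le {k : ℕ} {H : Digraph (Fin n)} (h : IsTCSpanner k G H) :
    {u | ∃ v, (offDiagClosure G).Adj u v}.ncard ≤ numEdges H := by
  have key : ∀ u ∈ {u | ∃ v, (offDiagClosure G).Adj u v}, ∃ w, H.Adj u w := by
    rintro u ⟨v, hne, huv⟩
    obtain ⟨m, -, hw⟩ := h.within huv
    cases hw with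
    | nil => exact absurd rfl hne
    | cons h _ => exact ⟨_, h⟩
  choose! f hf using key
  exact Set.ncard_le_ncard_of_injOn (fun u => (u, f u)) (fun u hu => hf u hu)
    (fun u _ v _ huv => congrArg Prod.fst huv) (Set.toFinite _)

theorem IsTCSpanner.numNonmax_le {k : ℕ} {H : Digraph (Fin n)} (h : IsTCSpanner k G H) :
    numNonmax (repLt G) ≤ numEdges H := by
  refine (Set.ncard_le_ncard ?_ (Set.toFinite _)).trans h.ncard_offDiag_le
  rintro u ⟨v, huv⟩
  exact ⟨v, fun he => irrefl_of (repLt G) u (by rwa [← he] at huv), huv.2.2.1⟩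

theorem IsTCSpanner.numEdges_offDiag_le {k : ℕ} {H : Digraph (Fin n)} (h : IsTCSpanner k G H) :
    numEdges (offDiagClosure G) ≤ numEdges H * n := by
  calc numEdges (offDiagClosure G)
      ≤ ({u | ∃ v, (offDiagClosure G).Adj u v} ×ˢ (Set.univ : Set (Fin n))).ncard :=
        Set.ncard_le_ncard (fun e he => ⟨⟨e.2, he⟩, trivial⟩) (Set.toFinite _)
    _ ≤ _ := by
        rw [Set.ncard_prod, Set.ncard_univ, Nat.card_fin]
        exact Nat.mul_le_mul_right _ h.ncard_offDiag_le

/-- A component has only one representative, so a star edge into a representative is determined by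
its tail and one out of a representative by its head. Each of these ends reaches a vertex other than
itself. -/
theorem IsTCSpanner.numEdges_star_le {k : ℕ} {H : Digraph (Fin n)} (h : IsTCSpanner k G H) :
    numEdges (starGraph G) ≤ 2 * numEdges H := by
  have h1 : {e : Fin n × Fin n | (starGraph G).Adj e.1 e.2 ∧ IsRep G e.2}.ncard ≤ numEdges H := by
    refine le_trans (Set.ncard_le_ncard_of_injOn Prod.fst ?_ ?_ (Set.toFinite _)) h.ncard_offDiag_le
    · rintro ⟨u, v⟩ ⟨⟨h1, h2, -⟩, -⟩
      exact ⟨v, h1, h2⟩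
    · rintro ⟨u, v⟩ ⟨⟨h1, h2, h3, -⟩, hv⟩ ⟨u', v'⟩ ⟨⟨h1', h2', h3', -⟩, hv'⟩ (rfl : u = u')
      exact Prod.ext rfl (hv.eq hv' (h3.trans h2') (h3'.trans h2))
  have h2 : {e : Fin n × Fin n | (starGraph G).Adj e.1 e.2 ∧ IsRep G e.1}.ncard ≤ numEdges H := by
    refine le_trans (Set.ncard_le_ncard_of_injOn Prod.snd ?_ ?_ (Set.toFinite _)) h.ncard_offDiag_le
    · rintro ⟨u, v⟩ ⟨⟨h1, h2, h3, -⟩, -⟩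
      exact ⟨u, h1.symm, h3⟩
    · rintro ⟨u, v⟩ ⟨⟨h1, h2, h3, -⟩, hv⟩ ⟨u', v'⟩ ⟨⟨h1', h2', h3', -⟩, hv'⟩ (rfl : v = v')
      exact Prod.ext (hv.eq hv' (h2.trans h3') (h2'.trans h3)) rfl
  have h3 : {e : Fin n × Fin n | (starGraph G).Adj e.1 e.2} ⊆
      {e : Fin n × Fin n | (starGraph G).Adj e.1 e.2 ∧ IsRep G e.2} ∪
      {e : Fin n × Fin n | (starGraph G).Adj e.1 e.2 ∧ IsRep G e.1} := by
    intro e he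
    rcases he.2.2.2 with h | h
    · exact .inr ⟨he, h⟩
    · exact .inl ⟨he, h⟩
  have h4 := (Set.ncard_le_ncard h3 (Set.toFinite _)).trans (Set.ncard_union_le _ _)
  rw [numEdges]
  omega

/-- A spanner has an edge between the strong components of any two representatives one of which
covers the other one. -/
theorem exists_adj_of_cover {H : Digraph (Fin n)} (hH : H ≤ transClosure G) {m : ℕ} {a b x : Fin n}
    (hab : (coverGraph (repLt G)).Adj a b) (hw : HasWalk H m x b)
    (hx : x = a ∨ Relation.TransGen G.Adj x a ∧ Relation.TransGen G.Adj a x) :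
    ∃ p q, H.Adj p q ∧ (p = a ∨ Relation.TransGen G.Adj p a ∧ Relation.TransGen G.Adj a p) ∧
      (q = b ∨ Relation.TransGen G.Adj q b ∧ Relation.TransGen G.Adj b q) := by
  obtain ⟨hlt, hcov⟩ := hab
  generalize hb : b = b' at hw
  induction hw with
  | nil u =>
    subst hb
    rcases hx with rfl | ⟨h1, -⟩
    · exact absurd hlt (irrefl_of _ _)
    · exact absurd h1 hlt.2.2.2
  | @cons m x y c hxy hyb ih =>
    subst hb
    by_cases hya : y = a ∨ Relation.TransGen G.Adj y a ∧ Relation.TransGen G.Adj a y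
    · exact ih hya rfl
    -- Here the walk first leaves the component of `a`. If `y` were not in the component of `b`, its
    -- representative would lie strictly between `a` and `b`.
    · refine ⟨x, y, hxy, hx, ?_⟩
      have hay : Relation.TransGen G.Adj a y := by
        rcases hx with rfl | ⟨-, h2⟩
        · exact hH hxy
        · exact h2.trans (hH hxy)
      by_contra hyb'
      have hyb2 : Relation.TransGen G.Adj y b := by
        cases hyb with
        | nil => exact absurd (.inl rfl) hyb'
        | cons h1 h2 =>
          exact (transGen_iff_hasWalk.2 ⟨_, _, h1, h2⟩).lift' id fun p q hpq => hH hpq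
      push Not at hya hyb'
      obtain ⟨r, hr, hry⟩ := exists_isRep G y
      have har : Relation.TransGen G.Adj a r := by
        rcases hry with rfl | ⟨h1, -⟩
        · exact hay
        · exact hay.trans h1
      have hrb : Relation.TransGen G.Adj r b := by
        rcases hry with rfl | ⟨-, h1⟩
        · exact hyb2
        · exact h1.trans hyb2
      have hra : ¬ Relation.TransGen G.Adj r a := by
        intro hra
        rcases hry with rfl | ⟨h1, -⟩
        · exact hya.2 hra hay
        · exact hya.2 (h1.trans hra) hay
      have hbr : ¬ Relation.TransGen G.Adj b r := by
        intro hbr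
        rcases hry with rfl | ⟨-, h1⟩
        · exact hyb'.2 hyb2 hbr
        · exact hyb'.2 hyb2 (hbr.trans h1)
      exact hcov r ⟨hlt.1, hr, har, hra⟩ ⟨hr, hlt.2.1, hrb, hbr⟩

/-- The ends of the edge given by `exists_adj_of_cover` determine the two components and thereby
their representatives, so different cover relations get different edges. -/
theorem IsTCSpanner.numEdges_cover_le {k : ℕ} {H : Digraph (Fin n)} (h : IsTCSpanner k G H) :
    numEdges (coverGraph (repLt G)) ≤ numEdges H := by
  have key : ∀ e ∈ {e : Fin n × Fin n | (coverGraph (repLt G)).Adj e.1 e.2}, ∃ f : Fin n × Fin n,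
      H.Adj f.1 f.2 ∧
      (f.1 = e.1 ∨ Relation.TransGen G.Adj f.1 e.1 ∧ Relation.TransGen G.Adj e.1 f.1) ∧
      (f.2 = e.2 ∨ Relation.TransGen G.Adj f.2 e.2 ∧ Relation.TransGen G.Adj e.2 f.2) := by
    rintro ⟨a, b⟩ hab
    obtain ⟨m, -, hw⟩ := h.within hab.1.2.2.1
    obtain ⟨p, q, h1, h2⟩ := exists_adj_of_cover h.1 hab hw (.inl rfl)
    exact ⟨(p, q), h1, h2⟩
  have rep_eq : ∀ p a b : Fin n, IsRep G a → IsRep G b →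
      (p = a ∨ Relation.TransGen G.Adj p a ∧ Relation.TransGen G.Adj a p) →
      (p = b ∨ Relation.TransGen G.Adj p b ∧ Relation.TransGen G.Adj b p) → a = b := by
    rintro p a b ha hb (rfl | ⟨h1, h2⟩) (rfl | ⟨h3, h4⟩)
    · rfl
    · exact ha.eq hb h3 h4
    · exact ha.eq hb h2 h1
    · exact ha.eq hb (h2.trans h3) (h4.trans h1)
  choose! f hf using key
  refine Set.ncard_le_ncard_of_injOn f (fun e he => (hf e he).1) ?_ (Set.toFinite _)
  rintro ⟨a, b⟩ he ⟨a', b'⟩ he' hff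
  have h1 := (hf _ he).2
  have h2 := (hf _ he').2
  rw [← hff] at h2
  rw [rep_eq _ a a' he.1.1 he'.1.1 h1.1 h2.1, rep_eq _ b b' he.1.2.1 he'.1.2.1 h1.2 h2.2]

/-! ### Spanners built from the order on representatives -/

theorem isTCSpanner_offDiag {k : ℕ} (hk : 1 ≤ k) : IsTCSpanner k G (offDiagClosure G) := by
  refine ⟨fun u v h => h.2, fun u v h => (dist_le_iff _ _ _ _).2 ?_⟩
  by_cases huv : u = v
  · rw [huv]
    exact Within.refl _ _ _
  · exact (Within.of_adj (show (offDiagClosure G).Adj u v from ⟨huv, h⟩)).mono hk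

/-- A path goes from `u` to its representative, then in at most `K` steps to the representative of
`v`, then to `v`; the two end steps account for `K + 2`. -/
theorem isTCSpanner_sup_star {k K : ℕ} (hk : K + 2 ≤ k) {H : Digraph (Fin n)}
    (hH : ∀ u v, H.Adj u v → repLt G u v) (hK : ∀ u v, repLt G u v → Within H K u v) :
    IsTCSpanner k G (H ⊔ starGraph G) := by
  refine ⟨?_, fun u v h => (dist_le_iff _ _ _ _).2 ?_⟩
  · rintro u v (h | h)
    · exact (hH u v h).2.2.1
    · exact h.2.1
  · obtain ⟨r, hr, hru⟩ := exists_isRep G u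
    obtain ⟨s, hs, hsv⟩ := exists_isRep G v
    have h1 : Within (H ⊔ starGraph G) 1 u r := by
      by_cases hne : u = r
      · rw [hne]; exact .refl _ _ _
      · rcases hru with rfl | hru
        · exact absurd rfl hne
        · exact .of_adj (.inr ⟨hne, hru.1, hru.2, .inr hr⟩)
    have h2 : Within (H ⊔ starGraph G) 1 s v := by
      by_cases hne : s = v
      · rw [hne]; exact .refl _ _ _
      · rcases hsv with rfl | hsv
        · exact absurd rfl hne
        · exact .of_adj (.inr ⟨hne, hsv.2, hsv.1, .inl hs⟩)
    have h3 : Relation.TransGen G.Adj r s := by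
      rcases hru with rfl | hru
      · rcases hsv with rfl | hsv
        · exact h
        · exact h.trans hsv.1
      · rcases hsv with rfl | hsv
        · exact hru.2.trans h
        · exact (hru.2.trans h).trans hsv.1
    have h4 : Within (H ⊔ starGraph G) K r s := by
      by_cases hsr : Relation.TransGen G.Adj s r
      · rw [hr.eq hs h3 hsr]
        exact .refl _ _ _
      · exact (hK r s ⟨hr, hs, h3, hsr⟩).mono_graph le_sup_left
    exact ((h1.trans h4).trans h2).mono (by omega)

theorem numEdges_sup_le {V : Type*} [Finite V] (G H : Digraph V) :
    numEdges (G ⊔ H) ≤ numEdges G + numEdges H :=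
  (Set.ncard_le_ncard (fun _ he => he) (Set.toFinite _)).trans (Set.ncard_union_le _ _)

end Rep

/-! ### Extraction of chains -/

section Chains

/-- `q` numbers the elements of an `lt`-chain of `l + 1` elements of `U` that ends in `v`. -/
structure IsRow (U : V → Prop) (lt : V → V → Prop) (l : ℕ) (v : V) (q : V → ℕ) : Prop where
  last : q v = l + 1
  le : ∀ w, q w ≤ l + 1
  mem : ∀ w, q w ≠ 0 → U w
  lt_of : ∀ w w', q w ≠ 0 → q w < q w' → lt w w'
  inj : ∀ w w', q w ≠ 0 → q w = q w' → w = w'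
  surj : ∀ p, 1 ≤ p → p ≤ l + 1 → ∃ w, q w = p

/-- The row of every vertex that ends a chain of `l + 1` elements numbers such a chain. -/
def AreRows (U : V → Prop) (lt : V → V → Prop) (l : ℕ) (Q : V → V → ℕ) : Prop :=
  ∀ v, (ChainTo U lt l v → IsRow U lt l v (Q v)) ∧ (¬ ChainTo U lt l v → Q v v = 0)

theorem AreRows.diag {U : V → Prop} {lt : V → V → Prop} {l : ℕ} {Q : V → V → ℕ}
    (h : AreRows U lt l Q) (v : V) : Q v v = l + 1 ↔ ChainTo U lt l v := by
  by_cases hv : ChainTo U lt l v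
  · simp [hv, ((h v).1 hv).last]
  · simp [hv, (h v).2 hv]

theorem areRows_zero {U : V → Prop} {lt : V → V → Prop} {Q : V → V → ℕ}
    (h1 : ∀ v w, v = w ∧ U v → Q v w = 1) (h0 : ∀ v w, ¬ (v = w ∧ U v) → Q v w = 0) :
    AreRows U lt 0 Q := by
  intro v
  refine ⟨fun hv => ?_, fun hv => h0 v v fun h => hv h.2⟩
  have hne : ∀ w, Q v w ≠ 0 → v = w := fun w hw => by
    by_contra hcon
    exact hw (h0 v w fun h => hcon h.1)
  have hv1 : Q v v = 1 := h1 v v ⟨rfl, hv⟩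
  refine ⟨hv1, fun w => ?_, fun w hw => hne w hw ▸ hv, fun w w' hw hw' => ?_,
    fun w w' hw hw' => (hne w hw).symm.trans (hne w' (hw' ▸ hw)), fun p hp hp' => ⟨v, by omega⟩⟩
  · by_cases hw : Q v w = 0
    · omega
    · rw [← hne w hw, hv1]
  · rw [← hne w hw, ← hne w' (by omega)] at hw'
    omega

/-- The vertex `v` is put on top of the row of a predecessor `x`. It is not in that row already, as
the elements there lie at or below `x`. -/
theorem AreRows.succ {U : V → Prop} {lt : V → V → Prop} [IsStrictOrder V lt] {l : ℕ}
    {Q Q' : V → V → ℕ} (h : AreRows U lt l Q)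
    (h1 : ∀ v, ChainTo U lt (l + 1) v → Q' v v = l + 2 ∧
      ∃ x, ChainTo U lt l x ∧ lt x v ∧ ∀ w, v ≠ w → Q' v w = Q x w)
    (h0 : ∀ v, ¬ ChainTo U lt (l + 1) v → Q' v v = 0) : AreRows U lt (l + 1) Q' := by
  intro v
  refine ⟨fun hv => ?_, h0 v⟩
  obtain ⟨hvv, x, hx, hxv, hw⟩ := h1 v hv
  have hr := (h x).1 hx
  have hQv : Q x v = 0 := by
    by_contra hcon
    rcases Nat.lt_or_ge (Q x v) (l + 1) with hl | hl
    · exact irrefl_of lt v (trans_of lt (hr.lt_of v x hcon (by rw [hr.last]; exact hl)) hxv)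
    · have := hr.inj v x hcon (by rw [hr.last]; exact le_antisymm (hr.le v) hl)
      subst this
      exact irrefl_of lt v hxv
  have hlt : ∀ w, v ≠ w → Q' v w ≤ l + 1 := fun w hne => by rw [hw w hne]; exact hr.le w
  have hltv : ∀ w, v ≠ w → Q' v w ≠ 0 → lt w v := by
    intro w hne h0
    rw [hw w hne] at h0
    rcases Nat.lt_or_ge (Q x w) (l + 1) with hl | hl
    · exact trans_of lt (hr.lt_of w x h0 (by rw [hr.last]; exact hl)) hxv
    · rwa [hr.inj w x h0 (by rw [hr.last]; exact le_antisymm (hr.le w) hl)]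
  refine ⟨hvv, fun w => ?_, fun w hw0 => ?_, fun w w' hw0 hlt' => ?_, fun w w' hw0 heq => ?_,
    fun p hp hp' => ?_⟩
  · by_cases hne : v = w
    · rw [← hne, hvv]
    · have := hlt w hne
      omega
  · by_cases hne : v = w
    · rw [← hne]
      exact hv.1
    · rw [hw w hne] at hw0
      exact hr.mem w hw0
  · by_cases hne : v = w
    · subst hne
      by_cases hne' : v = w'
      · subst hne'
        omega
      · have := hlt w' hne'
        omega
    · by_cases hne' : v = w'
      · subst hne'
        exact hltv w hne hw0
      · rw [hw w hne] at hw0 hlt'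
        rw [hw w' hne'] at hlt'
        exact hr.lt_of w w' hw0 hlt'
  · by_cases hne : v = w
    · by_contra hne'
      have := hlt w' (fun h => hne' (hne.symm.trans h))
      rw [← heq, ← hne, hvv] at this
      omega
    · by_cases hne' : v = w'
      · have := hlt w hne
        rw [heq, ← hne', hvv] at this
        omega
      · rw [hw w hne] at hw0 heq
        rw [hw w' hne'] at heq
        exact hr.inj w w' hw0 heq
  · by_cases hpl : p = l + 2
    · exact ⟨v, by rw [hvv, hpl]⟩
    · obtain ⟨w, hwp⟩ := hr.surj p hp (by omega)
      refine ⟨w, ?_⟩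
      rw [hw w, hwp]
      rintro rfl
      omega

/-- The state of the extraction of chains after `t` passes. -/
structure IsExtraction (lt : V → V → Prop) (D t : ℕ) (id pos : V → ℕ) : Prop where
  system : IsChainSystem lt D id pos
  id_le : ∀ u, id u ≤ t
  pos_eq : ∀ u, id u = 0 → pos u = 0
  progress : (∀ v, ¬ ChainTo (fun v => id v = 0) lt (D - 1) v) ∨ t ≤ {u | id u ≠ 0}.ncard

theorem IsExtraction.zero {lt : V → V → Prop} {D : ℕ} {id pos : V → ℕ} (hid : ∀ u, id u = 0)
    (hpos : ∀ u, pos u = 0) : IsExtraction lt D 0 id pos :=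
  ⟨⟨fun u _ h => absurd (hid u) h, fun u _ h => absurd (hid u) h, fun u h => absurd (hid u) h,
    fun u _ h => absurd (hid u) h⟩, fun u => (hid u).le, fun u _ => hpos u, .inr (Nat.zero_le _)⟩

theorem IsExtraction.succ_of_none {lt : V → V → Prop} {D t : ℕ} {id pos : V → ℕ}
    (h : IsExtraction lt D t id pos)
    (hn : ∀ v, ¬ ChainTo (fun v => id v = 0) lt (D - 1) v) : IsExtraction lt D (t + 1) id pos :=
  ⟨h.system, fun u => (h.id_le u).trans (by omega), h.pos_eq, .inl hn⟩

/-- The number `t + 1` is fresh since all earlier ones are at most `t`, and adding `q` to `pos`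
amounts to assigning it, since unnumbered vertices have position 0. At least `v` becomes numbered,
which is the progress made. -/
theorem IsExtraction.succ_of_row [Finite V] {lt : V → V → Prop} {D t : ℕ}
    {id pos id' pos' q : V → ℕ} {v : V} (h : IsExtraction lt D t id pos) (hD : 1 ≤ D)
    (hq : IsRow (fun v => id v = 0) lt (D - 1) v q)
    (h1 : ∀ w, q w ≠ 0 → id' w = t + 1) (h0 : ∀ w, q w = 0 → id' w = id w)
    (hp : ∀ w, pos' w = pos w + q w) : IsExtraction lt D (t + 1) id' pos' := by
  have hcase : ∀ w, (q w ≠ 0 ∧ id w = 0 ∧ id' w = t + 1 ∧ pos' w = q w) ∨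
      (q w = 0 ∧ id' w = id w ∧ pos' w = pos w ∧ id' w ≠ t + 1) := by
    intro w
    by_cases hw : q w = 0
    · have := h.id_le w
      exact .inr ⟨hw, h0 w hw, by rw [hp, hw, add_zero], by rw [h0 w hw]; omega⟩
    · have := hq.mem w hw
      exact .inl ⟨hw, this, h1 w hw, by rw [hp, h.pos_eq w this, zero_add]⟩
  have hD' : D - 1 + 1 = D := by omega
  refine ⟨⟨fun u w hu huw hlt => ?_, fun u w hu huw hlt => ?_, fun u hu => ?_,
    fun u p hu hp1 hp2 => ?_⟩, fun u => ?_, fun u hu => ?_, ?_⟩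
  · rcases hcase u with ⟨a1, a2, a3, a4⟩ | ⟨a1, a2, a3, a4⟩ <;>
      rcases hcase w with ⟨b1, b2, b3, b4⟩ | ⟨b1, b2, b3, b4⟩
    · exact hq.lt_of u w a1 (by omega)
    · omega
    · omega
    · exact h.system.lt_of u w (by omega) (by omega) (by omega)
  · rcases hcase u with ⟨a1, a2, a3, a4⟩ | ⟨a1, a2, a3, a4⟩ <;>
      rcases hcase w with ⟨b1, b2, b3, b4⟩ | ⟨b1, b2, b3, b4⟩
    · exact hq.inj u w a1 (by omega)
    · omega
    · omega
    · exact h.system.inj u w (by omega) (by omega) (by omega)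
  · rcases hcase u with ⟨a1, a2, a3, a4⟩ | ⟨a1, a2, a3, a4⟩
    · have := hq.le u
      omega
    · have := h.system.range u (by omega)
      omega
  · rcases hcase u with ⟨a1, a2, a3, a4⟩ | ⟨a1, a2, a3, a4⟩
    · obtain ⟨w, hw⟩ := hq.surj p hp1 (by omega)
      refine ⟨w, ?_⟩
      rcases hcase w with ⟨b1, b2, b3, b4⟩ | ⟨b1, b2, b3, b4⟩ <;> omega
    · obtain ⟨w, hw, hwp⟩ := h.system.surj u p (by omega) hp1 hp2
      refine ⟨w, ?_⟩
      rcases hcase w with ⟨b1, b2, b3, b4⟩ | ⟨b1, b2, b3, b4⟩ <;> omega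
  · have := h.id_le u
    rcases hcase u with ⟨a1, a2, a3, a4⟩ | ⟨a1, a2, a3, a4⟩ <;> omega
  · rcases hcase u with ⟨a1, a2, a3, a4⟩ | ⟨a1, a2, a3, a4⟩
    · omega
    · rw [a3]
      exact h.pos_eq u (by omega)
  · rcases h.progress with hn | hn
    · left
      intro w hw
      have : ∀ l w, ChainTo (fun v => id' v = 0) lt l w → ChainTo (fun v => id v = 0) lt l w := by
        intro l
        induction l with
        | zero =>
          intro w (hw : id' w = 0)
          show id w = 0
          rcases hcase w with ⟨b1, b2, b3, b4⟩ | ⟨b1, b2, b3, b4⟩ <;> omega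
        | succ l ih =>
          rintro w ⟨hw, x, hx, hxw⟩
          refine ⟨?_, x, ih x hx, hxw⟩
          rcases hcase w with ⟨b1, b2, b3, b4⟩ | ⟨b1, b2, b3, b4⟩ <;> omega
      exact hn w (this _ w hw)
    · right
      refine Nat.succ_le_of_lt (lt_of_le_of_lt hn (Set.ncard_lt_ncard ⟨fun w hw => ?_, fun hs => ?_⟩
        (Set.toFinite _)))
      · simp only [Set.mem_ofPred_eq] at hw ⊢
        rcases hcase w with ⟨b1, b2, b3, b4⟩ | ⟨b1, b2, b3, b4⟩ <;> omega
      · have hv := hq.last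
        have : id v ≠ 0 := hs (show id' v ≠ 0 by rw [h1 v (by omega)]; omega)
        exact this (hq.mem v (by omega))

theorem ChainTo.mem {U : V → Prop} {lt : V → V → Prop} {l : ℕ} {v : V} (h : ChainTo U lt l v) :
    U v := by
  cases l with
  | zero => exact h
  | succ l => exact h.1

/-- If the extraction never got stuck, all vertices are numbered after this many passes, and no
unnumbered one can end a chain. -/
theorem IsExtraction.rest [Fintype V] {lt : V → V → Prop} {D : ℕ} {id pos : V → ℕ}
    (h : IsExtraction lt D (Fintype.card V) id pos) (v : V) :
    ¬ ChainTo (fun v => id v = 0) lt (D - 1) v := by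
  rcases h.progress with hn | hn
  · exact hn v
  · intro hv
    have : {u | id u ≠ 0} = Set.univ := by
      refine Set.eq_of_subset_of_ncard_le (Set.subset_univ _) ?_ (Set.toFinite _)
      rwa [Set.ncard_univ, Nat.card_eq_fintype_card]
    exact (this ▸ Set.mem_univ v : v ∈ {u | id u ≠ 0}) hv.mem

/-- The graph with the cover relation and the shortcuts on the chains. -/
theorem IsExtraction.isChained [Fintype V] {lt : V → V → Prop} [IsStrictOrder V lt] {D L : ℕ}
    {id pos : V → ℕ} (h : IsExtraction lt D (Fintype.card V) id pos) (hL : D < 2 ^ L) :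
    IsChained lt D L id pos (coverGraph lt ⊔ chainGraph id pos) := by
  refine ⟨h.system, h.rest, ?_, fun u v hu huv hle => ?_, fun u v huv => ?_⟩
  · rintro u v (huv | ⟨hu, huv, l, hl⟩)
    · exact huv.1
    · have : 0 < 2 ^ l := by positivity
      exact h.system.lt_of u v hu huv (by omega)
  · have := h.system.range v (huv ▸ hu)
    exact (h.system.within L hu huv hle (by omega)).mono_graph le_sup_right
  · obtain ⟨m, hm⟩ := hasWalk_coverGraph huv
    exact ⟨m, hm.mono le_sup_left⟩

end Chains

/-! ### Distances -/

/-- The distance from `u` to `v`, cut off at `n`. -/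
noncomputable def cutDist {V : Type*} (H : Digraph V) (n : ℕ) (u v : V) : ℕ :=
  open Classical in ((Finset.range n).filter fun l => ¬ Within H l u v).card

/-- The lengths that are too short form an initial segment, so their number is the distance. -/
theorem cutDist_le_iff {V : Type*} {H : Digraph V} {n l : ℕ} {u v : V} (hl : l < n) :
    cutDist H n u v ≤ l ↔ Within H l u v := by
  classical
  constructor
  · intro h
    by_contra hcon
    have : Finset.range (l + 1) ⊆ (Finset.range n).filter fun l => ¬ Within H l u v := by
      intro i hi
      have := Finset.mem_range.1 hi
      exact Finset.mem_filter.2 ⟨Finset.mem_range.2 (by omega), fun hw => hcon (hw.mono (by omega))⟩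
    have h1 := Finset.card_le_card this
    rw [Finset.card_range] at h1
    rw [cutDist] at h
    have h2 : l + 1 ≤ l := by
      refine le_trans h1 (le_trans (le_of_eq ?_) h)
      congr
    omega
  · intro h
    have : ((Finset.range n).filter fun l => ¬ Within H l u v) ⊆ Finset.range l := by
      intro i hi
      have := (Finset.mem_filter.1 hi).2
      refine Finset.mem_range.2 ?_
      by_contra hcon
      exact this (h.mono (by omega))
    have h1 := Finset.card_le_card this
    rw [Finset.card_range] at h1
    refine le_trans (le_of_eq ?_) h1
    rw [cutDist]

theorem cutDist_lt_iff {n : ℕ} {H : Digraph (Fin n)} {u v : Fin n} :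
    cutDist H n u v < n ↔ ∃ m, HasWalk H m u v := by
  have hn : 0 < n := u.pos
  rw [show cutDist H n u v < n ↔ cutDist H n u v ≤ n - 1 by omega, cutDist_le_iff (by omega)]
  constructor
  · rintro ⟨m, -, hm⟩
    exact ⟨m, hm⟩
  · rintro ⟨m, hm⟩
    simpa using hm.within_card

/-- For `K ≥ n` both sides are false, but only because `v` is reachable; otherwise the cutoff would
spoil the equivalence. -/
theorem cutDist_gt_iff {n K : ℕ} {H : Digraph (Fin n)} {u v : Fin n} (h : ∃ m, HasWalk H m u v) :
    K < cutDist H n u v ↔ ¬ Within H K u v := by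
  have h1 := cutDist_lt_iff.2 h
  by_cases hK : K < n
  · rw [← not_le, cutDist_le_iff hK]
  · have h2 : Within H K u v := ((cutDist_le_iff h1).1 le_rfl).mono (by omega)
    simp only [h2, not_true_eq_false, iff_false]
    omega

/-- A bad pair is still connected, so `K` is below its distance and hence below `n`; all lengths
involved stay in the range where the cutoff is invisible. -/
theorem fixes_iff_cutDist {n K : ℕ} {lt : Fin n → Fin n → Prop} {H : Digraph (Fin n)}
    (hr : ∀ u v, lt u v → ∃ m, HasWalk H m u v) {x y u v : Fin n} :
    Fixes lt H K x y u v ↔ (lt u v ∧ K < cutDist H n u v) ∧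
      cutDist H n u x + 1 + cutDist H n y v ≤ K := by
  constructor
  · rintro ⟨⟨h1, h2⟩, a, b, hab, ha, hb⟩
    have h3 := (cutDist_gt_iff (hr u v h1)).2 h2
    have h4 := cutDist_lt_iff.2 (hr u v h1)
    have h5 := (cutDist_le_iff (n := n) (by omega)).2 ha
    have h6 := (cutDist_le_iff (n := n) (by omega)).2 hb
    exact ⟨⟨h1, h3⟩, by omega⟩
  · rintro ⟨⟨h1, h2⟩, h3⟩
    have h4 := cutDist_lt_iff.2 (hr u v h1)
    exact ⟨⟨h1, (cutDist_gt_iff (hr u v h1)).1 h2⟩, _, _, h3,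
      (cutDist_le_iff (by omega)).1 le_rfl, (cutDist_le_iff (by omega)).1 le_rfl⟩

/-! ### Terms as formulas -/

/-- The term is nonzero. -/
def Tm.Holds (A : ℕ → ℕ → ℕ → ℕ) (t : Tm) (ρ : ℕ → ℕ) : Prop := t.eval A ρ ≠ 0

/-- Negation. -/
def Tm.not (t : Tm) : Tm := .sub (.lit 1) t

/-- Conjunction. -/
def Tm.and (s t : Tm) : Tm := .ite s t (.lit 0)

/-- Disjunction. -/
def Tm.or (s t : Tm) : Tm := .add s t

/-- The relation `<`. -/
def Tm.lt (s t : Tm) : Tm := .sub t s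

/-- The relation `≤`. -/
def Tm.le (s t : Tm) : Tm := .not (.sub s t)

/-- Equality. -/
def Tm.eq (s t : Tm) : Tm := .and (.le s t) (.le t s)

/-- Universal quantification over the variable `x + 2`. -/
def Tm.all (x : ℕ) (t : Tm) : Tm := .not (.sum x (.not t))

/-- The least value of a variable for which `f` holds, with the auxiliary bound variables `x + 2`
and `y + 2`. -/
def Tm.least (x y : ℕ) (f : Tm → Tm) : Tm :=
  .sum x (.not (.sum y (.and (.le (.var (y + 2)) (.var (x + 2))) (f (.var (y + 2))))))

section

variable (A : ℕ → ℕ → ℕ → ℕ) (s t c : Tm) (ρ : ℕ → ℕ)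

@[simp] theorem Tm.holds_not : (Tm.not t).Holds A ρ ↔ ¬ t.Holds A ρ := by
  simp only [Tm.Holds, Tm.not, Tm.eval]
  omega

@[simp] theorem Tm.holds_and : (Tm.and s t).Holds A ρ ↔ s.Holds A ρ ∧ t.Holds A ρ := by
  simp only [Tm.Holds, Tm.and, Tm.eval]
  split_ifs with h <;> simp [h]

@[simp] theorem Tm.holds_or : (Tm.or s t).Holds A ρ ↔ s.Holds A ρ ∨ t.Holds A ρ := by
  simp only [Tm.Holds, Tm.or, Tm.eval]
  omega

@[simp] theorem Tm.holds_lt : (Tm.lt s t).Holds A ρ ↔ s.eval A ρ < t.eval A ρ := by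
  simp only [Tm.Holds, Tm.lt, Tm.eval]
  omega

@[simp] theorem Tm.holds_le : (Tm.le s t).Holds A ρ ↔ s.eval A ρ ≤ t.eval A ρ := by
  simp only [Tm.Holds, Tm.le, Tm.not, Tm.eval]
  omega

@[simp] theorem Tm.holds_eq : (Tm.eq s t).Holds A ρ ↔ s.eval A ρ = t.eval A ρ := by
  simp only [Tm.eq, Tm.holds_and, Tm.holds_le]
  omega

@[simp] theorem Tm.holds_get (a : ℕ) : (Tm.get a s t).Holds A ρ ↔ A a (s.eval A ρ) (t.eval A ρ) ≠ 0 :=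
  Iff.rfl

@[simp] theorem Tm.holds_sum (x : ℕ) : (Tm.sum x t).Holds A ρ ↔
    ∃ w : Fin (ρ 0), t.Holds A (Function.update ρ (x + 2) w) := by
  simp only [Tm.Holds, Tm.eval, ne_eq, Finset.sum_eq_zero_iff, Finset.mem_range, not_forall,
    Fin.exists_iff]

@[simp] theorem Tm.holds_all (x : ℕ) : (Tm.all x t).Holds A ρ ↔
    ∀ w : Fin (ρ 0), t.Holds A (Function.update ρ (x + 2) w) := by
  simp [Tm.all]

@[simp] theorem Tm.eval_lit (k : ℕ) : (Tm.lit k).eval A ρ = k := rfl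

@[simp] theorem Tm.eval_var (x : ℕ) : (Tm.var x).eval A ρ = ρ x := rfl

@[simp] theorem Tm.eval_get (a : ℕ) : (Tm.get a s t).eval A ρ = A a (s.eval A ρ) (t.eval A ρ) := rfl

@[simp] theorem Tm.eval_add : (Tm.add s t).eval A ρ = s.eval A ρ + t.eval A ρ := rfl

@[simp] theorem Tm.eval_sub : (Tm.sub s t).eval A ρ = s.eval A ρ - t.eval A ρ := rfl

open Classical in
@[simp] theorem Tm.eval_ite : (Tm.ite c s t).eval A ρ =
    if c.Holds A ρ then s.eval A ρ else t.eval A ρ := by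
  simp only [Tm.eval, Tm.Holds]
  congr

@[simp] theorem Tm.eval_sum (x : ℕ) : (Tm.sum x t).eval A ρ =
    ∑ w : Fin (ρ 0), t.eval A (Function.update ρ (x + 2) w) :=
  Finset.sum_range _

open Classical in
theorem Tm.eval_not : (Tm.not t).eval A ρ = if t.Holds A ρ then 0 else 1 := by
  by_cases h : t.eval A ρ = 0
  · simp [Tm.not, Tm.Holds, h]
  · rw [if_pos (show t.Holds A ρ from h)]
    simp only [Tm.not, Tm.eval]
    omega

/-- The term `Tm.least` finds the least value, if there is one. -/
theorem Tm.eval_least {x y : ℕ} (hxy : x ≠ y) (f : Tm → Tm) {P : ℕ → Prop}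
    (hf : ∀ i j, (f (.var (y + 2))).Holds A (Function.update (Function.update ρ (x + 2) i) (y + 2) j)
      ↔ P j) :
    (∀ w < (Tm.least x y f).eval A ρ, ¬ P w) ∧
      ((∃ w < ρ 0, P w) → P ((Tm.least x y f).eval A ρ)) ∧
      ((Tm.least x y f).eval A ρ < ρ 0 ↔ ∃ w < ρ 0, P w) := by
  classical
  -- The least solution is the number of `i` with no solution up to `i`; if there is no solution at
  -- all, this number is the bound `ρ 0`.
  have he : (Tm.least x y f).eval A ρ =
      ((Finset.range (ρ 0)).filter fun i => ¬ ∃ j < ρ 0, j ≤ i ∧ P j).card := by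
    rw [Tm.least, Tm.eval, Finset.card_filter]
    refine Finset.sum_congr rfl fun i _ => ?_
    rw [Tm.eval_not]
    have : (Tm.sum y (Tm.and (Tm.le (.var (y + 2)) (.var (x + 2))) (f (.var (y + 2))))).Holds A
        (Function.update ρ (x + 2) i) ↔ ∃ j < ρ 0, j ≤ i ∧ P j := by
      simp [Fin.exists_iff, hf, hxy, and_left_comm]
    simp only [this]
    split_ifs <;> rfl
  rw [he]
  by_cases hex : ∃ w < ρ 0, P w
  · obtain ⟨hm, hP⟩ := Nat.find_spec hex
    have hmin := fun w h => Nat.find_min hex (m := w) h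
    set m := Nat.find hex
    have : ((Finset.range (ρ 0)).filter fun i => ¬ ∃ j < ρ 0, j ≤ i ∧ P j) = Finset.range m := by
      ext i
      simp only [Finset.mem_filter, Finset.mem_range]
      constructor
      · rintro ⟨hi, hn⟩
        by_contra hcon
        exact hn ⟨m, hm, by omega, hP⟩
      · intro hi
        refine ⟨by omega, ?_⟩
        rintro ⟨j, hj, hji, hPj⟩
        exact hmin j (by omega) ⟨hj, hPj⟩
    rw [this, Finset.card_range]
    exact ⟨fun w hw hPw => hmin w hw ⟨by omega, hPw⟩, fun _ => hP, by simp only [hm, hex]⟩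
  · have : ((Finset.range (ρ 0)).filter fun i => ¬ ∃ j < ρ 0, j ≤ i ∧ P j) = Finset.range (ρ 0) := by
      refine Finset.filter_true_of_mem fun i _ => ?_
      rintro ⟨j, hj, -, hPj⟩
      exact hex ⟨j, hj, hPj⟩
    rw [this, Finset.card_range]
    exact ⟨fun w hw hPw => hex ⟨w, hw, hPw⟩, fun h => absurd h hex, by simp only [hex]; simp⟩

end

@[simp] theorem indexEnv_zero (n k i j : ℕ) : indexEnv n k i j 0 = n := rfl

@[simp] theorem indexEnv_one (n k i j : ℕ) : indexEnv n k i j 1 = k := rfl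

@[simp] theorem indexEnv_two (n k i j : ℕ) : indexEnv n k i j 2 = i := rfl

@[simp] theorem indexEnv_three (n k i j : ℕ) : indexEnv n k i j 3 = j := rfl

/-! ### Effects of commands -/

section

variable {n k : ℕ} (A : ℕ → ℕ → ℕ → ℕ)

@[simp] theorem Cmd.exec_seq (c d : Cmd) : (Cmd.seq c d).exec n k A = d.exec n k (c.exec n k A) := rfl

@[simp] theorem Cmd.exec_define_self (a : ℕ) (t : Tm) (u v : Fin n) :
    (Cmd.define a t).exec n k A a u v = t.eval A (indexEnv n k u v) := by
  simp [Cmd.exec]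

theorem Cmd.exec_define_of_ne {a b : ℕ} (t : Tm) (h : b ≠ a) :
    (Cmd.define a t).exec n k A b = A b := by
  simp [Cmd.exec, h]

/-- The arrays that a command may change. -/
def Cmd.writes : Cmd → List ℕ
  | .define a _ => [a]
  | .seq c d => c.writes ++ d.writes
  | .loop c => c.writes

theorem Cmd.exec_of_notMem (c : Cmd) {b : ℕ} (h : b ∉ c.writes) : c.exec n k A b = A b := by
  induction c generalizing A with
  | define a t => exact Cmd.exec_define_of_ne A t (by simpa [Cmd.writes] using h)
  | seq c d hc hd =>
    simp only [Cmd.writes, List.mem_append, not_or] at h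
    rw [Cmd.exec_seq, hd _ h.2, hc _ h.1]
  | loop c hc =>
    have : ∀ i, (c.exec n k)^[i] A b = A b := by
      intro i
      induction i with
      | zero => rfl
      | succ i ih => rw [Function.iterate_succ_apply', hc _ h, ih]
    exact this n

theorem Cmd.exec_loop_induction (c : Cmd) (I : ℕ → (ℕ → ℕ → ℕ → ℕ) → Prop) (h0 : I 0 A)
    (hs : ∀ i A, I i A → I (i + 1) (c.exec n k A)) : I n ((Cmd.loop c).exec n k A) := by
  have : ∀ i, I i ((c.exec n k)^[i] A) := by
    intro i
    induction i with
    | zero => exact h0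
    | succ i ih =>
      rw [Function.iterate_succ_apply']
      exact hs i _ ih
  exact this n

end

/-! ### Distances and reachability -/

/-- Set array `14` to the distances, cut off at the number of vertices, in the graph with the
adjacency matrix in array `h`; the array `13` is used. -/
def distCmd (h : ℕ) : Cmd :=
  .seq (.define 13 (.eq (.var 2) (.var 3))) <|
  .seq (.define 14 (.lit 0)) <|
  .loop <|
    .seq (.define 14 (.add (.get 14 (.var 2) (.var 3)) (.not (.get 13 (.var 2) (.var 3)))))
      (.define 13 (.or (.get 13 (.var 2) (.var 3))
        (.sum 2 (.and (.get h (.var 2) (.var 4)) (.get 13 (.var 4) (.var 3))))))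

/-- Pass `i` first adds 1 to the cells of array 14 whose pair has no walk of at most `i` edges, as
recorded in array 13, and then advances array 13 to `i + 1`. -/
theorem distCmd_spec {n k h : ℕ} (h13 : h ≠ 13) (h14 : h ≠ 14) {A : ℕ → ℕ → ℕ → ℕ}
    {H : Digraph (Fin n)} (hA : ∀ u v : Fin n, A h u v ≠ 0 ↔ H.Adj u v) (u v : Fin n) :
    (distCmd h).exec n k A 14 u v = cutDist H n u v := by
  classical
  have := Cmd.exec_loop_induction (n := n) (k := k) ((Cmd.define 14 (.lit 0)).exec n k
    ((Cmd.define 13 (.eq (.var 2) (.var 3))).exec n k A))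
    (.seq (.define 14 (.add (.get 14 (.var 2) (.var 3)) (.not (.get 13 (.var 2) (.var 3)))))
      (.define 13 (.or (.get 13 (.var 2) (.var 3))
        (.sum 2 (.and (.get h (.var 2) (.var 4)) (.get 13 (.var 4) (.var 3)))))))
    (fun i A => (∀ u v : Fin n, A h u v ≠ 0 ↔ H.Adj u v) ∧
      (∀ u v : Fin n, A 13 u v ≠ 0 ↔ Within H i u v) ∧
      ∀ u v : Fin n, A 14 u v = cutDist H i u v)
    ⟨fun u v => by
      rw [Cmd.exec_define_of_ne _ _ h14, Cmd.exec_define_of_ne _ _ h13, hA], fun u v => by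
      rw [Cmd.exec_define_of_ne _ _ (by omega), Cmd.exec_define_self]
      change (Tm.eq _ _).Holds _ _ ↔ _
      simp [within_zero, Fin.ext_iff], fun u v => by simp [cutDist]⟩
    (by
      rintro i A ⟨h1, h2, h3⟩
      refine ⟨fun u v => ?_, fun u v => ?_, fun u v => ?_⟩
      · rw [Cmd.exec_seq, Cmd.exec_define_of_ne _ _ h13, Cmd.exec_define_of_ne _ _ h14, h1]
      · rw [Cmd.exec_seq, Cmd.exec_define_self]
        change (Tm.or _ _).Holds _ _ ↔ _
        simp [Cmd.exec_define_of_ne _ _ h14, Cmd.exec_define_of_ne _ _ (show 13 ≠ 14 by omega),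
          within_succ, Function.update_apply, -ne_eq, h1, h2]
      · rw [Cmd.exec_seq, Cmd.exec_define_of_ne _ _ (by omega), Cmd.exec_define_self]
        simp only [Tm.eval_add, Tm.eval_not, Tm.eval_get, Tm.eval_var, indexEnv_two,
          indexEnv_three, Tm.holds_get, h2, h3, cutDist, Finset.range_add_one, Finset.filter_insert]
        split_ifs with hw
        · rfl
        · rw [Finset.card_insert_of_notMem (by simp)])
  exact this.2.2 u v

/-- The vertex `t` is the least one of its strong component, if array `1` holds the transitive
closure. -/
def repTm (t : Tm) : Tm :=
  .all 2 (.not (.and (.lt (.var 4) t) (.and (.get 1 t (.var 4)) (.get 1 (.var 4) t))))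

/-- From the graph in array `0`, compute its transitive closure (array `1`) and strict reachability
between representatives (array `2`). -/
def reachCmd : Cmd :=
  .seq (distCmd 0) <|
  .seq (.define 1 (.sum 2 (.and (.get 0 (.var 2) (.var 4)) (.lt (.get 14 (.var 4) (.var 3)) (.var 0)))))
    (.define 2 (.and (repTm (.var 2)) (.and (repTm (.var 3))
      (.and (.get 1 (.var 2) (.var 3)) (.not (.get 1 (.var 3) (.var 2)))))))

section

variable {n k : ℕ} {A : ℕ → ℕ → ℕ → ℕ} {G : Digraph (Fin n)}

theorem holds_repTm (hA : ∀ u v : Fin n, A 1 u v ≠ 0 ↔ Relation.TransGen G.Adj u v) (u v : Fin n) :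
    ((repTm (.var 2)).Holds A (indexEnv n k u v) ↔ IsRep G u) ∧
      ((repTm (.var 3)).Holds A (indexEnv n k u v) ↔ IsRep G v) := by
  constructor <;>
  · simp only [repTm, Tm.holds_all, Tm.holds_not, Tm.holds_and, Tm.holds_lt, Tm.holds_get,
      Tm.eval_var, Function.update_apply, IsRep, not_and]
    simp [-ne_eq, hA]

/-- Reachability by at least one edge is an edge followed by a possibly empty walk, and a walk
exists exactly if the cut-off distance is below `n`. -/
theorem reachCmd_spec (hA : ∀ u v : Fin n, A 0 u v ≠ 0 ↔ G.Adj u v) :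
    (∀ u v : Fin n, reachCmd.exec n k A 1 u v ≠ 0 ↔ Relation.TransGen G.Adj u v) ∧
      ∀ u v : Fin n, reachCmd.exec n k A 2 u v ≠ 0 ↔ repLt G u v := by
  have h0 : ∀ u v : Fin n, (distCmd 0).exec n k A 0 u v ≠ 0 ↔ G.Adj u v := by
    rw [Cmd.exec_of_notMem A _ (by decide)]
    exact hA
  have h1 : ∀ u v : Fin n, (distCmd 0).exec n k A 14 u v = cutDist G n u v :=
    distCmd_spec (by omega) (by omega) hA
  have h2 : ∀ u v : Fin n, (Cmd.define 1 (.sum 2 (.and (.get 0 (.var 2) (.var 4))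
      (.lt (.get 14 (.var 4) (.var 3)) (.var 0))))).exec n k ((distCmd 0).exec n k A) 1 u v ≠ 0 ↔
      Relation.TransGen G.Adj u v := by
    intro u v
    rw [Cmd.exec_define_self, transGen_iff_hasWalk]
    change (Tm.sum _ _).Holds _ _ ↔ _
    simp only [Tm.holds_sum, Tm.holds_and, Tm.holds_get, Tm.holds_lt, Tm.eval_var, Tm.eval_get,
      Function.update_apply]
    simp [-ne_eq, h0, h1, cutDist_lt_iff]
  refine ⟨fun u v => ?_, fun u v => ?_⟩
  · rw [reachCmd, Cmd.exec_seq, Cmd.exec_seq, Cmd.exec_define_of_ne _ _ (by omega), h2]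
  · rw [reachCmd, Cmd.exec_seq, Cmd.exec_seq, Cmd.exec_define_self]
    change (Tm.and _ _).Holds _ _ ↔ _
    rw [Tm.holds_and, Tm.holds_and, (holds_repTm h2 u v).1, (holds_repTm h2 u v).2, Tm.holds_and,
      Tm.holds_not, Tm.holds_get, Tm.holds_get]
    simp only [Tm.eval_var, indexEnv_two, indexEnv_three, h2, repLt]

end

/-! ### Parameters -/

/-- The value of an array all of whose cells agree. -/
def Tm.const (a : ℕ) : Tm := .get a (.var 2) (.var 3)

/-- Set array `4` to the number `L` of binary digits of the number `n` of vertices, and array `5` to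
the minimum of `n` and `(k - 2) / (2 * L + 4)`. The arrays `3` and `6` are used. -/
def paramCmd : Cmd :=
  .seq (.define 3 (.lit 1)) <| .seq (.define 4 (.lit 0)) <|
  .seq (.loop <|
    .seq (.define 4 (.ite (.le (.const 3) (.var 0)) (.add (.const 4) (.lit 1)) (.const 4)))
      (.define 3 (.add (.const 3) (.const 3)))) <|
  .seq (.define 5 (.lit 0)) <| .seq (.define 6 (.lit 0)) <|
  .loop <|
    .seq (.define 5 (.ite (.le (.add (.const 6) (.add (.add (.const 4) (.const 4)) (.lit 4)))
        (.sub (.var 1) (.lit 2))) (.add (.const 5) (.lit 1)) (.const 5)))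
      (.define 6 (.ite (.le (.add (.const 6) (.add (.add (.const 4) (.const 4)) (.lit 4)))
        (.sub (.var 1) (.lit 2))) (.add (.const 6) (.add (.add (.const 4) (.const 4)) (.lit 4)))
          (.const 6)))

/-- The length of the chains. -/
def chainLength (n k : ℕ) : ℕ := min n ((k - 2) / (2 * (Nat.log 2 n + 1) + 4))

/-- Without multiplication or division, the logarithm comes from doubling and the quotient from
repeated addition. For the logarithm `n` passes suffice; for the quotient they produce the minimum
with `n`. -/
theorem paramCmd_spec {n k : ℕ} {A : ℕ → ℕ → ℕ → ℕ} (u v : Fin n) :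
    paramCmd.exec n k A 5 u v = chainLength n k := by
  have hn : n ≠ 0 := u.pos.ne'
  simp only [paramCmd, Cmd.exec_seq]
  set A1 := Cmd.exec n k (.define 4 (.lit 0)) (Cmd.exec n k (.define 3 (.lit 1)) A) with hA1
  have h1 := Cmd.exec_loop_induction (n := n) (k := k) A1
    (.seq (.define 4 (.ite (.le (.const 3) (.var 0)) (.add (.const 4) (.lit 1)) (.const 4)))
      (.define 3 (.add (.const 3) (.const 3))))
    (fun i A => (∀ u v : Fin n, A 3 u v = 2 ^ i) ∧
      ∀ u v : Fin n, A 4 u v = min i (Nat.log 2 n + 1))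
    ⟨fun u v => by
      rw [hA1, Cmd.exec_define_of_ne _ _ (by omega), Cmd.exec_define_self]
      rfl, fun u v => by
      rw [hA1, Cmd.exec_define_self]
      simp⟩
    (by
      rintro i A ⟨h3, h4⟩
      refine ⟨fun u v => ?_, fun u v => ?_⟩
      · rw [Cmd.exec_seq, Cmd.exec_define_self]
        simp only [Tm.const, Tm.eval_add, Tm.eval_get, Tm.eval_var, indexEnv_two, indexEnv_three]
        rw [Cmd.exec_define_of_ne _ _ (by omega), h3, pow_succ]
        ring
      · rw [Cmd.exec_seq, Cmd.exec_define_of_ne _ _ (by omega), Cmd.exec_define_self]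
        simp only [Tm.const, Tm.eval_ite, Tm.eval_add, Tm.eval_get, Tm.eval_var, indexEnv_two,
          indexEnv_three, Tm.holds_le, indexEnv_zero, h3, h4, Tm.eval_lit]
        have := Nat.le_log_iff_pow_le (b := 2) (x := i) (by omega) hn
        split_ifs with h
        · have := this.2 h
          omega
        · have := mt this.1 h
          omega)
  have hlog : Nat.log 2 n + 1 ≤ n := Nat.log_lt_self 2 hn
  set A2 := Cmd.exec n k (.loop _) A1
  set A3 := Cmd.exec n k (.define 6 (.lit 0)) (Cmd.exec n k (.define 5 (.lit 0)) A2) with hA3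
  have h2 := Cmd.exec_loop_induction (n := n) (k := k) A3
    (.seq (.define 5 (.ite (.le (.add (.const 6) (.add (.add (.const 4) (.const 4)) (.lit 4)))
        (.sub (.var 1) (.lit 2))) (.add (.const 5) (.lit 1)) (.const 5)))
      (.define 6 (.ite (.le (.add (.const 6) (.add (.add (.const 4) (.const 4)) (.lit 4)))
        (.sub (.var 1) (.lit 2))) (.add (.const 6) (.add (.add (.const 4) (.const 4)) (.lit 4)))
          (.const 6))))
    (fun i A => (∀ u v : Fin n, A 4 u v = Nat.log 2 n + 1) ∧
      (∀ u v : Fin n, A 5 u v = min i ((k - 2) / (2 * (Nat.log 2 n + 1) + 4))) ∧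
      ∀ u v : Fin n, A 6 u v = min i ((k - 2) / (2 * (Nat.log 2 n + 1) + 4)) *
        (2 * (Nat.log 2 n + 1) + 4))
    ⟨fun u v => by
      rw [hA3, Cmd.exec_define_of_ne _ _ (by omega), Cmd.exec_define_of_ne _ _ (by omega), h1.2]
      omega, fun u v => by
      rw [hA3, Cmd.exec_define_of_ne _ _ (by omega), Cmd.exec_define_self]
      simp, fun u v => by
      rw [hA3, Cmd.exec_define_self]
      simp⟩
    (by
      rintro i A ⟨h4, h5, h6⟩
      set w := 2 * (Nat.log 2 n + 1) + 4 with hw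
      have hcond : min i ((k - 2) / w) * w + (Nat.log 2 n + 1 + (Nat.log 2 n + 1) + 4) ≤ k - 2 ↔
          i < (k - 2) / w := by
        rw [show min i ((k - 2) / w) * w + (Nat.log 2 n + 1 + (Nat.log 2 n + 1) + 4) =
          (min i ((k - 2) / w) + 1) * w by rw [hw]; ring, ← Nat.le_div_iff_mul_le (by omega)]
        omega
      refine ⟨fun u v => ?_, fun u v => ?_, fun u v => ?_⟩
      · rw [Cmd.exec_seq, Cmd.exec_define_of_ne _ _ (by omega), Cmd.exec_define_of_ne _ _ (by omega),
          h4]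
      · rw [Cmd.exec_seq, Cmd.exec_define_of_ne _ _ (by omega), Cmd.exec_define_self]
        simp only [Tm.const, Tm.eval_ite, Tm.eval_add, Tm.eval_sub, Tm.eval_get, Tm.eval_var,
          indexEnv_two, indexEnv_three, Tm.holds_le, indexEnv_one, h4, h5, h6, Tm.eval_lit, hcond]
        split_ifs with h <;> omega
      · rw [Cmd.exec_seq, Cmd.exec_define_self]
        simp only [Tm.const, Tm.eval_ite, Tm.eval_add, Tm.eval_sub, Tm.eval_get, Tm.eval_var,
          indexEnv_two, indexEnv_three, Tm.holds_le, indexEnv_one, Tm.eval_lit,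
          Cmd.exec_define_of_ne _ _ (show 4 ≠ 5 by omega),
          Cmd.exec_define_of_ne _ _ (show 6 ≠ 5 by omega), h4, h6, hcond]
        split_ifs with h
        · rw [min_eq_left h.le, min_eq_left (show i + 1 ≤ _ by omega), hw]
          ring
        · rw [min_eq_right (by omega), min_eq_right (by omega)])
  exact h2.2.1 u v

/-! ### Chains -/

/-- A vertex below the vertex in variable `2` that ends a chain of the current length. -/
def predTm (x : Tm) : Tm := .and (.eq (.get 10 x x) (.const 11)) (.get 2 x (.var 2))

/-- Lengthen the chains in the rows of array `10` by one element. -/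
def rowTm : Tm :=
  .ite (.lt (.const 11) (.const 5))
    (.ite (.and (.not (.get 7 (.var 2) (.var 2))) (.sum 2 (predTm (.var 4))))
      (.ite (.eq (.var 2) (.var 3)) (.add (.const 11) (.lit 1))
        (.get 10 (.least 2 3 predTm) (.var 3)))
      (.lit 0))
    (.get 10 (.var 2) (.var 3))

/-- Compute in the rows of array `10` chains of as many elements as array `5` says in the order in
array `2`, on the elements that are zero in array `7`. Array `11` is used. -/
def rowCmd : Cmd :=
  .seq (.define 10 (.ite (.and (.eq (.var 2) (.var 3)) (.not (.get 7 (.var 2) (.var 2))))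
    (.lit 1) (.lit 0))) <|
  .seq (.define 11 (.lit 1)) <|
  .loop <|
    .seq (.define 10 rowTm)
    (.define 11 (.ite (.lt (.const 11) (.const 5)) (.add (.const 11) (.lit 1)) (.const 11)))

/-- Array 11 holds the current chain length. The loop makes `n` passes, but rows grow only until
this length is `D`, whence the `min i (D - 1)` in the invariant. -/
theorem rowCmd_spec {n k D : ℕ} {A : ℕ → ℕ → ℕ → ℕ} {lt : Fin n → Fin n → Prop}
    [IsStrictOrder (Fin n) lt] {id : Fin n → ℕ} (hlt : ∀ u v : Fin n, A 2 u v ≠ 0 ↔ lt u v)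
    (hD : ∀ u v : Fin n, A 5 u v = D) (hid : ∀ u v : Fin n, A 7 u v = id u) (h1 : 1 ≤ D)
    (hn : D ≤ n) :
    AreRows (fun v => id v = 0) lt (D - 1) fun v w : Fin n => rowCmd.exec n k A 10 v w := by
  classical
  simp only [rowCmd, Cmd.exec_seq]
  set A1 := Cmd.exec n k (.define 10 (.ite (.and (.eq (.var 2) (.var 3))
    (.not (.get 7 (.var 2) (.var 2)))) (.lit 1) (.lit 0))) A with hA1
  have h := Cmd.exec_loop_induction (n := n) (k := k) ((Cmd.define 11 (.lit 1)).exec n k A1)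
    (.seq (.define 10 rowTm)
    (.define 11 (.ite (.lt (.const 11) (.const 5)) (.add (.const 11) (.lit 1)) (.const 11))))
    (fun i A => ((∀ u v : Fin n, A 2 u v ≠ 0 ↔ lt u v) ∧ (∀ u v : Fin n, A 5 u v = D) ∧
      (∀ u v : Fin n, A 7 u v = id u)) ∧ (∀ u v : Fin n, A 11 u v = min i (D - 1) + 1) ∧
      AreRows (fun v => id v = 0) lt (min i (D - 1)) fun v w : Fin n => A 10 v w)
    ⟨by
      simp only [hA1, Cmd.exec_define_of_ne _ _ (show 2 ≠ 11 by omega),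
        Cmd.exec_define_of_ne _ _ (show 2 ≠ 10 by omega),
        Cmd.exec_define_of_ne _ _ (show 5 ≠ 11 by omega),
        Cmd.exec_define_of_ne _ _ (show 5 ≠ 10 by omega),
        Cmd.exec_define_of_ne _ _ (show 7 ≠ 11 by omega),
        Cmd.exec_define_of_ne _ _ (show 7 ≠ 10 by omega)]
      exact ⟨hlt, hD, hid⟩, fun u v => by simp, by
      have hv : ∀ v w : Fin n, (Cmd.define 11 (.lit 1)).exec n k A1 10 v w =
          if v = w ∧ id v = 0 then 1 else 0 := by
        intro v w
        rw [Cmd.exec_define_of_ne _ _ (by omega), hA1, Cmd.exec_define_self]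
        simp [hid, Fin.ext_iff]
      rw [Nat.zero_min]
      exact areRows_zero (fun v w h => by rw [hv, if_pos h]) fun v w h => by rw [hv, if_neg h]⟩
    (by
      rintro i A ⟨⟨h2, h5, h7⟩, h11, h10⟩
      refine ⟨?_, fun u v => ?_, ?_⟩
      · simp only [Cmd.exec_seq, Cmd.exec_define_of_ne _ _ (show 2 ≠ 11 by omega),
          Cmd.exec_define_of_ne _ _ (show 2 ≠ 10 by omega),
          Cmd.exec_define_of_ne _ _ (show 5 ≠ 11 by omega),
          Cmd.exec_define_of_ne _ _ (show 5 ≠ 10 by omega),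
          Cmd.exec_define_of_ne _ _ (show 7 ≠ 11 by omega),
          Cmd.exec_define_of_ne _ _ (show 7 ≠ 10 by omega)]
        exact ⟨h2, h5, h7⟩
      · rw [Cmd.exec_seq, Cmd.exec_define_self]
        simp only [Tm.const, Tm.eval_ite, Tm.eval_add, Tm.eval_get, Tm.eval_var, Tm.eval_lit,
          indexEnv_two, indexEnv_three, Tm.holds_lt,
          Cmd.exec_define_of_ne _ _ (show 11 ≠ 10 by omega),
          Cmd.exec_define_of_ne _ _ (show 5 ≠ 10 by omega), h11, h5]
        split_ifs <;> omega
      · simp only [Cmd.exec_seq, Cmd.exec_define_of_ne _ _ (show 10 ≠ 11 by omega),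
          Cmd.exec_define_self]
        by_cases hi : i < D - 1
        · rw [min_eq_left (by omega)] at h10
          rw [min_eq_left (by omega)]
          have hex : ∀ v w : Fin n, (Tm.sum 2 (predTm (.var 4))).Holds A (indexEnv n k v w) ↔
              ∃ x, ChainTo (fun v => id v = 0) lt i x ∧ lt x v := by
            intro v w
            simp only [Tm.holds_sum, predTm, Tm.holds_and, Tm.holds_eq, Tm.const, Tm.holds_get,
              Tm.eval_get, Tm.eval_var, Function.update_apply]
            simp [-ne_eq, h2, h11, min_eq_left hi.le, h10.diag]
          have hval : ∀ v w : Fin n, rowTm.eval A (indexEnv n k v w) =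
              if ChainTo (fun v => id v = 0) lt (i + 1) v then (if v = w then i + 2 else
                A 10 ((Tm.least 2 3 predTm).eval A (indexEnv n k v w)) w) else 0 := by
            intro v w
            simp only [rowTm, Tm.eval_ite, Tm.holds_lt, Tm.holds_and, Tm.holds_not, Tm.holds_get,
              Tm.holds_eq, Tm.const, Tm.eval_get, Tm.eval_var, Tm.eval_lit, Tm.eval_add,
              indexEnv_two, indexEnv_three, hex, h11, h5, h7, ChainTo, min_eq_left hi.le,
              Fin.val_inj, ne_eq, not_not]
            rw [if_pos (by omega)]
            congr
          refine h10.succ (fun v hv => ?_) fun v hv => ?_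
          · refine ⟨?_, ?_⟩
            · rw [hval, if_pos hv, if_pos rfl]
            · have hv2 := hv.2
              obtain ⟨-, hP, hlt⟩ := Tm.eval_least A (indexEnv n k v v) (x := 2) (y := 3) (by omega)
                predTm (P := fun j => A 10 j j = i + 1 ∧ A 2 j v ≠ 0) (fun a b => by
                  simp only [predTm, Tm.holds_and, Tm.holds_eq, Tm.const, Tm.holds_get,
                    Tm.eval_get, Tm.eval_var, Function.update_apply]
                  simp [h11, min_eq_left hi.le])
              have hex' : ∃ w < n, A 10 w w = i + 1 ∧ A 2 w v ≠ 0 := by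
                obtain ⟨x, hx, hxv⟩ := hv2
                exact ⟨x, x.2, (h10.diag x).2 hx, (h2 x v).2 hxv⟩
              have hlt' := hlt.2 hex'
              have hP' := hP hex'
              -- The chosen predecessor must not depend on the column, so that the new row is copied
              -- from a single old row.
              have hsame : ∀ w : Fin n, (Tm.least 2 3 predTm).eval A (indexEnv n k v w) =
                  (Tm.least 2 3 predTm).eval A (indexEnv n k v v) := by
                intro w
                simp only [Tm.least, predTm, Tm.eval_sum, Tm.eval_not, Tm.holds_sum, Tm.holds_and,
                  Tm.holds_eq, Tm.holds_le, Tm.const, Tm.holds_get, Tm.eval_get, Tm.eval_var,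
                  Function.update_apply]
                simp only [Nat.reduceAdd, Nat.reduceEqDiff, if_true, if_false, indexEnv_two,
                  indexEnv_three, h11]
                rfl
              refine ⟨⟨_, hlt'⟩, (h10.diag _).1 hP'.1, (h2 ⟨_, hlt'⟩ v).1 hP'.2, fun w hw => ?_⟩
              rw [hval, if_pos hv, if_neg hw, hsame]
          · rw [hval, if_neg hv]
        · rw [min_eq_right (by omega)] at h10
          rw [min_eq_right (by omega)]
          convert h10 using 3 with v w
          simp only [rowTm, Tm.eval_ite, Tm.holds_lt, Tm.const, Tm.eval_get, Tm.eval_var, indexEnv_two,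
            indexEnv_three, h11, h5]
          rw [if_neg (by omega)])
  have h3 := h.2.2
  rwa [min_eq_right (by omega)] at h3

/-- Extract disjoint chains of as many elements as array `5` says in the order in array `2`: array `7`
gets the numbers of the chains, and array `8` the positions. -/
def chainCmd : Cmd :=
  .seq (.define 7 (.lit 0)) <| .seq (.define 8 (.lit 0)) <| .seq (.define 9 (.lit 0)) <|
  .loop <|
    .seq (.define 9 (.add (.const 9) (.lit 1))) <|
    .seq rowCmd <|
    .seq (.define 17 (.least 2 3 fun x => .eq (.get 10 x x) (.const 5))) <|
    .seq (.define 8 (.add (.get 8 (.var 2) (.var 2))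
      (.ite (.lt (.const 17) (.var 0)) (.get 10 (.const 17) (.var 2)) (.lit 0))))
    (.define 7 (.ite (.and (.lt (.const 17) (.var 0)) (.get 10 (.const 17) (.var 2))) (.const 9)
      (.get 7 (.var 2) (.var 2))))

/-- Each pass numbers the chain ending in the least vertex that ends a chain of `D` unnumbered
elements; array 17 holds this vertex, or `n` if there is none and nothing changes. -/
theorem chainCmd_spec {n k D : ℕ} {A : ℕ → ℕ → ℕ → ℕ} {lt : Fin n → Fin n → Prop}
    [IsStrictOrder (Fin n) lt] (hlt : ∀ u v : Fin n, A 2 u v ≠ 0 ↔ lt u v)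
    (hD : ∀ u v : Fin n, A 5 u v = D) (h1 : 1 ≤ D) (hn : D ≤ n) :
    ∃ id pos : Fin n → ℕ, IsExtraction lt D n id pos ∧
      (∀ u v : Fin n, chainCmd.exec n k A 7 u v = id u) ∧
      ∀ u v : Fin n, chainCmd.exec n k A 8 u v = pos u := by
  classical
  have h := Cmd.exec_loop_induction (n := n) (k := k) ((Cmd.define 9 (.lit 0)).exec n k
    ((Cmd.define 8 (.lit 0)).exec n k ((Cmd.define 7 (.lit 0)).exec n k A)))
    (.seq (.define 9 (.add (.const 9) (.lit 1))) <|
    .seq rowCmd <|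
    .seq (.define 17 (.least 2 3 fun x => .eq (.get 10 x x) (.const 5))) <|
    .seq (.define 8 (.add (.get 8 (.var 2) (.var 2))
      (.ite (.lt (.const 17) (.var 0)) (.get 10 (.const 17) (.var 2)) (.lit 0))))
    (.define 7 (.ite (.and (.lt (.const 17) (.var 0)) (.get 10 (.const 17) (.var 2))) (.const 9)
      (.get 7 (.var 2) (.var 2)))))
    (fun i A => ((∀ u v : Fin n, A 2 u v ≠ 0 ↔ lt u v) ∧ (∀ u v : Fin n, A 5 u v = D) ∧
      (∀ u v : Fin n, A 9 u v = i)) ∧ ∃ id pos : Fin n → ℕ, IsExtraction lt D i id pos ∧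
      (∀ u v : Fin n, A 7 u v = id u) ∧ ∀ u v : Fin n, A 8 u v = pos u)
    ⟨⟨fun u v => by
        rw [Cmd.exec_define_of_ne _ _ (by omega), Cmd.exec_define_of_ne _ _ (by omega),
          Cmd.exec_define_of_ne _ _ (by omega), hlt], fun u v => by
        rw [Cmd.exec_define_of_ne _ _ (by omega), Cmd.exec_define_of_ne _ _ (by omega),
          Cmd.exec_define_of_ne _ _ (by omega), hD], fun u v => by simp⟩,
      fun _ => 0, fun _ => 0, .zero (fun _ => rfl) fun _ => rfl, fun u v => by
        rw [Cmd.exec_define_of_ne _ _ (by omega), Cmd.exec_define_of_ne _ _ (by omega)]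
        simp, fun u v => by
        rw [Cmd.exec_define_of_ne _ _ (by omega)]
        simp⟩
    (by
      rintro i A ⟨⟨h2, h5, h9⟩, id, pos, he, h7, h8⟩
      simp only [Cmd.exec_seq]
      set A1 := Cmd.exec n k (.define 9 (.add (.const 9) (.lit 1))) A with hA1
      have a2 : ∀ u v : Fin n, A1 2 u v ≠ 0 ↔ lt u v := fun u v => by
        rw [hA1, Cmd.exec_define_of_ne _ _ (by omega), h2]
      have a5 : ∀ u v : Fin n, A1 5 u v = D := fun u v => by
        rw [hA1, Cmd.exec_define_of_ne _ _ (by omega), h5]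
      have a7 : ∀ u v : Fin n, A1 7 u v = id u := fun u v => by
        rw [hA1, Cmd.exec_define_of_ne _ _ (by omega), h7]
      have a8 : ∀ u v : Fin n, A1 8 u v = pos u := fun u v => by
        rw [hA1, Cmd.exec_define_of_ne _ _ (by omega), h8]
      have a9 : ∀ u v : Fin n, A1 9 u v = i + 1 := fun u v => by
        rw [hA1, Cmd.exec_define_self]
        simp [Tm.const, h9]
      have hrow := rowCmd_spec (k := k) a2 a5 a7 h1 hn
      set A2 := rowCmd.exec n k A1 with hA2
      have b : ∀ a, a ≠ 10 → a ≠ 11 → A2 a = A1 a := fun a ha ha' =>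
        Cmd.exec_of_notMem _ _ (by simp [rowCmd, Cmd.writes, ha, ha'])
      set A3 := Cmd.exec n k (.define 17 (.least 2 3 fun x => .eq (.get 10 x x) (.const 5))) A2
        with hA3
      have c : ∀ a, a ≠ 10 → a ≠ 11 → a ≠ 17 → A3 a = A1 a := fun a ha ha' ha'' => by
        rw [hA3, Cmd.exec_define_of_ne _ _ ha'', b a ha ha']
      have c10 : A3 10 = A2 10 := Cmd.exec_define_of_ne _ _ (by omega)
      have c17 : ∀ u v : Fin n, (∀ w < A3 17 u v, ¬ A2 10 w w = D) ∧
          ((∃ w < n, A2 10 w w = D) → A2 10 (A3 17 u v) (A3 17 u v) = D) ∧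
          (A3 17 u v < n ↔ ∃ w < n, A2 10 w w = D) := by
        intro u v
        rw [hA3, Cmd.exec_define_self]
        refine Tm.eval_least A2 (indexEnv n k u v) (by omega)
          (fun x => .eq (.get 10 x x) (.const 5)) (P := fun w => A2 10 w w = D) fun a b' => ?_
        simp only [Tm.holds_eq, Tm.eval_get, Tm.eval_var, Tm.const, Function.update_apply]
        simp [b 5, a5]
      have hdiag : (∃ w < n, A2 10 w w = D) ↔
          ∃ w, ChainTo (fun v => id v = 0) lt (D - 1) w := by
        rw [show (∃ w < n, A2 10 w w = D) ↔ ∃ w : Fin n, A2 10 w w = D by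
          simp [Fin.exists_iff]]
        refine exists_congr fun w => ?_
        rw [← hrow.diag w, Nat.sub_add_cancel h1]
      set A4 := Cmd.exec n k (.define 8 (.add (.get 8 (.var 2) (.var 2))
        (.ite (.lt (.const 17) (.var 0)) (.get 10 (.const 17) (.var 2)) (.lit 0)))) A3 with hA4
      have d8 : ∀ u v : Fin n, A4 8 u v = pos u +
          if A3 17 u v < n then A2 10 (A3 17 u v) u else 0 := by
        intro u v
        rw [hA4, Cmd.exec_define_self]
        simp [Tm.const, c 8, a8, c10]
      have d : ∀ a, a ≠ 8 → A4 a = A3 a := fun a ha => Cmd.exec_define_of_ne _ _ ha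
      refine ⟨⟨fun u v => ?_, fun u v => ?_, fun u v => ?_⟩, ?_⟩
      · rw [Cmd.exec_define_of_ne _ _ (by omega), d 2 (by omega),
          c 2 (by omega) (by omega) (by omega), a2]
      · rw [Cmd.exec_define_of_ne _ _ (by omega), d 5 (by omega),
          c 5 (by omega) (by omega) (by omega), a5]
      · rw [Cmd.exec_define_of_ne _ _ (by omega), d 9 (by omega),
          c 9 (by omega) (by omega) (by omega), a9]
      have e7 : ∀ u v : Fin n, Cmd.exec n k (.define 7 (.ite (.and (.lt (.const 17) (.var 0))
          (.get 10 (.const 17) (.var 2))) (.const 9) (.get 7 (.var 2) (.var 2)))) A4 7 u v =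
          if A3 17 u v < n ∧ A2 10 (A3 17 u v) u ≠ 0 then i + 1 else id u := by
        intro u v
        rw [Cmd.exec_define_self]
        simp [Tm.const, d, c, a7, a9, c10]
      have e8 : ∀ u v : Fin n, Cmd.exec n k (.define 7 (.ite (.and (.lt (.const 17) (.var 0))
          (.get 10 (.const 17) (.var 2))) (.const 9) (.get 7 (.var 2) (.var 2)))) A4 8 u v =
          pos u + if A3 17 u v < n then A2 10 (A3 17 u v) u else 0 := by
        intro u v
        rw [Cmd.exec_define_of_ne _ _ (by omega), d8]
      by_cases hex : ∃ w, ChainTo (fun v => id v = 0) lt (D - 1) w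
      · have hex' := hdiag.2 hex
        have ⟨w₀, _⟩ := hex
        have hz := c17 w₀ w₀
        have hv := hz.2.2.2 hex'
        set z : Fin n := ⟨A3 17 w₀ w₀, hv⟩ with hzdef
        -- Being the least solution of one and the same condition, the entry of array 17 is the same
        -- in all cells.
        have hall : ∀ u v : Fin n, A3 17 u v = z := by
          intro u v
          have h' := c17 u v
          rcases lt_trichotomy (A3 17 u v) z with hl | hl | hl
          · exact absurd (h'.2.1 hex') (hz.1 _ hl)
          · exact hl
          · exact absurd (hz.2.1 hex') (h'.1 _ hl)
        have hzc : ChainTo (fun v => id v = 0) lt (D - 1) z := by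
          rw [← hrow.diag z, Nat.sub_add_cancel h1]
          exact hz.2.1 hex'
        have hr := (hrow z).1 hzc
        refine ⟨fun u => if A2 10 z u ≠ 0 then i + 1 else id u, fun u => pos u + A2 10 z u,
          he.succ_of_row h1 hr (fun w hw => if_pos hw) (fun w hw => if_neg (not_not.2 hw))
            fun w => rfl, fun u v => ?_, fun u v => ?_⟩
        · rw [e7, hall]
          simp
        · rw [e8, hall, if_pos z.2]
      · have hno : ∀ u v : Fin n, ¬ A3 17 u v < n := fun u v h =>
          hex (hdiag.1 ((c17 u v).2.2.1 h))
        refine ⟨id, pos, he.succ_of_none fun v hv => hex ⟨v, hv⟩, fun u v => ?_, fun u v => ?_⟩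
        · rw [e7, if_neg fun h => hno u v h.1]
        · rw [e8, if_neg (hno u v), add_zero])
  obtain ⟨-, id, pos, he, h7, h8⟩ := h
  exact ⟨id, pos, he, h7, h8⟩

/-- Set array `12` to the graph of the cover relation of the order in array `2` with the shortcuts on
the chains in the arrays `7` and `8`. Array `3` is used. -/
def graphCmd : Cmd :=
  .seq (.define 12 (.and (.get 2 (.var 2) (.var 3))
    (.all 2 (.not (.and (.get 2 (.var 2) (.var 4)) (.get 2 (.var 4) (.var 3))))))) <|
  .seq (.define 3 (.lit 1)) <|
  .loop <|
    .seq (.define 12 (.or (.get 12 (.var 2) (.var 3)) (.and (.get 7 (.var 2) (.var 2))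
      (.and (.eq (.get 7 (.var 2) (.var 2)) (.get 7 (.var 3) (.var 3)))
        (.eq (.get 8 (.var 3) (.var 3)) (.add (.get 8 (.var 2) (.var 2)) (.const 3)))))))
      (.define 3 (.add (.const 3) (.const 3)))

theorem graphCmd_spec {n k D : ℕ} {A : ℕ → ℕ → ℕ → ℕ} {lt : Fin n → Fin n → Prop}
    {id pos : Fin n → ℕ} (hlt : ∀ u v : Fin n, A 2 u v ≠ 0 ↔ lt u v)
    (hid : ∀ u v : Fin n, A 7 u v = id u) (hpos : ∀ u v : Fin n, A 8 u v = pos u)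
    (hs : IsChainSystem lt D id pos) (hn : D ≤ n) (u v : Fin n) :
    graphCmd.exec n k A 12 u v ≠ 0 ↔ (coverGraph lt ⊔ chainGraph id pos).Adj u v := by
  have h := Cmd.exec_loop_induction (n := n) (k := k) ((Cmd.define 3 (.lit 1)).exec n k
    ((Cmd.define 12 (.and (.get 2 (.var 2) (.var 3))
    (.all 2 (.not (.and (.get 2 (.var 2) (.var 4)) (.get 2 (.var 4) (.var 3))))))).exec n k A))
    (.seq (.define 12 (.or (.get 12 (.var 2) (.var 3)) (.and (.get 7 (.var 2) (.var 2))
      (.and (.eq (.get 7 (.var 2) (.var 2)) (.get 7 (.var 3) (.var 3)))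
        (.eq (.get 8 (.var 3) (.var 3)) (.add (.get 8 (.var 2) (.var 2)) (.const 3)))))))
      (.define 3 (.add (.const 3) (.const 3))))
    (fun i A => ((∀ u v : Fin n, A 7 u v = id u) ∧ (∀ u v : Fin n, A 8 u v = pos u) ∧
      ∀ u v : Fin n, A 3 u v = 2 ^ i) ∧
      ∀ u v : Fin n, A 12 u v ≠ 0 ↔ (coverGraph lt).Adj u v ∨
        id u ≠ 0 ∧ id u = id v ∧ ∃ l < i, pos v = pos u + 2 ^ l)
    ⟨⟨fun u v => by
        rw [Cmd.exec_define_of_ne _ _ (by omega), Cmd.exec_define_of_ne _ _ (by omega), hid],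
      fun u v => by
        rw [Cmd.exec_define_of_ne _ _ (by omega), Cmd.exec_define_of_ne _ _ (by omega), hpos],
      fun u v => by simp⟩, fun u v => by
        rw [Cmd.exec_define_of_ne _ _ (by omega), Cmd.exec_define_self]
        change (Tm.and _ _).Holds _ _ ↔ _
        simp only [Tm.holds_and, Tm.holds_all, Tm.holds_not, Tm.holds_get, Tm.eval_var,
          Function.update_apply]
        simp [-ne_eq, hlt, coverGraph]⟩
    (by
      rintro i A ⟨⟨h7, h8, h3⟩, h12⟩
      refine ⟨⟨fun u v => ?_, fun u v => ?_, fun u v => ?_⟩, fun u v => ?_⟩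
      · rw [Cmd.exec_seq, Cmd.exec_define_of_ne _ _ (by omega), Cmd.exec_define_of_ne _ _ (by omega),
          h7]
      · rw [Cmd.exec_seq, Cmd.exec_define_of_ne _ _ (by omega), Cmd.exec_define_of_ne _ _ (by omega),
          h8]
      · rw [Cmd.exec_seq, Cmd.exec_define_self]
        simp only [Tm.const, Tm.eval_add, Tm.eval_get, Tm.eval_var, indexEnv_two, indexEnv_three]
        rw [Cmd.exec_define_of_ne _ _ (by omega), h3, pow_succ]
        ring
      · rw [Cmd.exec_seq, Cmd.exec_define_of_ne _ _ (by omega), Cmd.exec_define_self]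
        change (Tm.or _ _).Holds _ _ ↔ _
        simp only [Tm.holds_or, Tm.holds_and, Tm.holds_get, Tm.holds_eq, Tm.eval_var, Tm.const,
          Tm.eval_get, Tm.eval_add, indexEnv_two, indexEnv_three, h12, h7, h8, h3]
        constructor
        · rintro ((h | ⟨h1, h2, l, hl, hp⟩) | ⟨h1, h2, hp⟩)
          · exact .inl h
          · exact .inr ⟨h1, h2, l, by omega, hp⟩
          · exact .inr ⟨h1, h2, i, by omega, hp⟩
        · rintro (h | ⟨h1, h2, l, hl, hp⟩)
          · exact .inl (.inl h)
          · rcases Nat.lt_succ_iff_lt_or_eq.1 hl with hl | rfl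
            · exact .inl (.inr ⟨h1, h2, l, hl, hp⟩)
            · exact .inr ⟨h1, h2, hp⟩)
  rw [graphCmd, Cmd.exec_seq, Cmd.exec_seq, h.2 u v]
  refine or_congr Iff.rfl ⟨fun ⟨h1, h2, l, _, h3⟩ => ⟨h1, h2, l, h3⟩, fun ⟨h1, h2, l, h3⟩ =>
    ⟨h1, h2, l, ?_, h3⟩⟩
  -- Pass `l` adds the shortcuts of length `2 ^ l`. Since `l < 2 ^ l` and positions are at most `D ≤
  -- n`, the `n` passes miss none.
  have h4 := (hs.range v (h2 ▸ h1)).2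
  have h5 : l < 2 ^ l := Nat.lt_two_pow_self
  omega

/-! ### The greedy shortcuts -/

theorem update_add_two_zero (ρ : ℕ → ℕ) (x c : ℕ) : Function.update ρ (x + 2) c 0 = ρ 0 := rfl

/-- The number of bad pairs that the edge between the vertices in the variables `2` and `3` fixes. -/
def scoreTm : Tm :=
  .ite (.get 2 (.var 2) (.var 3)) (.sum 2 (.sum 3 (.ite
    (.and (.and (.get 2 (.var 4) (.var 5)) (.lt (.sub (.var 1) (.lit 2)) (.get 14 (.var 4) (.var 5))))
      (.le (.add (.add (.get 14 (.var 4) (.var 2)) (.lit 1)) (.get 14 (.var 3) (.var 5)))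
        (.sub (.var 1) (.lit 2)))) (.lit 1) (.lit 0)))) (.lit 0)

/-- The edge between the vertices in the variables `2` and `3` is the first one with the largest
score, and this score is positive. -/
def bestTm : Tm :=
  .and (.get 15 (.var 2) (.var 3)) (.all 2 (.all 3 (.or
    (.lt (.get 15 (.var 4) (.var 5)) (.get 15 (.var 2) (.var 3)))
    (.and (.eq (.get 15 (.var 4) (.var 5)) (.get 15 (.var 2) (.var 3)))
      (.or (.lt (.var 2) (.var 4)) (.and (.eq (.var 2) (.var 4)) (.le (.var 3) (.var 5))))))))

/-- Add one greedy shortcut to the graph in array `12`. -/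
def stepCmd : Cmd :=
  .seq (distCmd 12) <| .seq (.define 15 scoreTm)
    (.define 12 (.or (.get 12 (.var 2) (.var 3)) bestTm))

/-- Ties are broken lexicographically, so the condition tested in `bestTm` singles out exactly one
edge per step. -/
theorem exists_first_max {n : ℕ} (f : Fin n → Fin n → ℕ) (h : ∃ x y, f x y ≠ 0) :
    ∃ x y, f x y ≠ 0 ∧ (∀ x' y', f x' y' ≤ f x y) ∧
      ∀ u v, (f u v ≠ 0 ∧ ∀ x' y', f x' y' < f u v ∨ f x' y' = f u v ∧
        (u < x' ∨ u = x' ∧ v ≤ y')) ↔ u = x ∧ v = y := by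
  obtain ⟨x₀, y₀, h0⟩ := h
  obtain ⟨p, -, hp⟩ := Finset.exists_max_image (Finset.univ : Finset (Fin n × Fin n))
    (fun p => f p.1 p.2) ⟨(x₀, y₀), Finset.mem_univ _⟩
  obtain ⟨q, hq, hmin⟩ := Finset.exists_min_image
    (Finset.univ.filter fun q : Fin n × Fin n => f q.1 q.2 = f p.1 p.2) (fun q => toLex q)
    ⟨p, by simp⟩
  simp only [Finset.mem_filter, Finset.mem_univ, true_and, forall_const] at hq hmin hp
  have hmax : ∀ x' y', f x' y' ≤ f q.1 q.2 := fun x' y' => hq ▸ hp (x', y')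
  have hlex : ∀ x' y', f x' y' = f q.1 q.2 → q.1 < x' ∨ q.1 = x' ∧ q.2 ≤ y' := fun x' y' h =>
    Prod.Lex.toLex_le_toLex.1 (hmin (x', y') (h.trans hq))
  refine ⟨q.1, q.2, fun h => h0 (by have := hmax x₀ y₀; omega), hmax, fun u v => ⟨?_, ?_⟩⟩
  · rintro ⟨-, hb⟩
    have h1 := hmax u v
    rcases hb q.1 q.2 with hl | ⟨he, hl⟩
    · omega
    · have h2 := hlex u v he.symm
      simp only [Fin.lt_def, Fin.le_def, Fin.ext_iff] at hl h2 ⊢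
      omega
  · rintro ⟨rfl, rfl⟩
    refine ⟨fun h => h0 (by have := hmax x₀ y₀; omega), fun x' y' => ?_⟩
    rcases Nat.lt_or_ge (f x' y') (f q.1 q.2) with hl | hl
    · exact .inl hl
    · have := le_antisymm (hmax x' y') hl
      exact .inr ⟨this, hlex x' y' this⟩

/-- The edge from `u` to `v` itself repairs the pair, provided that one edge is within the budget.
-/
theorem score_pos_of_isBad {V : Type*} [Finite V] {lt : V → V → Prop} {H : Digraph V} {K : ℕ}
    (hK : 1 ≤ K) {u v : V} (h : IsBad lt H K u v) : 0 < score lt H K u v := by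
  refine (Set.ncard_pos (Set.toFinite _)).2 ⟨(u, v), h, 0, 0, by omega, .refl _ _ _, .refl _ _ _⟩

theorem stepCmd_spec {n k : ℕ} {A : ℕ → ℕ → ℕ → ℕ} {lt : Fin n → Fin n → Prop}
    {H : Digraph (Fin n)} (hk : 3 ≤ k) (hlt : ∀ u v : Fin n, A 2 u v ≠ 0 ↔ lt u v)
    (hH : ∀ u v : Fin n, A 12 u v ≠ 0 ↔ H.Adj u v)
    (hr : ∀ u v, lt u v → ∃ m, HasWalk H m u v) :
    ∃ H' : Digraph (Fin n), IsGreedyStep lt (k - 2) H H' ∧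
      ∀ u v : Fin n, stepCmd.exec n k A 12 u v ≠ 0 ↔ H'.Adj u v := by
  classical
  simp only [stepCmd, Cmd.exec_seq]
  set A1 := (distCmd 12).exec n k A with hA1
  have a : ∀ a, a ≠ 13 → a ≠ 14 → A1 a = A a := fun a h13 h14 =>
    Cmd.exec_of_notMem _ _ (by simp [distCmd, Cmd.writes, h13, h14])
  have a14 : ∀ u v : Fin n, A1 14 u v = cutDist H n u v := distCmd_spec (by omega) (by omega) hH
  set A2 := Cmd.exec n k (.define 15 scoreTm) A1 with hA2
  have b15 : ∀ u v : Fin n, A2 15 u v = if lt u v then score lt H (k - 2) u v else 0 := by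
    intro x y
    have hsc : score lt H (k - 2) x y = ∑ u : Fin n, ∑ v : Fin n,
        if Fixes lt H (k - 2) x y u v then 1 else 0 := by
      rw [← Fintype.sum_prod_type' (f := fun u v => if Fixes lt H (k - 2) x y u v then 1 else 0),
        ← Finset.card_filter, score, ← Set.ncard_coe_finset]
      simp
    rw [hA2, Cmd.exec_define_self, hsc]
    simp only [fixes_iff_cutDist hr, scoreTm, Tm.eval_ite, Tm.holds_get, Tm.eval_sum, Tm.holds_and,
      Tm.holds_lt, Tm.holds_le, Tm.eval_sub, Tm.eval_add, Tm.eval_get, Tm.eval_var, Tm.eval_lit,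
      update_add_two_zero, indexEnv_zero, Function.update_apply]
    have h2 : ∀ u v : Fin n, A1 2 u v ≠ 0 ↔ lt u v := fun u v => by
      rw [a 2 (by omega) (by omega), hlt]
    simp [-ne_eq, -ite_not, h2, a14]
    congr
  have hA3 : ∀ u v : Fin n, Cmd.exec n k (.define 12 (.or (.get 12 (.var 2) (.var 3)) bestTm)) A2
      12 u v ≠ 0 ↔ H.Adj u v ∨ A2 15 u v ≠ 0 ∧ ∀ x y : Fin n, A2 15 x y < A2 15 u v ∨
        A2 15 x y = A2 15 u v ∧ (u < x ∨ u = x ∧ v ≤ y) := by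
    intro u v
    rw [Cmd.exec_define_self]
    change (Tm.or _ _).Holds _ _ ↔ _
    simp only [bestTm, Tm.holds_or, Tm.holds_and, Tm.holds_all, Tm.holds_lt, Tm.holds_le,
      Tm.holds_eq, Tm.holds_get, Tm.eval_get, Tm.eval_var, update_add_two_zero,
      indexEnv_zero, Function.update_apply]
    have h12 : A2 12 u v ≠ 0 ↔ H.Adj u v := by
      rw [hA2, Cmd.exec_define_of_ne _ _ (by omega), a 12 (by omega) (by omega), hH]
    simp [-ne_eq, h12, Fin.ext_iff]
  by_cases hb : numBad lt H (k - 2) = 0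
  · refine ⟨H, .inl ⟨hb, rfl⟩, fun u v => ?_⟩
    rw [hA3]
    refine ⟨?_, .inl⟩
    rintro (h | ⟨h, -⟩)
    · exact h
    · refine absurd ?_ h
      rw [b15]
      split_ifs
      · rw [numBad, Set.ncard_eq_zero (Set.toFinite _)] at hb
        rw [score, Set.ncard_eq_zero (Set.toFinite _)]
        refine Set.eq_empty_of_forall_notMem fun e he => ?_
        have : e ∈ {e : Fin n × Fin n | IsBad lt H (k - 2) e.1 e.2} := he.1
        rw [hb] at this
        exact this
      · rfl
  · obtain ⟨⟨u, v⟩, huv⟩ := Set.nonempty_of_ncard_ne_zero hb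
    obtain ⟨x, y, h0, hmax, hiff⟩ := exists_first_max (fun u v : Fin n => A2 15 u v) ⟨u, v, by
      rw [b15, if_pos huv.1]
      exact (score_pos_of_isBad (by omega) huv).ne'⟩
    have hxy : lt x y := by
      by_contra hcon
      exact h0 (by rw [b15, if_neg hcon])
    refine ⟨⟨fun u v => H.Adj u v ∨ u = x ∧ v = y⟩, .inr ⟨x, y, hxy, ?_, fun x' y' h' => ?_,
      fun u v => Iff.rfl⟩, fun u v => ?_⟩
    · rw [b15, if_pos hxy] at h0
      omega
    · have := hmax x' y'
      rwa [b15, b15, if_pos hxy, if_pos h'] at this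
    · rw [hA3]
      exact or_congr Iff.rfl (hiff u v)

theorem greedyCmd_spec {n k D L : ℕ} {A : ℕ → ℕ → ℕ → ℕ} {lt : Fin n → Fin n → Prop}
    [IsStrictOrder (Fin n) lt] {id pos : Fin n → ℕ} {H : Digraph (Fin n)}
    (hlt : ∀ u v : Fin n, A 2 u v ≠ 0 ↔ lt u v) (hH : ∀ u v : Fin n, A 12 u v ≠ 0 ↔ H.Adj u v)
    (h : IsChained lt D L id pos H) (hD : 1 ≤ D) (hK : (2 * L + 4) * D ≤ k - 2) :
    ∃ H' : Digraph (Fin n),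
      (∀ u v : Fin n, (Cmd.loop (.loop stepCmd)).exec n k A 12 u v ≠ 0 ↔ H'.Adj u v) ∧
      IsChained lt D L id pos H' ∧ numBad lt H' (k - 2) = 0 ∧
      (numEdges H' : ℝ) ≤ numEdges H + (numNonmax lt + numNonmax lt * (2 * Real.log n *
        (n / (D : ℝ) ^ 3))) := by
  have hk : 3 ≤ k := by
    have : 1 ≤ (2 * L + 4) * D := Nat.mul_pos (by omega) hD
    omega
  let F : ℕ → Digraph (Fin n) := fun i => ⟨fun u v => (stepCmd.exec n k)^[i] A 12 u v ≠ 0⟩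
  have hF0 : F 0 = H := by
    ext u v
    exact hH u v
  have h2 : ∀ i (u v : Fin n), (stepCmd.exec n k)^[i] A 2 u v ≠ 0 ↔ lt u v := by
    intro i
    induction i with
    | zero => exact hlt
    | succ i ih =>
      intro u v
      rw [Function.iterate_succ_apply', Cmd.exec_of_notMem _ _ (by decide), ih]
  have hstep : ∀ i, IsChained lt D L id pos (F i) → IsGreedyStep lt (k - 2) (F i) (F (i + 1)) := by
    intro i hi
    obtain ⟨H', hs, hH'⟩ := stepCmd_spec (k := k) (A := (stepCmd.exec n k)^[i] A) hk (h2 i)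
      (H := F i) (fun u v => Iff.rfl) hi.reach
    have : F (i + 1) = H' := by
      ext u v
      rw [← hH' u v]
      simp only [F, Function.iterate_succ_apply']
    rwa [this]
  have hch : ∀ i, IsChained lt D L id pos (F i) := by
    intro i
    induction i with
    | zero => rwa [hF0]
    | succ i ih => exact ih.step (hstep i ih)
  -- The nested loop makes `n * n` greedy steps, one for each pair that could be bad.
  have hit : (Cmd.loop (.loop stepCmd)).exec n k A = (stepCmd.exec n k)^[n * n] A := by
    rw [Function.iterate_mul]
    rfl
  have hg := (hch 0).greedy hD hK (fun i => hstep i (hch i)) (T := n * n) (by simp)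
  rw [hF0, Fintype.card_fin] at hg
  exact ⟨F (n * n), fun u v => by rw [hit], hg⟩

/-! ### The algorithm -/

/-- All of the algorithm but its output. -/
def mainCmd : Cmd :=
  .seq reachCmd <| .seq paramCmd <| .seq chainCmd <| .seq graphCmd <| .loop (.loop stepCmd)

/-- The adjacency matrix of the output. -/
def outputTm : Tm :=
  .ite (.const 5)
    (.or (.get 12 (.var 2) (.var 3)) (.and (.not (.eq (.var 2) (.var 3)))
      (.and (.get 1 (.var 2) (.var 3)) (.and (.get 1 (.var 3) (.var 2))
        (.or (repTm (.var 2)) (repTm (.var 3)))))))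
    (.and (.not (.eq (.var 2) (.var 3))) (.get 1 (.var 2) (.var 3)))

theorem mainCmd_spec {n k : ℕ} (hk : 1 ≤ k) {A : ℕ → ℕ → ℕ → ℕ} {G : Digraph (Fin n)}
    (hA : ∀ u v : Fin n, A 0 u v ≠ 0 ↔ G.Adj u v) : ∃ H : Digraph (Fin n),
      (∀ u v : Fin n, (Cmd.seq mainCmd (.define 16 outputTm)).exec n k A 16 u v ≠ 0 ↔ H.Adj u v) ∧
      IsTCSpanner k G H ∧ (chainLength n k = 0 → H = offDiagClosure G) ∧
      (1 ≤ chainLength n k → (numEdges H : ℝ) ≤ numEdges (coverGraph (repLt G)) +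
        numNonmax (repLt G) * (Nat.log 2 n + 1) +
        (numNonmax (repLt G) + numNonmax (repLt G) * (2 * Real.log n *
          (n / (chainLength n k : ℝ) ^ 3))) + numEdges (starGraph G)) := by
  classical
  obtain ⟨r1, r2⟩ := reachCmd_spec (k := k) hA
  set D := chainLength n k
  set A1 := reachCmd.exec n k A with hA1
  set A2 := paramCmd.exec n k A1 with hA2
  have p5 : ∀ u v : Fin n, A2 5 u v = D := paramCmd_spec
  have p2 : ∀ u v : Fin n, A2 2 u v ≠ 0 ↔ repLt G u v := by
    rw [hA2, Cmd.exec_of_notMem _ _ (by decide)]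
    exact r2
  set A3 := chainCmd.exec n k A2 with hA3
  have c2 : ∀ u v : Fin n, A3 2 u v ≠ 0 ↔ repLt G u v := by
    rw [hA3, Cmd.exec_of_notMem _ _ (by decide)]
    exact p2
  set A4 := graphCmd.exec n k A3 with hA4
  have g2 : ∀ u v : Fin n, A4 2 u v ≠ 0 ↔ repLt G u v := by
    rw [hA4, Cmd.exec_of_notMem _ _ (by decide)]
    exact c2
  set A5 := (Cmd.loop (.loop stepCmd)).exec n k A4 with hA5
  have s5 : ∀ u v : Fin n, A5 5 u v = D := by
    rw [hA5, Cmd.exec_of_notMem _ _ (by decide), hA4, Cmd.exec_of_notMem _ _ (by decide), hA3,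
      Cmd.exec_of_notMem _ _ (by decide)]
    exact p5
  have s1 : ∀ u v : Fin n, A5 1 u v ≠ 0 ↔ Relation.TransGen G.Adj u v := by
    rw [hA5, Cmd.exec_of_notMem _ _ (by decide), hA4, Cmd.exec_of_notMem _ _ (by decide), hA3,
      Cmd.exec_of_notMem _ _ (by decide), hA2, Cmd.exec_of_notMem _ _ (by decide)]
    exact r1
  have hout : ∀ u v : Fin n, (Cmd.seq mainCmd (.define 16 outputTm)).exec n k A 16 u v ≠ 0 ↔
      if D = 0 then (offDiagClosure G).Adj u v else A5 12 u v ≠ 0 ∨ (starGraph G).Adj u v := by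
    intro u v
    have he : (Cmd.seq mainCmd (.define 16 outputTm)).exec n k A =
        (Cmd.define 16 outputTm).exec n k A5 := rfl
    rw [he, Cmd.exec_define_self, outputTm, Tm.eval_ite]
    by_cases h0 : D = 0
    · rw [if_neg (by simp [Tm.const, s5, h0]), if_pos h0]
      change (Tm.and _ _).Holds _ _ ↔ _
      rw [Tm.holds_and, Tm.holds_not, Tm.holds_eq, Tm.holds_get]
      simp only [Tm.eval_var, indexEnv_two, indexEnv_three, s1, offDiagClosure, Fin.val_inj, ne_eq]
    · rw [if_pos (by simp [Tm.const, s5, h0]), if_neg h0]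
      change (Tm.or _ _).Holds _ _ ↔ _
      rw [Tm.holds_or, Tm.holds_and, Tm.holds_and, Tm.holds_and, Tm.holds_or, Tm.holds_not,
        Tm.holds_eq, Tm.holds_get, Tm.holds_get, Tm.holds_get, (holds_repTm s1 u v).1,
        (holds_repTm s1 u v).2]
      simp only [Tm.eval_var, indexEnv_two, indexEnv_three, s1, starGraph, Fin.val_inj, ne_eq]
  by_cases h0 : D = 0
  · refine ⟨offDiagClosure G, fun u v => ?_, isTCSpanner_offDiag hk, fun _ => rfl, fun h => by omega⟩
    rw [hout, if_pos h0]
  · have h1 : 1 ≤ D := by omega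
    have hDn : D ≤ n := min_le_left _ _
    -- The distance allowed between representatives is `k - 2`, two steps being reserved for the
    -- star edges; `chainLength` is chosen to fit this budget.
    have hDw : (2 * (Nat.log 2 n + 1) + 4) * D ≤ k - 2 := by
      refine (Nat.mul_le_mul_left _ (min_le_right _ _)).trans (Nat.mul_div_le _ _)
    have hDL : D < 2 ^ (Nat.log 2 n + 1) := hDn.trans_lt (Nat.lt_pow_succ_log_self (by omega) n)
    obtain ⟨id, pos, he, h7, h8⟩ := chainCmd_spec (k := k) p2 p5 h1 hDn
    have hg := graphCmd_spec (k := k) c2 h7 h8 he.system hDn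
    have hch := IsExtraction.isChained (L := Nat.log 2 n + 1) (lt := repLt G) (D := D) (id := id)
      (pos := pos) (by rwa [Fintype.card_fin]) hDL
    obtain ⟨H, hH, hc, hb, hcount⟩ := greedyCmd_spec (k := k) g2 hg hch h1 hDw
    have hk3 : 2 ≤ k := by
      have := Nat.mul_pos (show 0 < 2 * (Nat.log 2 n + 1) + 4 by omega) h1
      omega
    refine ⟨H ⊔ starGraph G, fun u v => ?_, isTCSpanner_sup_star (K := k - 2) (by omega) hc.sub
      fun u v huv => ?_, fun h => absurd h h0, fun _ => ?_⟩
    · rw [hout, if_neg h0, hH]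
      rfl
    · by_contra hcon
      rw [numBad, Set.ncard_eq_zero (Set.toFinite _)] at hb
      have : (u, v) ∈ {e : Fin n × Fin n | IsBad (repLt G) H (k - 2) e.1 e.2} := ⟨huv, hcon⟩
      rw [hb] at this
      exact this
    · have e1 : (numEdges (H ⊔ starGraph G) : ℝ) ≤ numEdges H + numEdges (starGraph G) := by
        exact_mod_cast numEdges_sup_le _ _
      have e2 : (numEdges (coverGraph (repLt G) ⊔ chainGraph id pos) : ℝ) ≤
          numEdges (coverGraph (repLt G)) + numEdges (chainGraph id pos) := by
        exact_mod_cast numEdges_sup_le _ _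
      have e3 : (numEdges (chainGraph id pos) : ℝ) ≤
          numNonmax (repLt G) * (Nat.log 2 n + 1) := by
        exact_mod_cast he.system.numEdges_le hDL
      linarith

/-! ### The approximation ratio -/

/-- Both summands are at most log(n + 2) / log 2, and 2 / 0.69 is less than 3. -/
theorem natLog_add_one_le (n : ℕ) : (Nat.log 2 n : ℝ) + 1 ≤ 3 * Real.log (n + 2) := by
  have h2 := Real.log_two_gt_d9
  have h1 : Real.log 2 ≤ Real.log (n + 2) :=
    Real.log_le_log (by norm_num) (by linarith [Nat.cast_nonneg (α := ℝ) n])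
  have h3 : (Nat.log 2 n : ℝ) * Real.log 2 ≤ Real.log (n + 2) := by
    rcases Nat.eq_zero_or_pos n with rfl | hn
    · simp
      positivity
    · rw [← Real.log_pow]
      refine Real.log_le_log (by positivity) ?_
      have : ((2 ^ Nat.log 2 n : ℕ) : ℝ) ≤ n := by exact_mod_cast Nat.pow_log_le_self 2 hn.ne'
      push_cast at this
      linarith
  have h4 : (Nat.log 2 n : ℝ) * 0.69 ≤ (Nat.log 2 n : ℝ) * Real.log 2 :=
    mul_le_mul_of_nonneg_left (by linarith) (Nat.cast_nonneg _)
  linarith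

/-- If `k` is at most `a * x`, then `n / x ^ 3` is at most `a ^ 3 * max 1 (n / k ^ 3)`. -/
theorem div_pow_three_le {n k a x : ℝ} (hn : 0 ≤ n) (hk : 0 < k) (hx : 0 < x) (ha : 0 ≤ a)
    (h : k ≤ a * x) : n / x ^ 3 ≤ a ^ 3 * max 1 (n / k ^ 3) := by
  refine le_trans ?_ (mul_le_mul_of_nonneg_left (le_max_right _ _) (by positivity))
  rw [mul_div_assoc', div_le_div_iff₀ (by positivity) (by positivity)]
  have : k ^ 3 ≤ (a * x) ^ 3 := pow_le_pow_left₀ hk.le h 3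
  calc n * k ^ 3 ≤ n * (a * x) ^ 3 := mul_le_mul_of_nonneg_left this hn
    _ = a ^ 3 * n * x ^ 3 := by ring

/-- There are three regimes: chain length 0, where `k` is logarithmic; chain length `n`, where n /
n³ ≤ 1; and otherwise a chain length that is `k` up to a factor `36 * l`. The cube of this factor
and the logarithm from the greedy run give the exponent 4. -/
theorem approximates_of_mainCmd {n k : ℕ} (hk : 1 ≤ k) {G H H' : Digraph (Fin n)}
    (hH' : IsTCSpanner k G H') (h0 : chainLength n k = 0 → H = offDiagClosure G)
    (h1 : 1 ≤ chainLength n k → (numEdges H : ℝ) ≤ numEdges (coverGraph (repLt G)) +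
        numNonmax (repLt G) * (Nat.log 2 n + 1) +
        (numNonmax (repLt G) + numNonmax (repLt G) * (2 * Real.log n *
          (n / (chainLength n k : ℝ) ^ 3))) + numEdges (starGraph G)) :
    (numEdges H : ℝ) ≤ 100000 * Real.log ((n : ℝ) + 2) ^ 4 * max 1 ((n : ℝ) / (k : ℝ) ^ 3) *
      numEdges H' := by
  set l := Real.log ((n : ℝ) + 2) with hl
  set r := max 1 ((n : ℝ) / (k : ℝ) ^ 3) with hr
  set M : ℝ := (numEdges H' : ℝ) with hM
  have hn0 : (0 : ℝ) ≤ n := Nat.cast_nonneg n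
  have hM0 : 0 ≤ M := Nat.cast_nonneg _
  have hr1 : 1 ≤ r := le_max_left _ _
  have hkpos : (0 : ℝ) < k := by exact_mod_cast hk
  have hl1 : 1 ≤ 3 / 2 * l := by
    have h2 := Real.log_two_gt_d9
    have : Real.log 2 ≤ l := Real.log_le_log (by norm_num) (by linarith)
    linarith
  have hl0 : 0 < l := by linarith
  have hL : (Nat.log 2 n : ℝ) + 1 ≤ 3 * l := natLog_add_one_le n
  have hw : ((2 * (Nat.log 2 n + 1) + 4 : ℕ) : ℝ) ≤ 12 * l := by
    push_cast
    linarith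
  have hlog : Real.log n ≤ l := by
    rcases Nat.eq_zero_or_pos n with rfl | hn
    · simp only [Nat.cast_zero, Real.log_zero]
      exact hl0.le
    · exact Real.log_le_log (by exact_mod_cast hn) (by linarith)
  -- Since `l ≥ 2 / 3`, lower powers of `l` are absorbed by `l ^ 4` at the price of powers of 3/2.
  have hpow : ∀ m : ℕ, m ≤ 4 → l ^ m ≤ (3 / 2) ^ (4 - m) * l ^ 4 := by
    intro m hm
    have : (1 : ℝ) ≤ (3 / 2 * l) ^ (4 - m) := one_le_pow₀ hl1
    calc l ^ m ≤ l ^ m * (3 / 2 * l) ^ (4 - m) := le_mul_of_one_le_right (by positivity) this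
      _ = (3 / 2) ^ (4 - m) * (l ^ m * l ^ (4 - m)) := by rw [mul_pow]; ring
      _ = _ := by rw [← pow_add, Nat.add_sub_cancel' hm]
  rcases Nat.eq_zero_or_pos (chainLength n k) with hD | hD
  · rw [h0 hD]
    have e1 : (numEdges (offDiagClosure G) : ℝ) ≤ M * n := by
      rw [hM]; exact_mod_cast hH'.numEdges_offDiag_le
    have e2 : (n : ℝ) ≤ 100000 * l ^ 4 * r := by
      rcases Nat.eq_zero_or_pos n with hn | hn
      · rw [hn, Nat.cast_zero]
        positivity
      · have hdiv : (k - 2) / (2 * (Nat.log 2 n + 1) + 4) = 0 := by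
          rw [chainLength] at hD
          omega
        -- Chain length 0 with `n > 0` means that the quotient vanishes, so `k` is at most one more
        -- than a logarithmic term.
        have hkw : k ≤ (2 * (Nat.log 2 n + 1) + 4) + 1 := by
          have := (Nat.div_eq_zero_iff_lt (by omega)).1 hdiv
          omega
        have hkw' : (k : ℝ) ≤ 36 * l * 1 := by
          have : (k : ℝ) ≤ ((2 * (Nat.log 2 n + 1) + 4 : ℕ) : ℝ) + 1 := by exact_mod_cast hkw
          linarith
        have := div_pow_three_le hn0 hkpos one_pos (by positivity) hkw'
        rw [one_pow, div_one, mul_pow] at this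
        have h3 := hpow 3 (by omega)
        have h4 : l ^ 3 * r ≤ (3 / 2) * l ^ 4 * r := by
          norm_num at h3
          exact mul_le_mul_of_nonneg_right h3 (by linarith)
        have h5 : 0 ≤ l ^ 4 * r := by positivity
        linarith
    calc (numEdges (offDiagClosure G) : ℝ) ≤ M * n := e1
      _ ≤ M * (100000 * l ^ 4 * r) := mul_le_mul_of_nonneg_left e2 hM0
      _ = _ := by ring
  · have hDpos : (0 : ℝ) < chainLength n k := by exact_mod_cast hD
    have e1 : (numEdges (coverGraph (repLt G)) : ℝ) ≤ M := by rw [hM]; exact_mod_cast hH'.numEdges_cover_le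
    have e2 : (numNonmax (repLt G) : ℝ) ≤ M := by rw [hM]; exact_mod_cast hH'.numNonmax_le
    have e3 : (numEdges (starGraph G) : ℝ) ≤ 2 * M := by rw [hM]; exact_mod_cast hH'.numEdges_star_le
    have e4 : (n : ℝ) / (chainLength n k : ℝ) ^ 3 ≤ (36 * l) ^ 3 * r := by
      rcases Nat.le_total n ((k - 2) / (2 * (Nat.log 2 n + 1) + 4)) with hle | hle
      · rw [chainLength, min_eq_left hle] at hDpos ⊢
        have hn1 : (1 : ℝ) ≤ n := by exact_mod_cast Nat.one_le_iff_ne_zero.2 (by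
          rintro rfl
          simp at hDpos)
        have : (n : ℝ) / (n : ℝ) ^ 3 ≤ 1 := by
          rw [div_le_one (by positivity)]
          exact le_self_pow₀ hn1 (by omega)
        have h36 : (1 : ℝ) ≤ (36 * l) ^ 3 := one_le_pow₀ (by linarith)
        exact this.trans (one_le_mul_of_one_le_of_one_le h36 hr1)
      · rw [chainLength, min_eq_right hle] at hD hDpos ⊢
        set w := 2 * (Nat.log 2 n + 1) + 4 with hwdef
        refine div_pow_three_le hn0 hkpos hDpos (by positivity) ?_
        -- With `q = (k - 2) / w ≥ 1`, rounding gives `k ≤ w * q + w + 1`, and both `w` and 1 are at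
        -- most `w * q`.
        have hkw : k ≤ 3 * w * ((k - 2) / w) := by
          have h5 := Nat.lt_mul_div_succ (k - 2) (show 0 < w by omega)
          have h6 : w * ((k - 2) / w + 1) = w * ((k - 2) / w) + w := by ring
          have h7 : w ≤ w * ((k - 2) / w) := Nat.le_mul_of_pos_right w hD
          have h8 : 3 * w * ((k - 2) / w) = 3 * (w * ((k - 2) / w)) := by ring
          omega
        have : (k : ℝ) ≤ 3 * (w : ℝ) * (((k - 2) / w : ℕ) : ℝ) := by exact_mod_cast hkw
        refine this.trans (mul_le_mul_of_nonneg_right ?_ hDpos.le)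
        linarith
    have hlog0 : 0 ≤ Real.log n := Real.log_natCast_nonneg n
    have e5 : 2 * Real.log n * (n / (chainLength n k : ℝ) ^ 3) ≤ 2 * l * ((36 * l) ^ 3 * r) :=
      mul_le_mul (by linarith) e4 (by positivity) (by positivity)
    have e6 : (numNonmax (repLt G) : ℝ) * (2 * Real.log n * (n / (chainLength n k : ℝ) ^ 3)) ≤
        M * (2 * l * ((36 * l) ^ 3 * r)) := mul_le_mul e2 e5 (by positivity) hM0
    have e7 : (numNonmax (repLt G) : ℝ) * (Nat.log 2 n + 1) ≤ M * (3 * l) :=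
      mul_le_mul e2 hL (by positivity) hM0
    -- The 4 collects cover edges, the additive term of the greedy bound and twice the star edges;
    -- `3 * l` comes from the chain shortcuts. As 2 · 36³ = 93312, the constant 100000 leaves room
    -- for both.
    have e8 : 4 + 3 * l + 2 * l * ((36 * l) ^ 3 * r) ≤ 100000 * l ^ 4 * r := by
      have q0 := hpow 0 (by omega)
      have q1 := hpow 1 (by omega)
      norm_num at q0 q1
      have q2 : l ^ 4 ≤ l ^ 4 * r := le_mul_of_one_le_right (by positivity) hr1
      have q3 : 2 * l * ((36 * l) ^ 3 * r) = 93312 * (l ^ 4 * r) := by ring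
      rw [q3]
      linarith
    calc (numEdges H : ℝ) ≤ M * (4 + 3 * l + 2 * l * ((36 * l) ^ 3 * r)) := by
          have := h1 hD
          linarith
      _ ≤ M * (100000 * l ^ 4 * r) := mul_le_mul_of_nonneg_left e8 hM0
      _ = _ := by ring

end TCSpanner

theorem corollary1p3 :
    ∃ (p : TCSpanner.Prog) (T : Polynomial ℕ) (C : ℝ) (c : ℕ),
      TCSpanner.Approximates p (fun n => T.eval n)
        (fun n k => C * Real.log ((n : ℝ) + 2) ^ c * max 1 ((n : ℝ) / (k : ℝ) ^ 3)) := by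
  obtain ⟨p, T, h⟩ := TCSpanner.Cmd.realize TCSpanner.mainCmd 16 TCSpanner.outputTm
  refine ⟨p, T, 100000, 4, fun n G k hk => ?_⟩
  obtain ⟨t, s, hrun, ht, hs⟩ := h n G k
  obtain ⟨H, hH, hsp, h0, h1⟩ := TCSpanner.mainCmd_spec (k := k) hk
    (A := TCSpanner.inputArrs G) (G := G) (fun u v => by
      simp [TCSpanner.inputArrs, TCSpanner.inputStore, TCSpanner.Store.arrs])
  have he : TCSpanner.outputGraph n s = H := by
    ext u v
    rw [hs, hH]
  refine ⟨t, s, hrun, ht, he ▸ hsp, fun H' hH' => ?_⟩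
  rw [he]
  exact TCSpanner.approximates_of_mainCmd hk hH' h0 h1
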